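/- **Setting.** Let $\mathcal X$ be a measurable space of contexts, $\mathcal A=\{1,\dots,K\}$ a finite action set, and $D$ a probability law on pairs $(x,r)$ with $x\in\mathcal X$ and $r\in[0,1]^K$; $D_{\mathcal X}$ is its context marginal. Let $\mathcal F$ be a class of measurable predictors $f:\mathcal X\times\mathcal A\to[0,1]$ which is pointwise separable (some countable $\mathcal F_0\subseteq\mathcal F$ is such that every $f\in\mathcal F$ is a pointwise limit of a sequence in $\mathcal F_0$; automatic if $\mathcal F$ is countable). Assume realizability: some $f^\star\in\mathcal F$ satisfies $\mathbb E[r(a)\mid x]=f^\star(x,a)$ for all $a$. Let $\pi^\star(x)\in\arg\max_a f^\star(x,a)$ be a measurable greedy policy. In rounds $t=1,\dots,T$, $T\ge 2$, a pair $(x_t,r_t)\sim D$ is drawn independently of the past, the learner sees $x_t$, chooses $a_t$ and observes $r_t(a_t)$. The regret is $\mathrm{Reg}_T=\sum_{t\le T} r_t(\pi^\star(x_t))-\sum_{t\le T}r_t(a_t)$. Let $L_1>0$ be the smallest constant with $(f(x,a)-f^\star(x,a))^2\le L_1\,\mathbb E_{x'\sim D_{\mathcal X}}\mathbb E_{a'\sim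 \mathrm{Unif}(\mathcal A)}(f(x',a')-f^\star(x',a'))^2$ for all $f\in\mathcal F$, $x$, $a$; assume that it exists (in particular $\mathcal F\ne\{f^\star\}$). For $\lambda\in(0,1)$ let $U_\lambda(a)=\{x: f^\star(x,a)\ge f^\star(x,a')+\lambda\ \forall a'\ne a\}$, and let $L_{2,\lambda}>0$ be the smallest constant with $(f(x,a)-f^\star(x,a))^2\le L_{2,\lambda}\,\mathbb E_{x'}\mathbb E_{a'}\big[\mathbf 1\{x'\in U_\lambda(a')\}(f(x',a')-f^\star(x',a'))^2\big]$ for all $f,x,a$. The Massart condition with margin $\gamma>0$ says that $f^\star(x,\pi^\star(x))\ge f^\star(x,a)+\gamma$ for all $x$ and all $a\ne\pi^\star(x)$. For $\delta\in(0,1)$ let $$C'_\delta=\min\Big\{16\log\tfrac{2|\mathcal F|T^2}{\delta},\ \inf_{\varepsilon>0}\Big(100\,\varepsilon KT+320\sum_{a\in\mathcal A}\log\tfrac{8\,\mathbb E_{x_{1:T}}[\mathcal N_1(\mathcal F|_a,\varepsilon,x_{1:T})]\,K T^2\log T}{\delta}\Big)\Big\}$$ or, if $\mathcal F$ is finite,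 alternatively $C'_\delta=16\log(2|\mathcal F|T^2/\delta)$. Here $\mathcal F|_a=\{f(\cdot,a):f\in\mathcal F\}$, the $x_{1:T}$ are i.i.d. from $D_{\mathcal X}$, and $\mathcal N_1(\mathcal G,\varepsilon,x_{1:T})$ is the least size of a set $V\subseteq\mathbb R^T$ such that each $g\in\mathcal G$ has some $v\in V$ with $\frac1T\sum_t|g(x_t)-v_t|\le\varepsilon$. **Algorithm (RegCB.Optimistic).** Let $\tau_m=2^{m-1}$, $M=\lfloor\log_2T\rfloor+1$, $\beta_m=\frac{(M-m+1)C'_\delta}{\tau_m-1}$ and $M_0=2+\big\lfloor\log_2\big(1+\frac{(2M+3)L_1C'_\delta}{\lambda^2}\big)\big\rfloor$. In rounds $t<\tau_{M_0}$, $a_t$ is drawn uniformly from $\mathcal A$. In a round $t$ of epoch $m\ge M_0$ ($\tau_m\le t<\tau_{m+1}$), $a_t\in\arg\max_a\sup_{f\in\mathcal F_m}f(x_t,a)$, where $\mathcal F_m=\{f\in\mathcal F:\hat R_m(f)-\inf_{\mathcal F}\hat R_m\le\beta_m\}$ and $\hat R_m(f)=\frac1{\tau_m-1}\sum_{s<\tau_m}(f(x_s,a_s)-r_s(a_s))^2$.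 Ties are broken arbitrarily from the past, the current context and internal randomness. **Theorem.** The constants in $O$ and $\tilde O$ below are universal, and $\tilde O$ hides factors polynomial in $1+\log T$, $1+\log K$ and $1+\log(1/\delta)$. 1. If $L_{2,\lambda}$ exists, then with probability at least $1-\delta$, $$\mathrm{Reg}_T=O\Big(\frac{L_1C'_\delta\log T}{\lambda^2}+\sqrt{TL_{2,\lambda}C'_\delta}\,\log T\Big),$$ and for finite $\mathcal F$, with probability at least $1-\delta$, $\mathrm{Reg}_T=\tilde O\big(\frac{L_1\log|\mathcal F|}{\lambda^2}+\sqrt{TL_{2,\lambda}\log|\mathcal F|}\big)$. 2. Under the Massart condition with margin $\gamma\ge\lambda$, with probability at least $1-\delta$ we have $a_t=\pi^\star(x_t)$ for all $\tau_{M_0}\le t\le T$ (no regret after the warm start) and $\mathrm{Reg}_T=O\big(\frac{L_1C'_\delta\log T}{\lambda^2}\big)$. 3. Under the Massart condition with margin $\gamma$ and with $\delta=1/T$, $$\mathbb E[\mathrm{Reg}_T]=O\Big(\frac{L_1C'_{1/T}\log T}{\lambda^2}+\frac{L_{2,\lambda}C'_{1/T}\log^2T}{\gamma}\mathbf 1\{\lambda>\gamma\}\Big),$$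 which for finite $\mathcal F$ is $\tilde O\big(\frac{L_1\log|\mathcal F|}{\lambda^2}+\frac{L_{2,\lambda}\log|\mathcal F|}{\gamma}\mathbf 1\{\lambda>\gamma\}\big)$. The existence of $L_{2,\lambda}$ is needed here only if $\lambda>\gamma$. -/

import Mathlib

open MeasureTheory ProbabilityTheory Set

namespace RegCB

/-! The action set is `Fin K`. A predictor is a function `X → Fin K → ℝ` with values in `[0,1]`, and
`D` is a law on pairs (context, reward vector). Rounds are numbered `1, …, T`. -/

/-- The standing assumptions on a stochastic contextual bandit instance. -/
structure IsInstance {X : Type*} [MeasurableSpace X] {K : ℕ} (D : Measure (X × (Fin K → ℝ)))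
    (F : Set (X → Fin K → ℝ)) (fstar : X → Fin K → ℝ) (pistar : X → Fin K) : Prop where
  prob : IsProbabilityMeasure D
  /-- rewards lie in `[0,1]` -/
  reward_mem : ∀ᵐ z ∂D, ∀ k, z.2 k ∈ Icc (0 : ℝ) 1
  /-- predictors take values in `[0,1]` -/
  pred_mem : ∀ f ∈ F, ∀ x k, f x k ∈ Icc (0 : ℝ) 1
  pred_meas : ∀ f ∈ F, ∀ k, Measurable fun x => f x k
  /-- the class is pointwise separable (the usual measurability condition for suprema over an
  uncountable class; automatic when `F` is countable) -/
  separable : ∃ F₀ ⊆ F, F₀.Countable ∧ ∀ f ∈ F, ∃ s : ℕ → X → Fin K → ℝ, (∀ n, s n ∈ F₀) ∧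
    ∀ x k, Filter.Tendsto (fun n => s n x k) Filter.atTop (nhds (f x k))
  /-- realizability: `fstar ∈ F` and `E[r(k) | x] = fstar(x,k)` -/
  star_mem : fstar ∈ F
  realizable : ∀ k, condExp (MeasurableSpace.comap Prod.fst inferInstance) D (fun z => z.2 k)
    =ᵐ[D] fun z => fstar z.1 k
  /-- `pistar` is a greedy policy of `fstar`, with some fixed tie-breaking -/
  policy_meas : Measurable pistar
  policy_greedy : ∀ x k, fstar x k ≤ fstar x (pistar x)

/-- `L₁ > 0` is the smallest constant such that for all `f ∈ F`, `x` and `k`,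
`(f(x,k) - fstar(x,k))² ≤ L₁ E_{x'} E_{k' ~ Unif} (f(x',k') - fstar(x',k'))²`. -/
def IsSurpriseBound {X : Type*} [MeasurableSpace X] {K : ℕ} (D : Measure (X × (Fin K → ℝ)))
    (F : Set (X → Fin K → ℝ)) (fstar : X → Fin K → ℝ) (L₁ : ℝ) : Prop :=
  IsLeast {L : ℝ | 0 < L ∧ ∀ f ∈ F, ∀ x k, (f x k - fstar x k) ^ 2 ≤
    L * ∫ x', (1 / (K : ℝ)) * ∑ k', (f x' k' - fstar x' k') ^ 2 ∂(D.map Prod.fst)} L₁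

/-- The contexts at which action `k` is best by a margin of `lam`. -/
def marginSet {X : Type*} {K : ℕ} (fstar : X → Fin K → ℝ) (lam : ℝ) (k : Fin K) : Set X :=
  {x | ∀ k', k' ≠ k → fstar x k' + lam ≤ fstar x k}

/-- `L₂ > 0` is the implicit exploration coefficient `L_{2,lam}`: the smallest constant such that
for all `f ∈ F`, `x` and `k`, `(f(x,k) - fstar(x,k))² ≤
L₂ E_{x'} E_{k' ~ Unif} [1{x' ∈ U_lam(k')} (f(x',k') - fstar(x',k'))²]`. -/
def IsIEC {X : Type*} [MeasurableSpace X] {K : ℕ} (D : Measure (X × (Fin K → ℝ)))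
    (F : Set (X → Fin K → ℝ)) (fstar : X → Fin K → ℝ) (lam L₂ : ℝ) : Prop :=
  IsLeast {L : ℝ | 0 < L ∧ ∀ f ∈ F, ∀ x k, (f x k - fstar x k) ^ 2 ≤
    L * ∫ x', (1 / (K : ℝ)) * ∑ k', (marginSet fstar lam k').indicator
      (fun y => (f y k' - fstar y k') ^ 2) x' ∂(D.map Prod.fst)} L₂

/-- The Massart noise condition with margin `γ`. -/
def IsMassart {X : Type*} {K : ℕ} (fstar : X → Fin K → ℝ) (pistar : X → Fin K) (γ : ℝ) : Prop :=
  0 < γ ∧ ∀ x k, k ≠ pistar x → fstar x k + γ ≤ fstar x (pistar x)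

/-! ### The confidence radius -/

/-- The empirical `L₁` covering number `N₁(G, ε, x_{1:T})` (with arbitrary centres in `ℝ^T`). -/
noncomputable def coveringNumber {X : Type*} {T : ℕ} (G : Set (X → ℝ)) (ε : ℝ) (xs : Fin T → X) :
    ℕ∞ :=
  ⨅ (V : Finset (Fin T → ℝ))
    (_ : ∀ g ∈ G, ∃ v ∈ V, (1 / (T : ℝ)) * ∑ t, |g (xs t) - v t| ≤ ε), (V.card : ℕ∞)

/-- The expected covering number `E N₁(F|_k, ε, x_{1:T})` for i.i.d. contexts, where
`F|_k = {x ↦ f(x,k) : f ∈ F}`. It is finite for all classes with values in `[0,1]`. -/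
noncomputable def expectedCover {X : Type*} [MeasurableSpace X] {K : ℕ}
    (D : Measure (X × (Fin K → ℝ))) (F : Set (X → Fin K → ℝ)) (T : ℕ) (ε : ℝ) (k : Fin K) : ℝ :=
  (∫⁻ xs : Fin T → X, (coveringNumber ((fun f x => f x k) '' F) ε xs : ENNReal)
    ∂(Measure.pi fun _ => D.map Prod.fst)).toReal

/-- `16 log(2 |F| T² / δ)`, for finite classes. -/
noncomputable def finiteRadius {X : Type*} {K : ℕ} (F : Set (X → Fin K → ℝ)) (T : ℕ) (δ : ℝ) : ℝ :=
  16 * Real.log (2 * F.ncard * (T : ℝ) ^ 2 / δ)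

/-- `inf_{ε > 0} {100 ε K T + 320 ∑_k log(8 E[N₁(F|_k, ε, x_{1:T})] K T² log T / δ)}`. -/
noncomputable def coverRadius {X : Type*} [MeasurableSpace X] {K : ℕ}
    (D : Measure (X × (Fin K → ℝ))) (F : Set (X → Fin K → ℝ)) (T : ℕ) (δ : ℝ) : ℝ :=
  sInf ((fun ε : ℝ => 100 * ε * K * T + 320 * ∑ k : Fin K,
    Real.log (8 * expectedCover D F T ε k * K * (T : ℝ) ^ 2 * Real.log T / δ)) '' Ioi 0)

/-- The admissible values of `C'_δ`: for a finite class, `16 log(2 |F| T² / δ)`; for every class,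
the minimum of this quantity (infinite if `F` is infinite) and the covering number bound. -/
def IsRadius {X : Type*} [MeasurableSpace X] {K : ℕ}
    (D : Measure (X × (Fin K → ℝ))) (F : Set (X → Fin K → ℝ)) (T : ℕ) (δ C : ℝ) : Prop :=
  (F.Finite ∧ (C = finiteRadius F T δ ∨ C = min (finiteRadius F T δ) (coverRadius D F T δ))) ∨
  (F.Infinite ∧ C = coverRadius D F T δ)

/-! ### The algorithm -/

/-- Epoch `m ≥ 1` starts in round `2^(m-1)`. -/
def epochStart (m : ℕ) : ℕ := 2 ^ (m - 1)

/-- The number `M` of epochs that are started within `T ≥ 1` rounds. -/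
def numEpochs (T : ℕ) : ℕ := Nat.log 2 T + 1

/-- The tolerance `β_m = (M - m + 1) C / (τ_m - 1)`. -/
noncomputable def tolerance (T : ℕ) (C : ℝ) (m : ℕ) : ℝ :=
  ((numEpochs T : ℝ) - m + 1) * C / ((epochStart m : ℝ) - 1)

/-- `M₀ = 2 + ⌊log₂(1 + (2M+3) L₁ C / lam²)⌋`. -/
noncomputable def warmStart (T : ℕ) (L₁ C lam : ℝ) : ℕ :=
  2 + ⌊Real.logb 2 (1 + (2 * (numEpochs T : ℝ) + 3) * L₁ * C / lam ^ 2)⌋₊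

/-- The empirical square loss of `f` before epoch `m`, for contexts `x s`, actions `a s` and observed
rewards `y s`. -/
noncomputable def empRisk {X : Type*} {K : ℕ} (x : ℕ → X) (a : ℕ → Fin K) (y : ℕ → ℝ) (m : ℕ)
    (f : X → Fin K → ℝ) : ℝ :=
  (1 / ((epochStart m : ℝ) - 1)) * ∑ s ∈ Finset.Ico 1 (epochStart m), (f (x s) (a s) - y s) ^ 2

/-- The version space of epoch `m` with tolerance `β`; all of `F` if `m = 1`. -/
def versionSpace {X : Type*} {K : ℕ} (F : Set (X → Fin K → ℝ)) (x : ℕ → X) (a : ℕ → Fin K)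
    (y : ℕ → ℝ) (m : ℕ) (β : ℝ) : Set (X → Fin K → ℝ) :=
  {f | f ∈ F ∧ (2 ≤ m → empRisk x a y m f - sInf (empRisk x a y m '' F) ≤ β)}

/-- The upper reward bound of a class at a context-action pair. -/
noncomputable def high {X : Type*} {K : ℕ} (F : Set (X → Fin K → ℝ)) (x : X) (k : Fin K) : ℝ :=
  sSup ((fun f => f x k) '' F)

/-- The contexts `x t`, reward vectors `r t` and actions `a t` (rounds `1, …, T`), random variables
on `(Ω, P)`, arise from running the optimistic algorithm with tolerances `β` and `M₀` warm-start
epochs on the i.i.d. environment `D`. -/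
structure IsOptimisticRun {X Ω : Type*} [MeasurableSpace X] [mΩ : MeasurableSpace Ω] {K : ℕ}
    (D : Measure (X × (Fin K → ℝ))) (F : Set (X → Fin K → ℝ)) (T M₀ : ℕ) (β : ℕ → ℝ)
    (P : Measure Ω) (x : ℕ → Ω → X) (r : ℕ → Ω → Fin K → ℝ) (a : ℕ → Ω → Fin K) : Prop where
  prob : IsProbabilityMeasure P
  meas : ∀ t ∈ Finset.Icc 1 T, Measurable (x t) ∧ Measurable (r t) ∧ Measurable (a t)
  /-- each context-reward pair has law `D` -/
  law : ∀ t ∈ Finset.Icc 1 T, P.map (fun ω => (x t ω, r t ω)) = D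
  /-- non-anticipation: `G t` comprises the previous rounds and the learner's internal randomness
  (that used for breaking ties or exploring in round `t` included). The pair `(x t, r t)` is drawn
  independently of it, and `a t` is chosen from it and `x t` alone. -/
  nonanticipating : ∃ G : Filtration ℕ mΩ, ∀ t ∈ Finset.Icc 1 T,
    (∀ s ∈ Finset.Ico 1 t, Measurable[G t] (x s) ∧ Measurable[G t] (r s) ∧ Measurable[G t] (a s)) ∧
    Indep (MeasurableSpace.comap (fun ω => (x t ω, r t ω)) inferInstance) (G t) P ∧
    Measurable[G t ⊔ MeasurableSpace.comap (x t) inferInstance] (a t)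
  /-- pure exploration before epoch `M₀`: the action is uniform, and independent of the past and of
  the current context and rewards -/
  explore : ∀ t ∈ Finset.Icc 1 T, t < epochStart M₀ →
    (∀ k, P.real {ω | a t ω = k} = 1 / (K : ℝ)) ∧
    Indep (MeasurableSpace.comap (a t) inferInstance)
      ((⨆ s ∈ Finset.Ico 1 t,
          MeasurableSpace.comap (fun ω => (x s ω, r s ω, a s ω)) inferInstance) ⊔
        MeasurableSpace.comap (fun ω => (x t ω, r t ω)) inferInstance) P
  /-- from epoch `M₀` on, the action maximizes the upper reward bound over the version space of the
  current epoch, which is computed from the observed rewards -/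
  optimistic : ∀ᵐ ω ∂P, ∀ m, M₀ ≤ m → ∀ t ∈ Finset.Icc 1 T,
    epochStart m ≤ t → t < epochStart (m + 1) → ∀ k,
      high (versionSpace F (fun s => x s ω) (fun s => a s ω) (fun s => r s ω (a s ω)) m (β m))
        (x t ω) k ≤
      high (versionSpace F (fun s => x s ω) (fun s => a s ω) (fun s => r s ω (a s ω)) m (β m))
        (x t ω) (a t ω)

/-- The regret after `T` rounds. -/
def regret {X Ω : Type*} {K : ℕ} (pistar : X → Fin K) (T : ℕ)
    (x : ℕ → Ω → X) (r : ℕ → Ω → Fin K → ℝ) (a : ℕ → Ω → Fin K) (ω : Ω) : ℝ :=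
  ∑ t ∈ Finset.Icc 1 T, r t ω (pistar (x t ω)) - ∑ t ∈ Finset.Icc 1 T, r t ω (a t ω)

/-- The logarithmic factors that are suppressed in soft-O bounds. -/
noncomputable def logFactor (K T : ℕ) (δ : ℝ) : ℝ :=
  (1 + Real.log T) * (1 + Real.log K) * (1 + Real.log (1 / δ))

end RegCB

namespace RegCB

/-! ### Independence of sequentially drawn variables -/

/-! Everything happens on one event of probability at least 1 - δ/2 (`IsGoodPath`), on which two
kinds of bounds hold for all f ∈ F at once. First, the squared distance of f to `fstar`, summed over
the past contexts and played actions, is at most 4/3 of the total excess square loss plus C/3.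
Second, certain expected squared distances are at most 3/2 of their empirical counterparts plus
2C/5. The first kind shows that `fstar` is in every version space and that the summed squared
distance of any surviving f is O(MC) (`IsGoodPath.star_mem`, `IsGoodPath.sum_sq_le`).

During the warm start actions are uniform, so the second kind turns this sum into a population
bound, and L₁ turns the population bound into a uniform width w < lam (`IsGoodPath.exists_width`).
Optimism makes the gap of the played action at most the width. Hence, after the warm start, an
action that is best by a margin of lam is always played (`IsGoodPath.action_eq`). This is implicit
exploration: the later data contain (f - fstar)² at (x, k) whenever x ∈ U_lam(k), so the second kind
of bound together with L₂ gives width² = O(L₂ M C / τ_m) without any further forced exploration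
(`IsGoodPath.width_le`). Gaps of order t^(-1/2) sum to √T. Under the Massart condition a nonzero gap
is at least γ, so it is at most width² / γ, and the sum is logarithmic; if lam ≤ γ there are no
mistakes at all.

The two kinds of deviation bounds need different tools. The excess losses involve adaptively chosen
actions. They are handled in a filtration that knows all contexts in advance: the rewards keep their
conditional means, the cover of the class at x_1, …, x_T is predictable, and each of its elements
gives an exponential supermartingale (`IsRewardFiltration.measure_excess_lt_le`). The expected
distances involve only independent contexts and exploratory actions. They are handled by
symmetrization with a ghost sample, which costs the square of the expected cover size
(`lintegral_iSup_exp_le`).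

The regret is the sum of the gaps plus two sums of reward noise. With high probability these are
O(√(TC)); in expectation they vanish, and the bad event costs at most Tδ/2. -/

lemma generateFrom_image2_inter {Ω : Type*} (B C : MeasurableSpace Ω) :
    MeasurableSpace.generateFrom
      {u | ∃ b c, MeasurableSet[B] b ∧ MeasurableSet[C] c ∧ u = b ∩ c} = B ⊔ C := by
  apply le_antisymm
  · apply MeasurableSpace.generateFrom_le
    rintro _ ⟨b, c, hb, hc, rfl⟩
    exact MeasurableSet.inter (le_sup_left (a := B) (b := C) _ hb)
      (le_sup_right (a := B) (b := C) _ hc)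
  · apply sup_le
    · intro b hb
      exact MeasurableSpace.measurableSet_generateFrom ⟨b, univ, hb, MeasurableSet.univ, by simp⟩
    · intro c hc
      exact MeasurableSpace.measurableSet_generateFrom ⟨univ, c, MeasurableSet.univ, hc, by simp⟩

lemma isPiSystem_image2_inter {Ω : Type*} (B C : MeasurableSpace Ω) :
    IsPiSystem {u | ∃ b c, MeasurableSet[B] b ∧ MeasurableSet[C] c ∧ u = b ∩ c} := by
  rintro _ ⟨b, c, hb, hc, rfl⟩ _ ⟨b', c', hb', hc', rfl⟩ _
  exact ⟨b ∩ b', c ∩ c', MeasurableSet.inter hb hb', MeasurableSet.inter hc hc',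
    inter_inter_inter_comm b c b' c'⟩

/-- Lets a σ-algebra that is independent of A grow by a source C that is independent of everything
before it: P(s ∩ b ∩ c) = P(c) P(s ∩ b) = P(s) P(b ∩ c) on the generating intersections. -/
lemma indep_sup_right_of_indep {Ω : Type*} {A B C mΩ : MeasurableSpace Ω} {P : Measure Ω}
    [IsProbabilityMeasure P] (hA : A ≤ mΩ) (hB : B ≤ mΩ) (hC : C ≤ mΩ)
    (hAB : Indep A B P) (hCAB : Indep C (A ⊔ B) P) : Indep A (B ⊔ C) P := by
  refine IndepSets.indep (p1 := {s | MeasurableSet[A] s}) hA (sup_le hB hC)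
    (@MeasurableSpace.isPiSystem_measurableSet _ A) (isPiSystem_image2_inter B C)
    (@MeasurableSpace.generateFrom_measurableSet _ A).symm (generateFrom_image2_inter B C).symm ?_
  rw [IndepSets_iff]
  rintro s _ hs ⟨b, c, hb, hc, rfl⟩
  rw [Indep_iff] at hAB hCAB
  have h1 := hCAB c (s ∩ b) hc
    (MeasurableSet.inter (le_sup_left (a := A) (b := B) _ hs) (le_sup_right (a := A) (b := B) _ hb))
  have h2 := hCAB c b hc (le_sup_right (a := A) (b := B) _ hb)
  have h3 := hAB s b hs hb
  rw [show s ∩ (b ∩ c) = c ∩ (s ∩ b) by ext; simp; tauto, h1, h3, inter_comm b c, h2]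
  ring

/-- Peel off the largest index of a finite set: its event is independent of the intersection of the
others, which belongs to the past. The shift by one matches `Fin T` with the rounds 1, …, T. -/
lemma iIndep_of_sequential {Ω : Type*} {mΩ : MeasurableSpace Ω} {P : Measure Ω}
    [IsProbabilityMeasure P] {T : ℕ} {m : ℕ → MeasurableSpace Ω}
    (h : ∀ t ∈ Finset.Icc 1 T, Indep (m t) (⨆ s ∈ Finset.Ico 1 t, m s) P) :
    iIndep (fun i : Fin T => m (i + 1)) P := by
  rw [iIndep_iff]
  intro S
  induction S using Finset.induction_on_max with
  | empty => intro f _; simp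
  | insert a S hlt ih =>
    intro f hf
    have ha : a ∉ S := fun h => lt_irrefl _ (hlt a h)
    rw [Finset.prod_insert ha, Finset.set_biInter_insert,
      ← ih (fun i hi => hf i (Finset.mem_insert_of_mem hi))]
    have hI := h (a + 1) (Finset.mem_Icc.2 ⟨by omega, a.2⟩)
    rw [Indep_iff] at hI
    refine hI _ _ (hf a (Finset.mem_insert_self _ _)) (Finset.measurableSet_biInter _ fun i hi => ?_)
    refine le_iSup₂_of_le (f := fun s (_ : s ∈ Finset.Ico 1 ((a : ℕ) + 1)) => m s) ((i : ℕ) + 1)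
      (Finset.mem_Ico.2 ⟨by omega, ?_⟩) le_rfl _ (hf i (Finset.mem_insert_of_mem hi))
    have := hlt i hi
    have : (i : ℕ) < a := this
    omega

/-! ### Conditioning on additional independent information -/

lemma setIntegral_of_indep {Ω : Type*} {A B mΩ : MeasurableSpace Ω} {P : Measure Ω}
    [IsProbabilityMeasure P] (hA : A ≤ mΩ) (hB : B ≤ mΩ) (hI : Indep A B P) {u : Ω → ℝ}
    (hum : StronglyMeasurable[A] u) (hu : Integrable u P) {b : Set Ω} (hb : MeasurableSet[B] b) :
    ∫ ω in b, u ω ∂P = P.real b * ∫ ω, u ω ∂P := by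
  have e1 : P[u | B] =ᵐ[P] fun _ => ∫ ω, u ω ∂P := condExp_indep_eq hA hB hum hI
  have e2 := setIntegral_condExp hB hu hb
  rw [setIntegral_congr_ae (hB _ hb) (e1.mono fun ω hω _ => hω)] at e2
  rw [← e2, setIntegral_const, smul_eq_mul]

/-- If `f` has conditional expectation `h` given `A`, and `f`, `A` are independent of `B`,
then `f` can be replaced with `h` in expectations weighted with `A ⊔ B`-measurable functions. -/
lemma integral_mul_eq_of_condExp_of_indep {Ω : Type*} {A A' B mΩ : MeasurableSpace Ω}
    {P : Measure Ω} [IsProbabilityMeasure P] (hA : A ≤ A') (hA' : A' ≤ mΩ) (hB : B ≤ mΩ)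
    (hI : Indep A' B P) {f h g : Ω → ℝ} (hfm : StronglyMeasurable[A'] f) (hf : Integrable f P)
    (hhm : StronglyMeasurable[A] h) (hh : Integrable h P)
    (hfh : ∀ s, MeasurableSet[A] s → ∫ ω in s, f ω ∂P = ∫ ω in s, h ω ∂P)
    (hg : StronglyMeasurable[A ⊔ B] g) {c : ℝ} (hgc : ∀ᵐ ω ∂P, ‖g ω‖ ≤ c) :
    ∫ ω, g ω * f ω ∂P = ∫ ω, g ω * h ω ∂P := by
  have hAm : A ≤ mΩ := hA.trans hA'
  have hle : A ⊔ B ≤ mΩ := sup_le hAm hB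
  have key : ∀ u : Ω → ℝ, StronglyMeasurable[A'] u → Integrable u P → ∀ s b, MeasurableSet[A] s →
      MeasurableSet[B] b → ∫ ω in s ∩ b, u ω ∂P = P.real b * ∫ ω in s, u ω ∂P := by
    intro u hu hui s b hs hb
    rw [inter_comm, ← setIntegral_indicator (hAm _ hs), setIntegral_of_indep hA' hB hI
      (hu.indicator (hA _ hs)) (hui.indicator (hAm _ hs)) hb, integral_indicator (hAm _ hs)]
  -- A π-λ argument: on intersections s ∩ b both integrals factor as P(b) times an integral over s,
  -- where f and h agree by assumption. So h is a version of E[f | A ⊔ B].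
  have hset : ∀ t, MeasurableSet[A ⊔ B] t → ∫ ω in t, h ω ∂P = ∫ ω in t, f ω ∂P := by
    intro t ht
    induction t, ht using MeasurableSpace.induction_on_inter
      (generateFrom_image2_inter A B).symm (isPiSystem_image2_inter A B) with
    | empty => simp
    | basic t ht =>
      obtain ⟨s, b, hs, hb, rfl⟩ := ht
      rw [key f hfm hf s b hs hb, key h (hhm.mono hA) hh s b hs hb, hfh s hs]
    | compl t ht ih =>
      have e := hfh univ MeasurableSet.univ
      simp only [setIntegral_univ] at e
      rw [setIntegral_compl (hle _ ht) hh, setIntegral_compl (hle _ ht) hf, ih, e]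
    | iUnion s hd hs ih =>
      rw [integral_iUnion (fun i => hle _ (hs i)) hd hh.integrableOn,
        integral_iUnion (fun i => hle _ (hs i)) hd hf.integrableOn]
      exact tsum_congr ih
  have hce : h =ᵐ[P] P[f | A ⊔ B] :=
    ae_eq_condExp_of_forall_setIntegral_eq hle hf (fun _ _ _ => hh.integrableOn)
      (fun s hs _ => hset s hs)
      (show StronglyMeasurable[A ⊔ B] h from hhm.mono le_sup_left).aestronglyMeasurable
  have hgf : Integrable (g * f) P :=
    hf.bdd_mul (hg.mono hle).aestronglyMeasurable hgc
  have hpull := condExp_mul_of_stronglyMeasurable_left hg hgf hf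
  calc ∫ ω, g ω * f ω ∂P = ∫ ω, P[g * f | A ⊔ B] ω ∂P := (integral_condExp hle).symm
    _ = ∫ ω, g ω * h ω ∂P := by
      apply integral_congr_ae
      filter_upwards [hpull, hce] with ω h1 h2
      rw [h1, Pi.mul_apply, h2]

/-! ### Symmetrization -/

/-- Regroup the two samples into independent pairs; on a single pair, exchanging the components
preserves ν i × ν i. -/
lemma measurePreserving_swap_coords {ι Y : Type*} [Fintype ι] [MeasurableSpace Y]
    (ν : ι → Measure Y) [∀ i, IsProbabilityMeasure (ν i)] (σ : ι → Bool) :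
    MeasurePreserving (fun z : (ι → Y) × (ι → Y) =>
      ((fun i => if σ i then z.2 i else z.1 i), (fun i => if σ i then z.1 i else z.2 i)))
      ((Measure.pi ν).prod (Measure.pi ν)) ((Measure.pi ν).prod (Measure.pi ν)) := by
  have h1 := measurePreserving_arrowProdEquivProdArrow Y Y ι ν ν
  have h2 : MeasurePreserving
      (fun (u : ι → Y × Y) i => (fun p : Y × Y => if σ i then p.swap else p) (u i))
      (Measure.pi fun i => (ν i).prod (ν i)) (Measure.pi fun i => (ν i).prod (ν i)) := by
    refine measurePreserving_pi _ _ (f := fun i (p : Y × Y) => if σ i then p.swap else p)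
      fun i => ?_
    cases σ i
    · simpa using! MeasurePreserving.id ((ν i).prod (ν i))
    · simpa using Measure.measurePreserving_swap
  have h3 := h1.comp (h2.comp (h1.symm _))
  convert h3 using 1
  funext z
  ext i
  · change _ = (if σ i then (z.1 i, z.2 i).swap else (z.1 i, z.2 i)).1
    split_ifs with h <;> simp [h]
  · change _ = (if σ i then (z.1 i, z.2 i).swap else (z.1 i, z.2 i)).2
    split_ifs with h <;> simp [h]

/-- The exponents are -(2/25)(p + q) ± (2/5)(p - q), so the sum is 2 exp(-(2/25)(p + q))
cosh((2/5)(p - q)), and cosh u ≤ exp(u²/2) reduces the claim to (p - q)² ≤ p + q. The imbalance 8/25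
< 12/25 creates the negative drift that pays for the variance; this is why the resulting deviation
bound is multiplicative, with factor (12/25)/(8/25) = 3/2, and has no square-root term. -/
lemma exp_swap_le {p q : ℝ} (hp : p ∈ Icc (0 : ℝ) 1) (hq : q ∈ Icc (0 : ℝ) 1) :
    Real.exp (8 / 25 * q - 12 / 25 * p) + Real.exp (8 / 25 * p - 12 / 25 * q) ≤ 2 := by
  have h := Real.cosh_le_exp_half_sq (2 / 5 * (p - q))
  rw [Real.cosh_eq] at h
  have e1 : Real.exp (8 / 25 * q - 12 / 25 * p)
      = Real.exp (-(2 / 25) * (p + q)) * Real.exp (-(2 / 5 * (p - q))) := by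
    rw [← Real.exp_add]; ring_nf
  have e2 : Real.exp (8 / 25 * p - 12 / 25 * q)
      = Real.exp (-(2 / 25) * (p + q)) * Real.exp (2 / 5 * (p - q)) := by
    rw [← Real.exp_add]; ring_nf
  have h3 : Real.exp (-(2 / 25) * (p + q)) * Real.exp ((2 / 5 * (p - q)) ^ 2 / 2) ≤ 1 := by
    rw [← Real.exp_add, Real.exp_le_one_iff]
    nlinarith [hp.1, hp.2, hq.1, hq.2, mul_nonneg hp.1 hq.1,
      mul_nonneg hp.1 (sub_nonneg.2 hp.2), mul_nonneg hq.1 (sub_nonneg.2 hq.2)]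
  have h4 := Real.exp_pos (-(2 / 25) * (p + q))
  rw [e1, e2]
  nlinarith

lemma sum_swap_exp_le {ι : Type*} [Fintype ι] [DecidableEq ι] {p q : ι → ℝ}
    (hp : ∀ i, p i ∈ Icc (0 : ℝ) 1) (hq : ∀ i, q i ∈ Icc (0 : ℝ) 1) :
    ∑ σ : ι → Bool, Real.exp (∑ i, (8 / 25 * (if σ i then p i else q i)
      - 12 / 25 * (if σ i then q i else p i))) ≤ 2 ^ Fintype.card ι := by
  simp_rw [Real.exp_sum]
  have := Finset.prod_univ_sum (fun _ : ι => (Finset.univ : Finset Bool))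
    (fun i b => Real.exp (8 / 25 * (if b then p i else q i) - 12 / 25 * (if b then q i else p i)))
  rw [Fintype.piFinset_univ] at this
  rw [← this]
  calc _ ≤ ∏ _i : ι, (2 : ℝ) := by
        refine Finset.prod_le_prod (fun i _ => Finset.sum_nonneg fun b _ => (Real.exp_pos _).le) ?_
        intro i _
        simpa [add_comm] using exp_swap_le (hp i) (hq i)
    _ = _ := by simp

/-- Exponential moment of the largest deviation between expectations and (a multiple of) sums of
independent `[0,1]`-valued functions, in terms of the size of empirical covers. -/
lemma lintegral_iSup_exp_le {ι Y Φ I : Type*} [Fintype ι] [MeasurableSpace Y] [Countable Φ]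
    (ν : ι → Measure Y) [∀ i, IsProbabilityMeasure (ν i)] (h : Φ → ι → Y → ℝ)
    (hm : ∀ φ i, Measurable (h φ i)) (h01 : ∀ φ i y, h φ i y ∈ Icc (0 : ℝ) 1)
    (v : I → (ι → Y) → ι → ℝ) (v01 : ∀ j y i, v j y i ∈ Icc (0 : ℝ) 1)
    (sel : (ι → Y) → Finset I) (hsel : Measurable fun y => (sel y).card) (e : ℝ)
    (hcov : ∀ φ y, ∃ j ∈ sel y, ∑ i, |h φ i (y i) - v j y i| ≤ e) :
    ∫⁻ y, (⨆ φ, ENNReal.ofReal (Real.exp (8 / 25 * ∑ i, ∫ u, h φ i u ∂ν i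
        - 12 / 25 * ∑ i, h φ i (y i)))) ∂Measure.pi ν ≤
      ENNReal.ofReal (Real.exp (24 / 25 * e)) *
        (∫⁻ y, ((sel y).card : ENNReal) ∂Measure.pi ν) ^ 2 := by
  classical
  set Ψ : (ι → Y) × (ι → Y) → ENNReal := fun z => ⨆ φ, ENNReal.ofReal (Real.exp
    (∑ i, (8 / 25 * h φ i (z.2 i) - 12 / 25 * h φ i (z.1 i)))) with hΨ
  have hΨm : Measurable Ψ := by
    refine Measurable.iSup fun φ => ?_
    refine ENNReal.measurable_ofReal.comp (Real.measurable_exp.comp ?_)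
    refine Finset.measurable_sum _ fun i _ => ?_
    exact (((hm φ i).comp ((measurable_pi_apply i).comp measurable_snd)).const_mul _).sub
      (((hm φ i).comp ((measurable_pi_apply i).comp measurable_fst)).const_mul _)
  -- Jensen's inequality replaces the expectations with an independent ghost sample y'.
  have hjensen : ∀ y, (⨆ φ, ENNReal.ofReal (Real.exp (8 / 25 * ∑ i, ∫ u, h φ i u ∂ν i
        - 12 / 25 * ∑ i, h φ i (y i)))) ≤ ∫⁻ y', Ψ (y, y') ∂Measure.pi ν := by
    intro y
    refine iSup_le fun φ => ?_
    set g : (ι → Y) → ℝ := fun y' =>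
      ∑ i, (8 / 25 * h φ i (y' i) - 12 / 25 * h φ i (y i)) with hg
    have hgm : Measurable g := by
      refine Finset.measurable_sum _ fun i _ => ?_
      exact (((hm φ i).comp (measurable_pi_apply i)).const_mul _).sub measurable_const
    have hint : ∀ i, Integrable (fun y' : ι → Y => h φ i (y' i)) (Measure.pi ν) := by
      intro i
      refine Integrable.of_bound ((hm φ i).comp (measurable_pi_apply i)).aestronglyMeasurable 1
        (Filter.Eventually.of_forall fun y' => ?_)
      rw [Real.norm_eq_abs, abs_of_nonneg (h01 φ i _).1]
      exact (h01 φ i _).2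
    have hgi : Integrable g (Measure.pi ν) :=
      integrable_finsetSum _ fun i _ => ((hint i).const_mul _).sub (integrable_const _)
    have hgb : ∀ y', g y' ≤ ∑ _i : ι, (1 : ℝ) := fun y' =>
      Finset.sum_le_sum fun i _ => by
        have := h01 φ i (y' i); have := h01 φ i (y i)
        simp only [mem_Icc] at *; linarith
    have hexp : Integrable (fun y' => Real.exp (g y')) (Measure.pi ν) := by
      refine Integrable.of_bound (Real.measurable_exp.comp hgm).aestronglyMeasurable
        (Real.exp (∑ _i : ι, (1 : ℝ))) (Filter.Eventually.of_forall fun y' => ?_)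
      rw [Real.norm_eq_abs, Real.abs_exp]
      exact Real.exp_le_exp.2 (hgb y')
    have hmean : ∫ y', g y' ∂Measure.pi ν
        = 8 / 25 * ∑ i, ∫ u, h φ i u ∂ν i - 12 / 25 * ∑ i, h φ i (y i) := by
      have hi : ∀ i ∈ (Finset.univ : Finset ι), Integrable
          (fun y' : ι → Y => 8 / 25 * h φ i (y' i) - 12 / 25 * h φ i (y i)) (Measure.pi ν) :=
        fun i _ => ((hint i).const_mul _).sub (integrable_const _)
      rw [hg, integral_finsetSum _ hi,
        Finset.mul_sum, Finset.mul_sum, ← Finset.sum_sub_distrib]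
      refine Finset.sum_congr rfl fun i _ => ?_
      rw [integral_sub ((hint i).const_mul _) (integrable_const _), integral_const_mul,
        integral_comp_eval (hm φ i).aestronglyMeasurable]
      simp
    rw [← hmean]
    have hj := convexOn_exp.map_integral_le (f := g) (μ := Measure.pi ν)
      Real.continuous_exp.continuousOn isClosed_univ (by simp) hgi hexp
    refine (ENNReal.ofReal_le_ofReal hj).trans ?_
    rw [ofReal_integral_eq_lintegral_ofReal hexp
      (Filter.Eventually.of_forall fun _ => (Real.exp_pos _).le)]
    exact lintegral_mono fun y' => le_iSup (fun φ => ENNReal.ofReal (Real.exp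
      (∑ i, (8 / 25 * h φ i (y' i) - 12 / 25 * h φ i (y i))))) φ
  have hpt : ∀ z : (ι → Y) × (ι → Y),
      ∑ σ : ι → Bool, Ψ ((fun i => if σ i then z.2 i else z.1 i),
        (fun i => if σ i then z.1 i else z.2 i)) ≤
      2 ^ Fintype.card ι * (ENNReal.ofReal (Real.exp (24 / 25 * e)) *
        (((sel z.1).card : ENNReal) * ((sel z.2).card : ENNReal))) := by
    rintro ⟨y, y'⟩
    -- The covers are taken at y and at y' before swapping, so the pairs (j, j') range over a set
    -- that does not depend on σ. A swap only changes which of the coefficients 8/25 and 12/25 an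
    -- entry receives, so the approximation errors total at most 12/25 · (e + e).
    set G : I × I → (ι → Bool) → ℝ := fun j σ => Real.exp (∑ i,
      (8 / 25 * (if σ i then v j.1 y i else v j.2 y' i)
        - 12 / 25 * (if σ i then v j.2 y' i else v j.1 y i))) with hG
    have hle : ∀ σ : ι → Bool, Ψ ((fun i => if σ i then y' i else y i),
        (fun i => if σ i then y i else y' i)) ≤
        ENNReal.ofReal (Real.exp (24 / 25 * e) * ∑ j ∈ sel y ×ˢ sel y', G j σ) := by
      intro σ
      refine iSup_le fun φ => ENNReal.ofReal_le_ofReal ?_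
      obtain ⟨j, hj, hje⟩ := hcov φ y
      obtain ⟨j', hj', hje'⟩ := hcov φ y'
      have h1 : G (j, j') σ ≤ ∑ j ∈ sel y ×ˢ sel y', G j σ :=
        Finset.single_le_sum (f := fun j => G j σ) (fun j _ => (Real.exp_pos _).le)
          (Finset.mk_mem_product hj hj')
      refine le_trans ?_ (mul_le_mul_of_nonneg_left h1 (Real.exp_pos _).le)
      rw [hG, ← Real.exp_add, Real.exp_le_exp]
      have h2 : ∑ i, (8 / 25 * h φ i (if σ i then y i else y' i)
          - 12 / 25 * h φ i (if σ i then y' i else y i)) ≤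
          ∑ i, ((8 / 25 * (if σ i then v j y i else v j' y' i)
            - 12 / 25 * (if σ i then v j' y' i else v j y i))
            + (if σ i then 8 / 25 * |h φ i (y i) - v j y i| + 12 / 25 * |h φ i (y' i) - v j' y' i|
              else 12 / 25 * |h φ i (y i) - v j y i| + 8 / 25 * |h φ i (y' i) - v j' y' i|)) := by
        refine Finset.sum_le_sum fun i _ => ?_
        have a1 := abs_le.1 (le_refl |h φ i (y i) - v j y i|)
        have a2 := abs_le.1 (le_refl |h φ i (y' i) - v j' y' i|)
        split_ifs <;> linarith [a1.1, a1.2, a2.1, a2.2]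
      have h3 : ∑ i, (if σ i then 8 / 25 * |h φ i (y i) - v j y i| +
            12 / 25 * |h φ i (y' i) - v j' y' i|
          else 12 / 25 * |h φ i (y i) - v j y i| + 8 / 25 * |h φ i (y' i) - v j' y' i|) ≤
          ∑ i, 12 / 25 * (|h φ i (y i) - v j y i| + |h φ i (y' i) - v j' y' i|) := by
        refine Finset.sum_le_sum fun i _ => ?_
        have a1 := abs_nonneg (h φ i (y i) - v j y i)
        have a2 := abs_nonneg (h φ i (y' i) - v j' y' i)
        split_ifs <;> linarith
      rw [← Finset.mul_sum, Finset.sum_add_distrib] at h3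
      rw [Finset.sum_add_distrib] at h2
      linarith
    calc _ ≤ ∑ σ : ι → Bool, ENNReal.ofReal
          (Real.exp (24 / 25 * e) * ∑ j ∈ sel y ×ˢ sel y', G j σ) := Finset.sum_le_sum fun σ _ => hle σ
      _ = ENNReal.ofReal (Real.exp (24 / 25 * e) * ∑ j ∈ sel y ×ˢ sel y', ∑ σ, G j σ) := by
        rw [← ENNReal.ofReal_sum_of_nonneg fun σ _ => mul_nonneg (Real.exp_pos _).le
          (Finset.sum_nonneg fun j _ => (Real.exp_pos _).le), ← Finset.mul_sum, Finset.sum_comm]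
      _ ≤ ENNReal.ofReal (Real.exp (24 / 25 * e) *
          ∑ _j ∈ sel y ×ˢ sel y', (2 : ℝ) ^ Fintype.card ι) := by
        refine ENNReal.ofReal_le_ofReal (mul_le_mul_of_nonneg_left
          (Finset.sum_le_sum fun j _ => ?_) (Real.exp_pos _).le)
        exact sum_swap_exp_le (fun i => v01 j.1 y i) (fun i => v01 j.2 y' i)
      _ = _ := by
        rw [Finset.sum_const, Finset.card_product, nsmul_eq_mul,
          ENNReal.ofReal_mul (Real.exp_pos _).le, ENNReal.ofReal_mul (by positivity),
          ENNReal.ofReal_pow (by norm_num), ENNReal.ofReal_natCast]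
        push_cast
        simp only [ENNReal.ofReal_ofNat]
        ring
  set μ := Measure.pi ν with hμ
  -- Each swap preserves the joint law, so the integral of Ψ equals its average over all swaps, to
  -- which the pointwise bound `hpt` applies. Independence of the samples then turns the product of
  -- the cover sizes into the square of their mean.
  have hswap : ∀ σ : ι → Bool, ∫⁻ z, Ψ z ∂(μ.prod μ) = ∫⁻ z, Ψ ((fun i => if σ i then z.2 i else z.1 i),
        (fun i => if σ i then z.1 i else z.2 i)) ∂(μ.prod μ) := fun σ =>
    ((measurePreserving_swap_coords ν σ).lintegral_comp hΨm).symm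
  have hcard : Measurable fun y => ((sel y).card : ENNReal) :=
    (measurable_from_top (f := fun n : ℕ => (n : ENNReal))).comp hsel
  have htot : 2 ^ Fintype.card ι * ∫⁻ z, Ψ z ∂(μ.prod μ) ≤ 2 ^ Fintype.card ι *
      (ENNReal.ofReal (Real.exp (24 / 25 * e)) * (∫⁻ y, ((sel y).card : ENNReal) ∂μ) ^ 2) := by
    calc 2 ^ Fintype.card ι * ∫⁻ z, Ψ z ∂(μ.prod μ)
        = ∑ σ : ι → Bool, ∫⁻ z, Ψ ((fun i => if σ i then z.2 i else z.1 i),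
            (fun i => if σ i then z.1 i else z.2 i)) ∂(μ.prod μ) := by
          rw [Finset.sum_congr rfl fun σ _ => (hswap σ).symm]
          simp
      _ = ∫⁻ z, ∑ σ : ι → Bool, Ψ ((fun i => if σ i then z.2 i else z.1 i),
            (fun i => if σ i then z.1 i else z.2 i)) ∂(μ.prod μ) :=
          (lintegral_finsetSum _ fun σ _ =>
            hΨm.comp (measurePreserving_swap_coords ν σ).measurable).symm
      _ ≤ ∫⁻ z, 2 ^ Fintype.card ι * (ENNReal.ofReal (Real.exp (24 / 25 * e)) *
            (((sel z.1).card : ENNReal) * ((sel z.2).card : ENNReal))) ∂(μ.prod μ) :=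
          lintegral_mono hpt
      _ = _ := by
          have hm2 : Measurable fun z : (ι → Y) × (ι → Y) =>
              ((sel z.1).card : ENNReal) * ((sel z.2).card : ENNReal) :=
            (hcard.comp measurable_fst).mul (hcard.comp measurable_snd)
          rw [lintegral_const_mul _ (hm2.const_mul _), lintegral_const_mul _ hm2,
            lintegral_prod_mul hcard.aemeasurable hcard.aemeasurable, sq]
  have htot' := (ENNReal.mul_le_mul_iff_right (by positivity) (by finiteness)).1 htot
  refine (lintegral_mono hjensen).trans ?_
  rwa [← lintegral_prod _ hΨm.aemeasurable]

/-! ### The filtration that knows all contexts -/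

/-- `H s` knows all contexts and the rounds before `s`, and the reward vector of round `s` still has
its conditional mean `fstar (x s)`. -/
structure IsRewardFiltration {X Ω : Type*} [MeasurableSpace X] [mΩ : MeasurableSpace Ω] {K : ℕ}
    (fstar : X → Fin K → ℝ) (P : Measure Ω) (T : ℕ) (x : ℕ → Ω → X) (r : ℕ → Ω → Fin K → ℝ)
    (a : ℕ → Ω → Fin K) (H : ℕ → MeasurableSpace Ω) : Prop where
  le : ∀ s, H s ≤ mΩ
  mono : ∀ s ∈ Finset.Icc 1 T, ∀ t ∈ Finset.Icc 1 T, s ≤ t → H s ≤ H t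
  context : ∀ s ∈ Finset.Icc 1 T, ∀ i ∈ Finset.Icc 1 T, Measurable[H s] (x i)
  reward : ∀ s ∈ Finset.Icc 1 T, ∀ i ∈ Finset.Ico 1 s, Measurable[H s] (r i)
  action : ∀ s ∈ Finset.Icc 1 T, Measurable[H s] (a s)
  mean : ∀ s ∈ Finset.Icc 1 T, ∀ k, ∀ g : Ω → ℝ, StronglyMeasurable[H s] g →
    (∃ c, ∀ᵐ ω ∂P, ‖g ω‖ ≤ c) → ∫ ω, g ω * r s ω k ∂P = ∫ ω, g ω * fstar (x s ω) k ∂P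

section Run

variable {X Ω : Type*} [MeasurableSpace X] [mΩ : MeasurableSpace Ω] {K : ℕ}
  {D : Measure (X × (Fin K → ℝ))} {F : Set (X → Fin K → ℝ)} {fstar : X → Fin K → ℝ}
  {pistar : X → Fin K} {T M₀ : ℕ} {β : ℕ → ℝ} {P : Measure Ω} {x : ℕ → Ω → X}
  {r : ℕ → Ω → Fin K → ℝ} {a : ℕ → Ω → Fin K}

lemma IsOptimisticRun.reward_mem (hI : IsInstance D F fstar pistar)
    (hR : IsOptimisticRun D F T M₀ β P x r a) :
    ∀ᵐ ω ∂P, ∀ t ∈ Finset.Icc 1 T, ∀ k, r t ω k ∈ Icc (0 : ℝ) 1 := by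
  rw [Filter.eventually_all_finset]
  intro t ht
  obtain ⟨hx, hr, -⟩ := hR.meas t ht
  have h := hI.reward_mem
  rw [← hR.law t ht] at h
  exact ae_of_ae_map (hx.prodMk hr).aemeasurable h

lemma IsInstance.setIntegral_reward (hI : IsInstance D F fstar pistar) (k : Fin K) {U : Set X}
    (hU : MeasurableSet U) :
    ∫ z in Prod.fst ⁻¹' U, z.2 k ∂D = ∫ z in Prod.fst ⁻¹' U, fstar z.1 k ∂D := by
  have := hI.prob
  have hm : MeasurableSpace.comap (Prod.fst : X × (Fin K → ℝ) → X) inferInstance ≤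
      (inferInstance : MeasurableSpace (X × (Fin K → ℝ))) := measurable_fst.comap_le
  have hint : Integrable (fun z : X × (Fin K → ℝ) => z.2 k) D := by
    refine Integrable.of_bound ((measurable_pi_apply k).comp measurable_snd).aestronglyMeasurable 1 ?_
    filter_upwards [hI.reward_mem] with z hz
    rw [Real.norm_eq_abs, abs_of_nonneg (hz k).1]
    exact (hz k).2
  rw [← setIntegral_condExp hm hint ⟨U, hU, rfl⟩]
  exact setIntegral_congr_ae (measurable_fst hU) ((hI.realizable k).mono fun z hz _ => hz)

/-- Each later context is drawn independently of everything before it, round s included, so the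
contexts can be joined to G s one at a time. -/
lemma IsOptimisticRun.indep_future (hR : IsOptimisticRun D F T M₀ β P x r a)
    {G : Filtration ℕ mΩ} (hG : ∀ t ∈ Finset.Icc 1 T,
      (∀ s ∈ Finset.Ico 1 t, Measurable[G t] (x s) ∧ Measurable[G t] (r s) ∧ Measurable[G t] (a s)) ∧
      Indep (MeasurableSpace.comap (fun ω => (x t ω, r t ω)) inferInstance) (G t) P ∧
      Measurable[G t ⊔ MeasurableSpace.comap (x t) inferInstance] (a t))
    {s : ℕ} (hs : s ∈ Finset.Icc 1 T) {j : ℕ} (hsj : s ≤ j) (hjT : j ≤ T) :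
    Indep (MeasurableSpace.comap (fun ω => (x s ω, r s ω)) inferInstance)
      (G s ⊔ ⨆ i ∈ Finset.Ioc s j, MeasurableSpace.comap (x i) inferInstance) P := by
  have := hR.prob
  have hmem := Finset.mem_Icc.1 hs
  have hxle : ∀ i ∈ Finset.Icc 1 T, MeasurableSpace.comap (x i) inferInstance ≤ mΩ :=
    fun i hi => (hR.meas i hi).1.comap_le
  have hpair : ∀ i ∈ Finset.Icc 1 T,
      MeasurableSpace.comap (fun ω => (x i ω, r i ω)) inferInstance ≤ mΩ :=
    fun i hi => ((hR.meas i hi).1.prodMk (hR.meas i hi).2.1).comap_le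
  induction j, hsj using Nat.le_induction with
  | base => simpa using (hG s hs).2.1
  | succ j hsj ih =>
    have hj : j + 1 ∈ Finset.Icc 1 T := Finset.mem_Icc.2 ⟨by omega, hjT⟩
    have hsup : (⨆ i ∈ Finset.Ioc s (j + 1), MeasurableSpace.comap (x i) inferInstance)
        = (⨆ i ∈ Finset.Ioc s j, MeasurableSpace.comap (x i) inferInstance) ⊔
          MeasurableSpace.comap (x (j + 1)) inferInstance := by
      rw [show Finset.Ioc s (j + 1) = insert (j + 1) (Finset.Ioc s j) by ext; simp; omega,
        Finset.iSup_insert, sup_comm]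
    rw [hsup, ← sup_assoc]
    refine indep_sup_right_of_indep (hpair s hs) (sup_le (G.le s) (iSup₂_le fun i hi => ?_))
      (hxle _ hj) (ih (by omega)) ?_
    · exact hxle i (Finset.mem_Icc.2 (by rw [Finset.mem_Ioc] at hi; omega))
    · refine indep_of_indep_of_le (hG (j + 1) hj).2.1 ?_ ?_
      · exact (measurable_fst.comp (comap_measurable (fun ω => (x (j + 1) ω, r (j + 1) ω)))).comap_le
      · refine sup_le ?_ (sup_le (G.mono (by omega)) (iSup₂_le fun i hi => ?_))
        · have := (hG (j + 1) hj).1 s (Finset.mem_Ico.2 ⟨hmem.1, by omega⟩)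
          exact (this.1.prodMk this.2.1).comap_le
        · rw [Finset.mem_Ioc] at hi
          exact ((hG (j + 1) hj).1 i (Finset.mem_Ico.2 ⟨by omega, by omega⟩)).1.comap_le

lemma IsOptimisticRun.exists_rewardFiltration (hI : IsInstance D F fstar pistar)
    (hR : IsOptimisticRun D F T M₀ β P x r a) :
    ∃ H, IsRewardFiltration fstar P T x r a H := by
  have := hR.prob
  have := hI.prob
  obtain ⟨G, hG⟩ := hR.nonanticipating
  have hxle : ∀ i ∈ Finset.Icc 1 T, MeasurableSpace.comap (x i) inferInstance ≤ mΩ :=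
    fun i hi => (hR.meas i hi).1.comap_le
  -- The intersection with [1, T] matters because s runs over all of ℕ, while nothing is known about
  -- the measurability of x outside these rounds.
  refine ⟨fun s => G s ⊔ ⨆ i ∈ Finset.Icc s T ∩ Finset.Icc 1 T,
    MeasurableSpace.comap (x i) inferInstance, ?_, ?_, ?_, ?_, ?_, ?_⟩
  · exact fun s => sup_le (G.le s) (iSup₂_le fun i hi => hxle i (Finset.mem_inter.1 hi).2)
  · intro s hs t ht hst
    refine sup_le ((G.mono hst).trans le_sup_left) (iSup₂_le fun i hi => ?_)
    rw [Finset.mem_inter, Finset.mem_Icc, Finset.mem_Icc] at hi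
    by_cases hit : i < t
    · exact (((hG t ht).1 i (Finset.mem_Ico.2 ⟨hi.2.1, hit⟩)).1.comap_le).trans le_sup_left
    · refine le_trans ?_ le_sup_right
      exact le_iSup₂_of_le (f := fun i (_ : i ∈ Finset.Icc t T ∩ Finset.Icc 1 T) =>
        MeasurableSpace.comap (x i) inferInstance) i
        (by simp only [Finset.mem_inter, Finset.mem_Icc]; omega) le_rfl
  · intro s hs i hi
    rw [Finset.mem_Icc] at hi
    by_cases his : i < s
    · exact ((hG s hs).1 i (Finset.mem_Ico.2 ⟨hi.1, his⟩)).1.mono le_sup_left le_rfl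
    · refine measurable_iff_comap_le.2 (le_trans ?_ le_sup_right)
      exact le_iSup₂_of_le (f := fun i (_ : i ∈ Finset.Icc s T ∩ Finset.Icc 1 T) =>
        MeasurableSpace.comap (x i) inferInstance) i
        (by simp only [Finset.mem_inter, Finset.mem_Icc]; omega) le_rfl
  · intro s hs i hi
    exact ((hG s hs).1 i hi).2.1.mono le_sup_left le_rfl
  · intro s hs
    refine (hG s hs).2.2.mono (sup_le_sup le_rfl ?_) le_rfl
    exact le_iSup₂_of_le (f := fun i (_ : i ∈ Finset.Icc s T ∩ Finset.Icc 1 T) =>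
        MeasurableSpace.comap (x i) inferInstance) s
        (by simp only [Finset.mem_inter, Finset.mem_Icc] at *; omega) le_rfl
  · intro s hs k g hg ⟨c, hc⟩
    have hsT := Finset.mem_Icc.1 hs
    obtain ⟨hxs, hrs, -⟩ := hR.meas s hs
    have hB : (G s ⊔ ⨆ i ∈ Finset.Ioc s T, MeasurableSpace.comap (x i) inferInstance) ≤ mΩ :=
      sup_le (G.le s) (iSup₂_le fun i hi => hxle i
        (Finset.mem_Icc.2 (by rw [Finset.mem_Ioc] at hi; omega)))
    have hpm : Measurable[MeasurableSpace.comap (fun ω => (x s ω, r s ω)) inferInstance]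
        (fun ω => (x s ω, r s ω)) := comap_measurable _
    have hfm := hI.pred_meas fstar hI.star_mem k
    refine integral_mul_eq_of_condExp_of_indep
      (A := MeasurableSpace.comap (x s) inferInstance)
      (A' := MeasurableSpace.comap (fun ω => (x s ω, r s ω)) inferInstance)
      (B := G s ⊔ ⨆ i ∈ Finset.Ioc s T, MeasurableSpace.comap (x i) inferInstance)
      ?_ (hxs.prodMk hrs).comap_le hB (hR.indep_future hG hs hsT.2 le_rfl) ?_ ?_ ?_ ?_ ?_ ?_ hc
    · exact (measurable_fst.comp hpm).comap_le
    · exact ((measurable_pi_apply k).comp (measurable_snd.comp hpm)).stronglyMeasurable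
    · refine Integrable.of_bound ((measurable_pi_apply k).comp hrs).aestronglyMeasurable 1 ?_
      filter_upwards [hR.reward_mem hI] with ω hω
      rw [Real.norm_eq_abs, abs_of_nonneg (hω s hs k).1]
      exact (hω s hs k).2
    · exact (hfm.comp (comap_measurable _)).stronglyMeasurable
    · refine Integrable.of_bound (hfm.comp hxs).aestronglyMeasurable 1
        (Filter.Eventually.of_forall fun ω => ?_)
      have := hI.pred_mem fstar hI.star_mem (x s ω) k
      rw [Real.norm_eq_abs, abs_of_nonneg this.1]
      exact this.2
    · rintro _ ⟨U, hU, rfl⟩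
      have h := hI.setIntegral_reward k hU
      have m1 : Measurable fun z : X × (Fin K → ℝ) => z.2 k :=
        (measurable_pi_apply k).comp measurable_snd
      have m2 : Measurable fun z : X × (Fin K → ℝ) => fstar z.1 k := hfm.comp measurable_fst
      rw [← hR.law s hs, setIntegral_map (measurable_fst hU) m1.aestronglyMeasurable
        (hxs.prodMk hrs).aemeasurable, setIntegral_map (measurable_fst hU)
        m2.aestronglyMeasurable (hxs.prodMk hrs).aemeasurable] at h
      exact h
    · refine hg.mono (sup_le (le_sup_left.trans le_sup_right) (iSup₂_le fun i hi => ?_))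
      rw [Finset.mem_inter, Finset.mem_Icc, Finset.mem_Icc] at hi
      rcases eq_or_lt_of_le hi.1.1 with rfl | hlt
      · exact le_sup_left
      · refine le_trans ?_ (le_sup_right.trans le_sup_right)
        exact le_iSup₂_of_le (f := fun i (_ : i ∈ Finset.Ioc s T) =>
          MeasurableSpace.comap (x i) inferInstance) i (Finset.mem_Ioc.2 ⟨hlt, hi.1.2⟩) le_rfl

end Run

/-! ### Exponential supermartingale bounds for the reward noise -/

/-- From exp u ≤ 1 + u + u² for |u| ≤ 1, and ρ² ≤ ρ. The bound is affine in ρ, so that the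
conditional mean of the reward suffices to integrate it. -/
lemma exp_centered_le {θ ρ p : ℝ} (hθ : |θ| ≤ 1) (hρ : ρ ∈ Icc (0 : ℝ) 1) (hp : p ∈ Icc (0 : ℝ) 1) :
    Real.exp (θ * (ρ - p)) ≤
      (1 - θ * p + θ ^ 2 * p ^ 2) + (θ + θ ^ 2 * (1 - 2 * p)) * ρ := by
  have h1 : |θ * (ρ - p)| ≤ 1 := by
    rw [abs_mul]
    have : |ρ - p| ≤ 1 := abs_le.2 ⟨by linarith [hρ.1, hp.2], by linarith [hρ.2, hp.1]⟩
    nlinarith [abs_nonneg θ, abs_nonneg (ρ - p)]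
  have h2 := (abs_le.1 (Real.abs_exp_sub_one_sub_id_le h1)).2
  nlinarith [mul_nonneg (sq_nonneg θ) (mul_nonneg hρ.1 (sub_nonneg.2 hρ.2))]

lemma measurable_apply_action {Ω : Type*} {K : ℕ} {m : MeasurableSpace Ω} {u : Ω → Fin K → ℝ} {b : Ω → Fin K}
    (hu : ∀ k, Measurable[m] fun ω => u ω k) (hb : Measurable[m] b) :
    Measurable[m] fun ω => u ω (b ω) := by
  have h : Measurable fun z : Fin K × (Fin K → ℝ) => z.2 z.1 :=
    measurable_from_prod_countable_right fun k => measurable_pi_apply k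
  exact h.comp (hb.prodMk (measurable_pi_iff.2 hu))

section Run

variable {X Ω : Type*} [MeasurableSpace X] [mΩ : MeasurableSpace Ω] {K : ℕ}
  {fstar : X → Fin K → ℝ} {T : ℕ} {P : Measure Ω} [IsProbabilityMeasure P] {x : ℕ → Ω → X}
  {r : ℕ → Ω → Fin K → ℝ} {a : ℕ → Ω → Fin K} {H : ℕ → MeasurableSpace Ω}

/-- The filtration provides the conditional mean for each fixed action; a predictable action is
split along its values. -/
lemma IsRewardFiltration.integral_mul_reward (hH : IsRewardFiltration fstar P T x r a H)
    (hf : ∀ k, Measurable fun y => fstar y k) (hf01 : ∀ y k, fstar y k ∈ Icc (0 : ℝ) 1)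
    (hr : ∀ t ∈ Finset.Icc 1 T, Measurable (r t))
    (hr01 : ∀ᵐ ω ∂P, ∀ t ∈ Finset.Icc 1 T, ∀ k, r t ω k ∈ Icc (0 : ℝ) 1)
    {s : ℕ} (hs : s ∈ Finset.Icc 1 T) {b : Ω → Fin K} (hb : Measurable[H s] b) {g : Ω → ℝ}
    (hg : Measurable[H s] g) (hgc : ∃ c, ∀ᵐ ω ∂P, ‖g ω‖ ≤ c) :
    ∫ ω, g ω * r s ω (b ω) ∂P = ∫ ω, g ω * fstar (x s ω) (b ω) ∂P := by
  classical
  obtain ⟨c, hc⟩ := hgc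
  have hx : Measurable (x s) := (hH.context s hs s hs).mono (hH.le s) le_rfl
  set G : Fin K → Ω → ℝ := fun k => (b ⁻¹' {k}).indicator g with hG
  have hGm : ∀ k, Measurable[H s] (G k) := fun k => hg.indicator (hb (measurableSet_singleton k))
  have hGc : ∀ k, ∀ᵐ ω ∂P, ‖G k ω‖ ≤ c := fun k => hc.mono fun ω hω =>
    (norm_indicator_le_norm_self g ω).trans hω
  have hsum : ∀ (u : Ω → Fin K → ℝ) ω, g ω * u ω (b ω) = ∑ k, G k ω * u ω k := by
    intro u ω
    rw [Finset.sum_eq_single (b ω)]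
    · simp [hG]
    · intro k _ hk
      rw [hG]
      simp only
      rw [indicator_of_notMem (by simpa using hk.symm), zero_mul]
    · simp
  have hb1 : ∀ (u : Ω → ℝ), Measurable u → (∀ᵐ ω ∂P, u ω ∈ Icc (0 : ℝ) 1) → ∀ k,
      Integrable (fun ω => G k ω * u ω) P := by
    intro u hu hu1 k
    refine Integrable.of_bound (((hGm k).mono (hH.le s) le_rfl).mul hu).aestronglyMeasurable c ?_
    filter_upwards [hu1, hGc k] with ω h1 h2
    rw [norm_mul, Real.norm_eq_abs (u ω), abs_of_nonneg h1.1]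
    exact (mul_le_of_le_one_right (norm_nonneg _) h1.2).trans h2
  simp_rw [hsum (fun ω => r s ω), hsum (fun ω => fstar (x s ω))]
  rw [integral_finsetSum, integral_finsetSum]
  · exact Finset.sum_congr rfl fun k _ => hH.mean s hs k (G k) (hGm k).stronglyMeasurable
      ⟨c, hGc k⟩
  · exact fun k _ => hb1 _ ((hf k).comp hx) (Filter.Eventually.of_forall fun ω => hf01 _ _) k
  · exact fun k _ => hb1 _ ((measurable_pi_apply k).comp (hr s hs)) (hr01.mono fun ω h => h s hs k) k

/-- The exponent of the supermartingale with increments `θ s` times the noise of the actions `b s`. -/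
noncomputable def noiseExponent (fstar : X → Fin K → ℝ) (x : ℕ → Ω → X) (r : ℕ → Ω → Fin K → ℝ)
    (b : ℕ → Ω → Fin K) (θ : ℕ → Ω → ℝ) (n : ℕ) (ω : Ω) : ℝ :=
  ∑ s ∈ Finset.Icc 1 n, (θ s ω * (r s ω (b s ω) - fstar (x s ω) (b s ω)) - θ s ω ^ 2 / 4)

/-- The supermartingale property, restricted to an event A that is decided before the first reward.
Since `H 1` knows all contexts, A may fix which cover has been selected. -/
lemma IsRewardFiltration.setIntegral_exp_le (hH : IsRewardFiltration fstar P T x r a H)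
    (hf : ∀ k, Measurable fun y => fstar y k) (hf01 : ∀ y k, fstar y k ∈ Icc (0 : ℝ) 1)
    (hr : ∀ t ∈ Finset.Icc 1 T, Measurable (r t))
    (hr01 : ∀ᵐ ω ∂P, ∀ t ∈ Finset.Icc 1 T, ∀ k, r t ω k ∈ Icc (0 : ℝ) 1)
    {b : ℕ → Ω → Fin K} (hb : ∀ s ∈ Finset.Icc 1 T, Measurable[H s] (b s)) {θ : ℕ → Ω → ℝ}
    (hθ : ∀ s ∈ Finset.Icc 1 T, Measurable[H s] (θ s)) (hθ1 : ∀ s ω, |θ s ω| ≤ 1) {A : Set Ω}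
    (hA : MeasurableSet[H 1] A) {n : ℕ} (hn : n ≤ T) :
    IntegrableOn (fun ω => Real.exp (noiseExponent fstar x r b θ n ω)) A P ∧
    ∫ ω in A, Real.exp (noiseExponent fstar x r b θ n ω) ∂P ≤ P.real A := by
  have hinc : ∀ s ∈ Finset.Icc 1 T, ∀ t ∈ Finset.Icc 1 T, s < t → Measurable[H t] fun ω =>
      θ s ω * (r s ω (b s ω) - fstar (x s ω) (b s ω)) - θ s ω ^ 2 / 4 := by
    intro s hs t ht hst
    have h1 := (hθ s hs).mono (hH.mono s hs t ht hst.le) le_rfl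
    have h2 := (hb s hs).mono (hH.mono s hs t ht hst.le) le_rfl
    have h3 : Measurable[H t] fun ω => r s ω (b s ω) := measurable_apply_action
      (fun k => (measurable_pi_apply k).comp
        (hH.reward t ht s (Finset.mem_Ico.2 ⟨(Finset.mem_Icc.1 hs).1, hst⟩))) h2
    have h4 : Measurable[H t] fun ω => fstar (x s ω) (b s ω) := measurable_apply_action
      (fun k => (hf k).comp (hH.context t ht s hs)) h2
    exact (h1.mul (h3.sub h4)).sub ((h1.pow_const 2).div_const 4)
  have hincm : ∀ s ∈ Finset.Icc 1 T, Measurable fun ω =>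
      θ s ω * (r s ω (b s ω) - fstar (x s ω) (b s ω)) - θ s ω ^ 2 / 4 := by
    intro s hs
    have h1 := (hθ s hs).mono (hH.le s) le_rfl
    have h2 := (hb s hs).mono (hH.le s) le_rfl
    have h3 : Measurable fun ω => r s ω (b s ω) := measurable_apply_action
      (fun k => (measurable_pi_apply k).comp (hr s hs)) h2
    have h4 : Measurable fun ω => fstar (x s ω) (b s ω) := measurable_apply_action
      (fun k => (hf k).comp ((hH.context s hs s hs).mono (hH.le s) le_rfl)) h2
    exact (h1.mul (h3.sub h4)).sub ((h1.pow_const 2).div_const 4)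
  have hbound : ∀ n ≤ T, ∀ᵐ ω ∂P, ‖Real.exp (noiseExponent fstar x r b θ n ω)‖ ≤ Real.exp n := by
    intro n hn
    filter_upwards [hr01] with ω hω
    rw [Real.norm_eq_abs, Real.abs_exp, Real.exp_le_exp]
    calc noiseExponent fstar x r b θ n ω ≤ ∑ s ∈ Finset.Icc 1 n, (1 : ℝ) := by
          refine Finset.sum_le_sum fun s hs => ?_
          have h1 := hω s (Finset.Icc_subset_Icc_right hn hs) (b s ω)
          have h2 := hf01 (x s ω) (b s ω)
          have h3 : |θ s ω * (r s ω (b s ω) - fstar (x s ω) (b s ω))| ≤ 1 := by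
            rw [abs_mul]
            have : |r s ω (b s ω) - fstar (x s ω) (b s ω)| ≤ 1 :=
              abs_le.2 ⟨by linarith [h1.1, h2.2], by linarith [h1.2, h2.1]⟩
            exact mul_le_one₀ (hθ1 s ω) (abs_nonneg _) this
          linarith [(abs_le.1 h3).2, sq_nonneg (θ s ω)]
      _ = n := by simp
  have hmeas : ∀ n ≤ T, Measurable fun ω => noiseExponent fstar x r b θ n ω := fun n hn =>
    Finset.measurable_sum _ fun s hs => hincm s (Finset.Icc_subset_Icc_right hn hs)
  have hint : ∀ n ≤ T, Integrable (fun ω => Real.exp (noiseExponent fstar x r b θ n ω)) P :=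
    fun n hn => Integrable.of_bound (Real.measurable_exp.comp (hmeas n hn)).aestronglyMeasurable _
      (hbound n hn)
  refine ⟨(hint n hn).integrableOn, ?_⟩
  induction n with
  | zero => simp [noiseExponent]
  | succ n ih =>
    refine le_trans ?_ (ih (by omega))
    have hs : n + 1 ∈ Finset.Icc 1 T := Finset.mem_Icc.2 ⟨by omega, hn⟩
    have h1T : 1 ∈ Finset.Icc 1 T := Finset.mem_Icc.2 ⟨le_rfl, by omega⟩
    have hAm : MeasurableSet[H (n + 1)] A := hH.mono 1 h1T _ hs (by omega) _ hA
    have hA0 : MeasurableSet A := hH.le 1 _ hA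
    set W : Ω → ℝ := fun ω => Real.exp (noiseExponent fstar x r b θ n ω) with hW
    have hWm : Measurable[H (n + 1)] W := by
      refine Real.measurable_exp.comp (Finset.measurable_sum _ fun s hs' => ?_)
      rw [Finset.mem_Icc] at hs'
      exact hinc s (Finset.mem_Icc.2 ⟨hs'.1, by omega⟩) _ hs (by omega)
    set g : Ω → ℝ := A.indicator fun ω => W ω * Real.exp (-(θ (n + 1) ω ^ 2 / 4)) with hg
    have hgm : Measurable[H (n + 1)] g := (hWm.mul (Real.measurable_exp.comp
      (((hθ _ hs).pow_const 2).div_const 4).neg)).indicator hAm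
    have hg0 : ∀ ω, 0 ≤ g ω := fun ω => indicator_nonneg (fun ω _ => by positivity) ω
    have hgW : ∀ ω, g ω ≤ W ω := by
      intro ω
      have : W ω * Real.exp (-(θ (n + 1) ω ^ 2 / 4)) ≤ W ω :=
        mul_le_of_le_one_right (Real.exp_pos _).le (Real.exp_le_one_iff.2
          (by linarith [sq_nonneg (θ (n + 1) ω)]))
      by_cases hω : ω ∈ A
      · rw [hg, indicator_of_mem hω]; exact this
      · rw [hg, indicator_of_notMem hω]; exact (Real.exp_pos _).le
    have hgb : ∀ᵐ ω ∂P, g ω ≤ Real.exp n := (hbound n (by omega)).mono fun ω hω =>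
      (hgW ω).trans ((le_abs_self _).trans hω)
    set p : Ω → ℝ := fun ω => fstar (x (n + 1) ω) (b (n + 1) ω) with hp
    have hpm : Measurable[H (n + 1)] p := measurable_apply_action
      (fun k => (hf k).comp (hH.context _ hs _ hs)) (hb _ hs)
    have hp01 : ∀ ω, p ω ∈ Icc (0 : ℝ) 1 := fun ω => hf01 _ _
    set t : Ω → ℝ := θ (n + 1) with ht
    have htm : Measurable[H (n + 1)] t := hθ _ hs
    have ht1 : ∀ ω, |t ω| ≤ 1 := hθ1 _
    set ρ : Ω → ℝ := fun ω => r (n + 1) ω (b (n + 1) ω) with hρ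
    have hρm : Measurable ρ := measurable_apply_action
      (fun k => (measurable_pi_apply k).comp (hr _ hs)) ((hb _ hs).mono (hH.le _) le_rfl)
    have hρ01 : ∀ᵐ ω ∂P, ρ ω ∈ Icc (0 : ℝ) 1 := hr01.mono fun ω h => h _ hs _
    -- The intercept and the slope in ρ from `exp_centered_le`. The slope is `H (n + 1)`-measurable,
    -- so ρ can be exchanged for its conditional mean p.
    set g1 : Ω → ℝ := fun ω => g ω * (1 - t ω * p ω + t ω ^ 2 * p ω ^ 2) with hg1
    set g2 : Ω → ℝ := fun ω => g ω * (t ω + t ω ^ 2 * (1 - 2 * p ω)) with hg2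
    have hg1m : Measurable[H (n + 1)] g1 := hgm.mul
      ((measurable_const.sub (htm.mul hpm)).add ((htm.pow_const 2).mul (hpm.pow_const 2)))
    have hg2m : Measurable[H (n + 1)] g2 := hgm.mul
      (htm.add ((htm.pow_const 2).mul (measurable_const.sub (hpm.const_mul 2))))
    have hg1b : ∀ᵐ ω ∂P, ‖g1 ω‖ ≤ Real.exp n * 3 := by
      filter_upwards [hgb] with ω hω
      rw [Real.norm_eq_abs, hg1, abs_mul, abs_of_nonneg (hg0 ω)]
      refine mul_le_mul hω ?_ (abs_nonneg _) (Real.exp_pos _).le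
      have h1 := abs_le.1 (ht1 ω); have h2 := hp01 ω
      have h3 : t ω ^ 2 ≤ 1 := by nlinarith
      have h4 : p ω ^ 2 ≤ 1 := by nlinarith [h2.1, h2.2]
      rw [abs_le]; constructor <;>
        nlinarith [h2.1, h2.2, mul_nonneg (sq_nonneg (t ω)) (sq_nonneg (p ω)),
          mul_le_one₀ h3 (sq_nonneg (p ω)) h4]
    have hg2b : ∀ᵐ ω ∂P, ‖g2 ω‖ ≤ Real.exp n * 3 := by
      filter_upwards [hgb] with ω hω
      rw [Real.norm_eq_abs, hg2, abs_mul, abs_of_nonneg (hg0 ω)]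
      refine mul_le_mul hω ?_ (abs_nonneg _) (Real.exp_pos _).le
      have h1 := abs_le.1 (ht1 ω); have h2 := hp01 ω
      have h3 : t ω ^ 2 ≤ 1 := by nlinarith
      rw [abs_le]; constructor <;> nlinarith [h2.1, h2.2, sq_nonneg (t ω)]
    have hg2r : ∀ u : Ω → ℝ, Measurable u → (∀ᵐ ω ∂P, u ω ∈ Icc (0 : ℝ) 1) →
        Integrable (fun ω => g2 ω * u ω) P := by
      intro u hu hu1
      refine Integrable.of_bound ((hg2m.mono (hH.le _) le_rfl).mul hu).aestronglyMeasurable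
        (Real.exp n * 3) ?_
      filter_upwards [hu1, hg2b] with ω h1 h2
      rw [norm_mul, Real.norm_eq_abs (u ω), abs_of_nonneg h1.1]
      exact (mul_le_of_le_one_right (norm_nonneg _) h1.2).trans h2
    have hg1i : Integrable g1 P :=
      Integrable.of_bound (hg1m.mono (hH.le _) le_rfl).aestronglyMeasurable _ hg1b
    have hswap := hH.integral_mul_reward hf hf01 hr hr01 hs (hb _ hs) hg2m ⟨_, hg2b⟩
    have i1 := hg2r ρ hρm hρ01
    have i2 := hg2r p (hpm.mono (hH.le _) le_rfl) (Filter.Eventually.of_forall hp01)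
    have step1 : ∫ ω in A, Real.exp (noiseExponent fstar x r b θ (n + 1) ω) ∂P ≤
        ∫ ω, (g1 ω + g2 ω * ρ ω) ∂P := by
      rw [← integral_indicator hA0]
      refine integral_mono_ae ((hint _ hn).indicator hA0) (hg1i.add i1) ?_
      filter_upwards [hρ01] with ω hω
      by_cases hωA : ω ∈ A
      · rw [indicator_of_mem hωA]
        have e1 : noiseExponent fstar x r b θ (n + 1) ω = noiseExponent fstar x r b θ n ω +
            (t ω * (ρ ω - p ω) - t ω ^ 2 / 4) := by
          rw [noiseExponent, Finset.sum_Icc_succ_top (by omega)]; rfl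
        have e2 : g ω = W ω * Real.exp (-(t ω ^ 2 / 4)) := by rw [hg, indicator_of_mem hωA]
        rw [e1, Real.exp_add, sub_eq_add_neg, Real.exp_add]
        have := mul_le_mul_of_nonneg_left (exp_centered_le (ht1 ω) hω (hp01 ω)) (hg0 ω)
        calc _ = g ω * Real.exp (t ω * (ρ ω - p ω)) := by rw [e2, hW]; ring
          _ ≤ _ := this
          _ = _ := by rw [hg1, hg2]; ring
      · rw [indicator_of_notMem hωA, hg1, hg2]
        have : g ω = 0 := by rw [hg, indicator_of_notMem hωA]
        simp [this]
    have step2 : ∫ ω, (g1 ω + g2 ω * ρ ω) ∂P = ∫ ω, (g1 ω + g2 ω * p ω) ∂P := by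
      rw [integral_add hg1i i1, integral_add hg1i i2, hswap]
    rw [step2] at step1
    refine step1.trans ?_
    rw [← integral_indicator hA0]
    refine integral_mono (hg1i.add i2) ((hint n (by omega)).indicator hA0) fun ω => ?_
    by_cases hωA : ω ∈ A
    · have e2 : g ω = W ω * Real.exp (-(t ω ^ 2 / 4)) := by rw [hg, indicator_of_mem hωA]
      simp only [indicator_of_mem hωA]
      -- The conditional second moment is controlled by p(1 - p) ≤ 1/4, which is the origin of the
      -- compensator θ²/4.
      have h1 : 1 + t ω ^ 2 * (p ω * (1 - p ω)) ≤ Real.exp (t ω ^ 2 / 4) := by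
        refine le_trans ?_ (Real.add_one_le_exp _)
        nlinarith [sq_nonneg (t ω), sq_nonneg (p ω - 1 / 2), mul_nonneg (sq_nonneg (t ω))
          (sq_nonneg (p ω - 1 / 2))]
      have h2 := mul_le_mul_of_nonneg_left h1 (hg0 ω)
      calc g1 ω + g2 ω * p ω = g ω * (1 + t ω ^ 2 * (p ω * (1 - p ω))) := by rw [hg1, hg2]; ring
        _ ≤ _ := h2
        _ = W ω := by rw [e2, mul_assoc, ← Real.exp_add]; simp
    · have : g ω = 0 := by rw [hg, indicator_of_notMem hωA]
      simp only [indicator_of_notMem hωA, hg1, hg2, this]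
      simp

/-- Markov's inequality on A. The factor P A is kept so that a union bound over covers is weighted
by the probabilities of their being selected. -/
lemma IsRewardFiltration.measure_inter_le (hH : IsRewardFiltration fstar P T x r a H)
    (hf : ∀ k, Measurable fun y => fstar y k) (hf01 : ∀ y k, fstar y k ∈ Icc (0 : ℝ) 1)
    (hr : ∀ t ∈ Finset.Icc 1 T, Measurable (r t))
    (hr01 : ∀ᵐ ω ∂P, ∀ t ∈ Finset.Icc 1 T, ∀ k, r t ω k ∈ Icc (0 : ℝ) 1)
    {b : ℕ → Ω → Fin K} (hb : ∀ s ∈ Finset.Icc 1 T, Measurable[H s] (b s)) {θ : ℕ → Ω → ℝ}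
    (hθ : ∀ s ∈ Finset.Icc 1 T, Measurable[H s] (θ s)) (hθ1 : ∀ s ω, |θ s ω| ≤ 1) {A : Set Ω}
    (hA : MeasurableSet[H 1] A) {n : ℕ} (hn : n ≤ T) (l : ℝ) :
    P (A ∩ {ω | l < noiseExponent fstar x r b θ n ω}) ≤ ENNReal.ofReal (Real.exp (-l)) * P A := by
  obtain ⟨hint, hle⟩ := hH.setIntegral_exp_le hf hf01 hr hr01 hb hθ hθ1 hA hn
  have hA0 : MeasurableSet A := hH.le 1 _ hA
  have h1 := mul_meas_ge_le_integral_of_nonneg (μ := P.restrict A)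
    (Filter.Eventually.of_forall fun ω => (Real.exp_pos (noiseExponent fstar x r b θ n ω)).le)
    hint (Real.exp l)
  have h2 : P (A ∩ {ω | l < noiseExponent fstar x r b θ n ω}) ≤
      P.restrict A {ω | Real.exp l ≤ Real.exp (noiseExponent fstar x r b θ n ω)} := by
    rw [Measure.restrict_apply' hA0, inter_comm]
    exact measure_mono (inter_subset_inter_left _ fun ω hω => Real.exp_le_exp.2 (le_of_lt hω))
  have h3 : (P.restrict A).real {ω | Real.exp l ≤ Real.exp (noiseExponent fstar x r b θ n ω)} ≤
      Real.exp (-l) * P.real A := by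
    rw [Real.exp_neg, ← div_eq_inv_mul, le_div_iff₀ (Real.exp_pos l), mul_comm]
    exact h1.trans hle
  refine h2.trans ?_
  rw [← ENNReal.ofReal_toReal (measure_ne_top P A), ← ENNReal.ofReal_mul (Real.exp_pos _).le,
    ← ENNReal.ofReal_toReal (measure_ne_top (P.restrict A) _)]
  exact ENNReal.ofReal_le_ofReal h3

end Run

/-! ### Deviation bounds in terms of empirical covers -/

/-- Covers of the class `F₀`, restricted to the actions in `S`, at samples `xs` of `T` contexts: a
finite family of tables `v j xs` and a subset `sel xs` of those, of expected size at most `N`,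
that approximate the values of every `f ∈ F₀` up to a total error of `e`. -/
structure SampleCover {X : Type*} [MeasurableSpace X] {K : ℕ} (μ : Measure X)
    (F₀ : Set (X → Fin K → ℝ)) (T : ℕ) (S : Finset (Fin K)) (e N : ℝ) where
  /-- the number of tables -/
  num : ℕ
  /-- the tables -/
  v : Fin num → (Fin T → X) → Fin T → Fin K → ℝ
  v_mem : ∀ j xs t k, v j xs t k ∈ Icc (0 : ℝ) 1
  v_meas : ∀ j t k, Measurable fun xs => v j xs t k
  /-- the tables that form the cover -/
  sel : (Fin T → X) → Finset (Fin num)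
  sel_meas : ∀ V, MeasurableSet {xs | sel xs = V}
  cover : ∀ f ∈ F₀, ∀ xs, ∃ j ∈ sel xs, ∑ t, ∑ k ∈ S, |f (xs t) k - v j xs t k| ≤ e
  card_le : ∫⁻ xs, ((sel xs).card : ENNReal) ∂(Measure.pi fun _ => μ) ≤ ENNReal.ofReal N

lemma abs_sq_sub_sq_le {f v p : ℝ} (hf : f ∈ Icc (0 : ℝ) 1) (hv : v ∈ Icc (0 : ℝ) 1)
    (hp : p ∈ Icc (0 : ℝ) 1) : |(f - p) ^ 2 - (v - p) ^ 2| ≤ 2 * |f - v| := by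
  rw [show (f - p) ^ 2 - (v - p) ^ 2 = (f + v - 2 * p) * (f - v) by ring, abs_mul]
  refine mul_le_mul_of_nonneg_right (abs_le.2 ⟨?_, ?_⟩) (abs_nonneg _) <;>
    linarith [hf.1, hf.2, hv.1, hv.2, hp.1, hp.2]

lemma sq_sub_mem_Icc {f p : ℝ} (hf : f ∈ Icc (0 : ℝ) 1) (hp : p ∈ Icc (0 : ℝ) 1) :
    (f - p) ^ 2 ∈ Icc (0 : ℝ) 1 :=
  ⟨sq_nonneg _, by nlinarith [hf.1, hf.2, hp.1, hp.2]⟩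

namespace SampleCover

variable {X : Type*} [MeasurableSpace X] {K : ℕ} {μ : Measure X} {F₀ : Set (X → Fin K → ℝ)} {T : ℕ}
  {S : Finset (Fin K)} {e N : ℝ}

lemma measurable_card (c : SampleCover μ F₀ T S e N) : Measurable fun xs => (c.sel xs).card := by
  refine measurable_to_countable' fun n => ?_
  have : (fun xs => (c.sel xs).card) ⁻¹' {n} =
      ⋃ V ∈ {V : Finset (Fin c.num) | V.card = n}, {xs | c.sel xs = V} := by
    ext xs; simp
  rw [this]
  exact MeasurableSet.biUnion (Set.to_countable _) fun V _ => c.sel_meas V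

/-- Weighted squared distances are controlled uniformly by their empirical counterparts. -/
lemma measure_expectation_gt_le (c : SampleCover μ F₀ T S e N) [IsProbabilityMeasure μ]
    (hF₀ : F₀.Countable)
    (hF01 : ∀ f ∈ F₀, ∀ y k, f y k ∈ Icc (0 : ℝ) 1) (hFm : ∀ f ∈ F₀, ∀ k, Measurable fun y => f y k)
    {fstar : X → Fin K → ℝ} (hf : ∀ k, Measurable fun y => fstar y k)
    (hf01 : ∀ y k, fstar y k ∈ Icc (0 : ℝ) 1) (ν : Fin T → Measure (X × Fin K))
    [∀ i, IsProbabilityMeasure (ν i)] (hν : ∀ i, (ν i).map Prod.fst = μ)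
    {w : Fin T → X × Fin K → Fin K → ℝ} (hw : ∀ i k, Measurable fun y => w i y k)
    (hw0 : ∀ i y k, 0 ≤ w i y k) (hw1 : ∀ i y, ∑ k, w i y k ≤ 1) (hN : 0 ≤ N) (l : ℝ) :
    Measure.pi ν {y | ∃ f ∈ F₀, 3 / 2 * ∑ i, ∑ k ∈ S, w i (y i) k *
        (f (y i).1 k - fstar (y i).1 k) ^ 2 + 25 / 8 * l + 6 * e <
      ∑ i, ∫ u, ∑ k ∈ S, w i u k * (f u.1 k - fstar u.1 k) ^ 2 ∂ν i} ≤
    ENNReal.ofReal (N ^ 2 * Real.exp (-l)) := by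
  have : Countable F₀ := hF₀.to_subtype
  have hwS : ∀ i y, ∑ k ∈ S, w i y k ≤ 1 := fun i y =>
    (Finset.sum_le_sum_of_subset_of_nonneg (Finset.subset_univ S)
      fun k _ _ => hw0 i y k).trans (hw1 i y)
  have hwk : ∀ i y, ∀ k, w i y k ≤ 1 := fun i y k =>
    (Finset.single_le_sum (f := fun k => w i y k) (fun k _ => hw0 i y k)
      (Finset.mem_univ k)).trans (hw1 i y)
  have hwd : ∀ i y (d : Fin K → ℝ), (∀ k, d k ∈ Icc (0 : ℝ) 1) →
      ∑ k ∈ S, w i y k * d k ∈ Icc (0 : ℝ) 1 := fun i y d hd =>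
    ⟨Finset.sum_nonneg fun k _ => mul_nonneg (hw0 i y k) (hd k).1,
      (Finset.sum_le_sum fun k _ => mul_le_of_le_one_right (hw0 i y k) (hd k).2).trans (hwS i y)⟩
  set h : F₀ → Fin T → X × Fin K → ℝ := fun f i u =>
    ∑ k ∈ S, w i u k * (f.1 u.1 k - fstar u.1 k) ^ 2 with hh
  have hhm : ∀ f i, Measurable (h f i) := fun f i => Finset.measurable_sum _ fun k _ =>
    (hw i k).mul ((((hFm f.1 f.2 k).comp measurable_fst).sub ((hf k).comp measurable_fst)).pow_const 2)
  set sel : (Fin T → X × Fin K) → Finset (Fin c.num) := fun y => c.sel fun t => (y t).1 with hsel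
  have hproj : MeasurePreserving (fun (y : Fin T → X × Fin K) t => (y t).1) (Measure.pi ν)
      (Measure.pi fun _ => μ) :=
    measurePreserving_pi ν (fun _ => μ) (f := fun _ => Prod.fst)
      fun i => ⟨measurable_fst, hν i⟩
  have key := lintegral_iSup_exp_le ν h hhm
    (fun f i y => hwd i y _ fun k => sq_sub_mem_Icc (hF01 f.1 f.2 _ k) (hf01 _ k))
    (fun j y i => ∑ k ∈ S, w i (y i) k * (c.v j (fun t => (y t).1) i k - fstar (y i).1 k) ^ 2)
    (fun j y i => hwd i _ _ fun k => sq_sub_mem_Icc (c.v_mem _ _ _ _) (hf01 _ k)) sel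
    (c.measurable_card.comp hproj.measurable) (2 * e) (by
      intro f y
      obtain ⟨j, hj, hje⟩ := c.cover f.1 f.2 (fun t => (y t).1)
      refine ⟨j, hj, le_trans ?_ (mul_le_mul_of_nonneg_left hje zero_le_two)⟩
      rw [Finset.mul_sum]
      refine Finset.sum_le_sum fun i _ => ?_
      rw [hh, ← Finset.sum_sub_distrib, Finset.mul_sum]
      refine (Finset.abs_sum_le_sum_abs _ _).trans (Finset.sum_le_sum fun k _ => ?_)
      rw [← mul_sub, abs_mul, abs_of_nonneg (hw0 _ _ _)]
      refine (mul_le_of_le_one_left (abs_nonneg _) (hwk _ _ _)).trans ?_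
      exact abs_sq_sub_sq_le (hF01 f.1 f.2 _ k) (c.v_mem _ _ _ _) (hf01 _ k))
  have hcard : ∫⁻ y, ((sel y).card : ENNReal) ∂Measure.pi ν ≤ ENNReal.ofReal N := by
    refine le_trans (le_of_eq ?_) c.card_le
    have hm : Measurable fun xs => ((c.sel xs).card : ENNReal) :=
      (measurable_from_top (f := fun n : ℕ => (n : ENNReal))).comp c.measurable_card
    exact hproj.lintegral_comp hm
  set Θ : (Fin T → X × Fin K) → ENNReal := fun y => ⨆ f : F₀, ENNReal.ofReal (Real.exp
    (8 / 25 * ∑ i, ∫ u, h f i u ∂ν i - 12 / 25 * ∑ i, h f i (y i))) with hΘ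
  -- The threshold for Markov's inequality. The cover error is 2e because squared distances are
  -- 2-Lipschitz (`abs_sq_sub_sq_le`). Dividing by 8/25 turns l into 25/8 · l and 24/25 · 2e into
  -- 6e.
  set L : ENNReal := ENNReal.ofReal (Real.exp (l + 24 / 25 * (2 * e))) with hL
  have hLpos : L ≠ 0 := by rw [hL]; simp [Real.exp_pos]
  have hLtop : L ≠ ⊤ := ENNReal.ofReal_ne_top
  have hΘm : Measurable Θ := Measurable.iSup fun f => ENNReal.measurable_ofReal.comp
    (Real.measurable_exp.comp (measurable_const.sub
      ((Finset.measurable_sum _ fun i _ => (hhm f i).comp (measurable_pi_apply i)).const_mul _)))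
  calc _ ≤ Measure.pi ν {y | L ≤ Θ y} := by
        refine measure_mono ?_
        rintro y ⟨f, hf, hlt⟩
        change L ≤ Θ y
        refine le_trans ?_ (le_iSup (fun f : F₀ => ENNReal.ofReal (Real.exp
          (8 / 25 * ∑ i, ∫ u, h f i u ∂ν i - 12 / 25 * ∑ i, h f i (y i)))) ⟨f, hf⟩)
        refine ENNReal.ofReal_le_ofReal (Real.exp_le_exp.2 ?_)
        simp only [hh]
        linarith
    _ ≤ (∫⁻ y, Θ y ∂Measure.pi ν) / L := meas_ge_le_lintegral_div hΘm.aemeasurable hLpos hLtop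
    _ ≤ (ENNReal.ofReal (Real.exp (24 / 25 * (2 * e))) * ENNReal.ofReal N ^ 2) / L := by
        gcongr
        exact key.trans (by gcongr)
    _ = ENNReal.ofReal (N ^ 2 * Real.exp (-l)) := by
        rw [hL, ← ENNReal.ofReal_pow hN, ← ENNReal.ofReal_mul (Real.exp_pos _).le,
          ← ENNReal.ofReal_div_of_pos (Real.exp_pos _)]
        congr 1
        rw [Real.exp_add, Real.exp_neg]
        field_simp

end SampleCover

/-- An identity if v = f: with d = f - p, the excess loss is d² - 2d(y - p), and θ = d/2 turns the
left side into θ(y - p) - θ²/4. Passing from f to v costs (2 · 3/16 + 2 · 1/4)|f - v|. Dividing by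
3/16 later gives the constants 4/3, 16/3 and 14/3. -/
lemma excess_loss_le {f v p y : ℝ} (hf : f ∈ Icc (0 : ℝ) 1) (hv : v ∈ Icc (0 : ℝ) 1)
    (hp : p ∈ Icc (0 : ℝ) 1) (hy : y ∈ Icc (0 : ℝ) 1) :
    3 / 16 * (f - p) ^ 2 - ((f - y) ^ 2 - (p - y) ^ 2) / 4 ≤
      ((v - p) / 2 * (y - p) - ((v - p) / 2) ^ 2 / 4) + 7 / 8 * |f - v| := by
  have h1 := (abs_le.1 (abs_sq_sub_sq_le hf hv hp)).2
  have h2 := (abs_le.1 (abs_sq_sub_sq_le hf hv hy)).1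
  nlinarith

section Run

variable {X Ω : Type*} [MeasurableSpace X] [mΩ : MeasurableSpace Ω] {K : ℕ}
  {fstar : X → Fin K → ℝ} {T : ℕ} {P : Measure Ω} [IsProbabilityMeasure P] {x : ℕ → Ω → X}
  {r : ℕ → Ω → Fin K → ℝ} {a : ℕ → Ω → Fin K} {H : ℕ → MeasurableSpace Ω}

/-- Empirical squared distances to `fstar` are controlled uniformly by empirical excess losses. -/
lemma IsRewardFiltration.measure_excess_lt_le (hH : IsRewardFiltration fstar P T x r a H)
    (hf : ∀ k, Measurable fun y => fstar y k) (hf01 : ∀ y k, fstar y k ∈ Icc (0 : ℝ) 1)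
    (hr : ∀ t ∈ Finset.Icc 1 T, Measurable (r t))
    (hr01 : ∀ᵐ ω ∂P, ∀ t ∈ Finset.Icc 1 T, ∀ k, r t ω k ∈ Icc (0 : ℝ) 1)
    {μ : Measure X} {F₀ : Set (X → Fin K → ℝ)} {S : Finset (Fin K)} {e N : ℝ}
    (hF01 : ∀ f ∈ F₀, ∀ y k, f y k ∈ Icc (0 : ℝ) 1)
    (c : SampleCover μ F₀ T S e N)
    (hlaw : P.map (fun ω (t : Fin T) => x (t + 1) ω) = Measure.pi fun _ => μ)
    (hT : 1 ≤ T) {n : ℕ} (hn : n ≤ T) (l : ℝ) :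
    P {ω | ∃ f ∈ F₀, 4 / 3 * ∑ s ∈ Finset.Icc 1 n, (if a s ω ∈ S then
        (f (x s ω) (a s ω) - r s ω (a s ω)) ^ 2 - (fstar (x s ω) (a s ω) - r s ω (a s ω)) ^ 2 else 0)
        + 16 / 3 * l + 14 / 3 * e <
      ∑ s ∈ Finset.Icc 1 n, (if a s ω ∈ S then
        (f (x s ω) (a s ω) - fstar (x s ω) (a s ω)) ^ 2 else 0)} ≤
    ENNReal.ofReal (N * Real.exp (-l)) := by
  classical
  have h1T : 1 ∈ Finset.Icc 1 T := Finset.mem_Icc.2 ⟨le_rfl, hT⟩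
  set xs : Ω → Fin T → X := fun ω t => x (t + 1) ω with hxs
  have hxsH : ∀ s ∈ Finset.Icc 1 T, Measurable[H s] xs := fun s hs =>
    @measurable_pi_lambda _ _ _ (H s) _ _ fun t =>
      hH.context s hs _ (Finset.mem_Icc.2 ⟨by omega, by omega⟩)
  -- Round s has index s - 1 in the sample. The default 0 outside the range keeps all values in
  -- [0,1].
  set tab : Fin c.num → ℕ → Ω → Fin K → ℝ := fun j s ω k =>
    if h : s - 1 < T then c.v j (xs ω) ⟨s - 1, h⟩ k else 0 with htab
  set θ : Fin c.num → ℕ → Ω → ℝ := fun j s ω =>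
    if s ∈ Finset.Icc 1 T then
      (if a s ω ∈ S then (tab j s ω (a s ω) - fstar (x s ω) (a s ω)) / 2 else 0) else 0 with hθdef
  have htab01 : ∀ j s ω k, tab j s ω k ∈ Icc (0 : ℝ) 1 := by
    intro j s ω k
    simp only [htab]
    split_ifs
    · exact c.v_mem _ _ _ _
    · exact ⟨le_rfl, zero_le_one⟩
  have hθ : ∀ j, ∀ s ∈ Finset.Icc 1 T, Measurable[H s] (θ j s) := by
    intro j s hs
    have h1 : s - 1 < T := by rw [Finset.mem_Icc] at hs; omega
    simp only [hθdef, hs, if_true, htab, h1, dif_pos]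
    have ha := hH.action s hs
    refine Measurable.ite (m := H s) (ha (S.measurableSet)) ?_ measurable_const
    refine (Measurable.sub ?_ ?_).div_const 2
    · exact measurable_apply_action (fun k => (c.v_meas j _ k).comp (hxsH s hs)) ha
    · exact measurable_apply_action (fun k => (hf k).comp (hH.context s hs s hs)) ha
  have hθ1 : ∀ j s ω, |θ j s ω| ≤ 1 := by
    intro j s ω
    simp only [hθdef]
    split_ifs
    · have h1 := htab01 j s ω (a s ω)
      have h2 := hf01 (x s ω) (a s ω)
      exact abs_le.2 ⟨by linarith [h1.1, h2.2], by linarith [h1.2, h2.1]⟩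
    all_goals simp
  have hsub : {ω | ∃ f ∈ F₀, 4 / 3 * ∑ s ∈ Finset.Icc 1 n, (if a s ω ∈ S then
        (f (x s ω) (a s ω) - r s ω (a s ω)) ^ 2 - (fstar (x s ω) (a s ω) - r s ω (a s ω)) ^ 2 else 0)
        + 16 / 3 * l + 14 / 3 * e <
      ∑ s ∈ Finset.Icc 1 n, (if a s ω ∈ S then
        (f (x s ω) (a s ω) - fstar (x s ω) (a s ω)) ^ 2 else 0)} ≤ᵐ[P]
      ⋃ V : Finset (Fin c.num), ⋃ j ∈ V, ({ω | c.sel (xs ω) = V} ∩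
        {ω | l < noiseExponent fstar x r a (θ j) n ω} : Set Ω) := by
    filter_upwards [hr01] with ω hω
    rintro ⟨f, hfF, hlt⟩
    obtain ⟨j, hj, hje⟩ := c.cover f hfF (xs ω)
    refine mem_iUnion.2 ⟨c.sel (xs ω), mem_iUnion₂.2 ⟨j, hj, rfl, ?_⟩⟩
    have h1 : ∑ s ∈ Finset.Icc 1 n, (if a s ω ∈ S then |f (x s ω) (a s ω) - tab j s ω (a s ω)|
        else 0) ≤ e := by
      refine le_trans ?_ hje
      calc _ ≤ ∑ s ∈ Finset.Icc 1 n, ∑ k ∈ S, |f (x s ω) k - tab j s ω k| := by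
            refine Finset.sum_le_sum fun s _ => ?_
            split_ifs with h
            · exact Finset.single_le_sum (f := fun k => |f (x s ω) k - tab j s ω k|)
                (fun k _ => abs_nonneg _) h
            · exact Finset.sum_nonneg fun k _ => abs_nonneg _
        _ ≤ ∑ s ∈ Finset.Icc 1 T, ∑ k ∈ S, |f (x s ω) k - tab j s ω k| :=
            Finset.sum_le_sum_of_subset_of_nonneg (Finset.Icc_subset_Icc_right hn)
              fun s _ _ => Finset.sum_nonneg fun k _ => abs_nonneg _
        _ = ∑ t : Fin T, ∑ k ∈ S, |f (x (t + 1) ω) k - tab j (t + 1) ω k| := by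
            rw [Fin.sum_univ_eq_sum_range
              (fun t => ∑ k ∈ S, |f (x (t + 1) ω) k - tab j (t + 1) ω k|) T,
              Finset.range_eq_Ico, Finset.sum_Ico_add'
              (fun t => ∑ k ∈ S, |f (x t ω) k - tab j t ω k|)]
            rfl
        _ = _ := by
            refine Finset.sum_congr rfl fun t _ => Finset.sum_congr rfl fun k _ => ?_
            simp [htab, hxs]
    have h2 : ∑ s ∈ Finset.Icc 1 n, ((3 / 16) * (if a s ω ∈ S then
          (f (x s ω) (a s ω) - fstar (x s ω) (a s ω)) ^ 2 else 0) -
        (1 / 4) * (if a s ω ∈ S then (f (x s ω) (a s ω) - r s ω (a s ω)) ^ 2 -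
          (fstar (x s ω) (a s ω) - r s ω (a s ω)) ^ 2 else 0)) ≤
        ∑ s ∈ Finset.Icc 1 n, ((θ j s ω * (r s ω (a s ω) - fstar (x s ω) (a s ω))
          - θ j s ω ^ 2 / 4) +
          7 / 8 * (if a s ω ∈ S then |f (x s ω) (a s ω) - tab j s ω (a s ω)| else 0)) := by
      refine Finset.sum_le_sum fun s hs => ?_
      have hsT : s ∈ Finset.Icc 1 T := Finset.Icc_subset_Icc_right hn hs
      simp only [hθdef, hsT, if_true]
      split_ifs
      · have := excess_loss_le (hF01 f hfF (x s ω) (a s ω)) (htab01 j s ω (a s ω))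
          (hf01 (x s ω) (a s ω)) (hω s hsT (a s ω))
        linarith
      · simp
    rw [Finset.sum_sub_distrib, Finset.sum_add_distrib, ← Finset.mul_sum, ← Finset.mul_sum,
      ← Finset.mul_sum] at h2
    change l < noiseExponent fstar x r a (θ j) n ω
    unfold noiseExponent
    linarith
  have hxm : Measurable xs := (hxsH 1 h1T).mono (hH.le 1) le_rfl
  have hm : Measurable fun ys => ((c.sel ys).card : ENNReal) :=
    (measurable_from_top (f := fun n : ℕ => (n : ENNReal))).comp c.measurable_card
  -- For each possible cover V the union bound runs over the elements of V only, on the event that V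
  -- is selected. The sum of |V| · P(V is selected) is the expected cover size, so no worst-case
  -- cover size enters.
  calc _ ≤ P (⋃ V : Finset (Fin c.num), ⋃ j ∈ V, ({ω | c.sel (xs ω) = V} ∩
        {ω | l < noiseExponent fstar x r a (θ j) n ω} : Set Ω)) := measure_mono_ae hsub
    _ ≤ ∑ V : Finset (Fin c.num), ∑ j ∈ V, P ({ω | c.sel (xs ω) = V} ∩
        {ω | l < noiseExponent fstar x r a (θ j) n ω}) :=
      (measure_iUnion_fintype_le _ _).trans
        (Finset.sum_le_sum fun V _ => measure_biUnion_finset_le _ _)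
    _ ≤ ∑ V : Finset (Fin c.num), ∑ _j ∈ V, ENNReal.ofReal (Real.exp (-l)) *
        P {ω | c.sel (xs ω) = V} :=
      Finset.sum_le_sum fun V _ => Finset.sum_le_sum fun j _ =>
        hH.measure_inter_le hf hf01 hr hr01 (hH.action) (hθ j) (hθ1 j)
          (hxsH 1 h1T (c.sel_meas V)) hn l
    _ = ENNReal.ofReal (Real.exp (-l)) * ∑ V : Finset (Fin c.num), (V.card : ENNReal) *
        P {ω | c.sel (xs ω) = V} := by
      rw [Finset.mul_sum]
      refine Finset.sum_congr rfl fun V _ => ?_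
      rw [Finset.sum_const, nsmul_eq_mul]
      ring
    _ = ENNReal.ofReal (Real.exp (-l)) * ∫⁻ ω, ((c.sel (xs ω)).card : ENNReal) ∂P := by
      congr 1
      have : ∀ ω, ((c.sel (xs ω)).card : ENNReal) = ∑ V : Finset (Fin c.num),
          {ω | c.sel (xs ω) = V}.indicator (fun _ => (V.card : ENNReal)) ω := by
        intro ω
        rw [Finset.sum_eq_single (c.sel (xs ω))]
        · simp
        · intro V _ hV
          exact indicator_of_notMem (fun h => hV h.symm) _
        · simp
      have hVm : ∀ V, MeasurableSet {ω | c.sel (xs ω) = V} := fun V => hxm (c.sel_meas V)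
      simp_rw [this]
      rw [lintegral_finsetSum _ fun V _ => measurable_const.indicator (hVm V)]
      exact Finset.sum_congr rfl fun V _ => (lintegral_indicator_const (hVm V) _).symm
    _ ≤ ENNReal.ofReal (Real.exp (-l)) * ENNReal.ofReal N := by
      gcongr
      rw [← lintegral_map hm hxm, hlaw]
      exact c.card_le
    _ = _ := by
      rw [← ENNReal.ofReal_mul (Real.exp_pos _).le, mul_comm]

end Run

/-! ### Construction of covers -/

/-- Ties are broken by an enumeration, which makes every fibre of the selection a finite combination
of the sets A i and thus measurable. -/
lemma exists_measurable_argmin {Z ι : Type*} [MeasurableSpace Z] [Fintype ι] (c : ι → ℕ)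
    {A : ι → Set Z} (hA : ∀ i, MeasurableSet (A i)) (hex : ∀ z, ∃ i, z ∈ A i) :
    ∃ sel : Z → ι, (∀ i, MeasurableSet {z | sel z = i}) ∧ (∀ z, z ∈ A (sel z)) ∧
      ∀ z i, z ∈ A i → c (sel z) ≤ c i := by
  classical
  set n := Fintype.card ι with hn
  set e := Fintype.equivFin ι with he
  -- Encodes the lexicographic order on (c i, e i): as e i < n, the cost is compared first, and
  -- equal keys force equal indices.
  set key : ι → ℕ := fun i => c i * n + e i with hkey
  have hkc : ∀ i j, key i ≤ key j → c i ≤ c j := by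
    intro i j hij
    by_contra! hlt
    have h1 : (c j + 1) * n ≤ c i * n := Nat.mul_le_mul_right _ hlt
    have h2 := (e j).2
    simp only [hkey] at hij
    have : (c j + 1) * n = c j * n + n := by ring
    omega
  have hinj : ∀ i j, key i ≤ key j → key j ≤ key i → i = j := by
    intro i j h1 h2
    have hc : c i = c j := le_antisymm (hkc _ _ h1) (hkc _ _ h2)
    simp only [hkey, hc] at h1 h2
    exact e.injective (Fin.ext (by omega))
  have hmin : ∀ z, ∃ i, z ∈ A i ∧ ∀ j, z ∈ A j → key i ≤ key j := by
    intro z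
    obtain ⟨i, hi, hle⟩ := Finset.exists_min_image (Finset.univ.filter fun i => z ∈ A i) key
      (by obtain ⟨i, hi⟩ := hex z; exact ⟨i, by simpa using hi⟩)
    exact ⟨i, by simpa using hi, fun j hj => hle j (by simpa using hj)⟩
  choose sel hsel hle using hmin
  refine ⟨sel, fun i => ?_, hsel, fun z i hi => hkc _ _ (hle z i hi)⟩
  have : {z | sel z = i} = A i ∩ ⋂ j, ((A j)ᶜ ∪ {_z | key i ≤ key j}) := by
    ext z
    simp only [mem_ofPred_eq, mem_inter_iff, mem_iInter, mem_union, mem_compl_iff]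
    constructor
    · rintro rfl
      exact ⟨hsel z, fun j => by by_cases h : z ∈ A j <;> simp [h, hle z j]⟩
    · rintro ⟨h1, h2⟩
      refine hinj _ _ (hle z i h1) ?_
      rcases h2 (sel z) with h | h
      · exact absurd (hsel z) h
      · exact h
  rw [this]
  exact (hA i).inter (MeasurableSet.iInter fun j => (hA j).compl.union (MeasurableSet.const _))

/-- A finite class covers itself. -/
noncomputable def SampleCover.ofFinite {X : Type*} [MeasurableSpace X] {K : ℕ} (μ : Measure X)
    [IsProbabilityMeasure μ] {F : Set (X → Fin K → ℝ)} (hF : F.Finite)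
    (hF01 : ∀ f ∈ F, ∀ y k, f y k ∈ Icc (0 : ℝ) 1) (hFm : ∀ f ∈ F, ∀ k, Measurable fun y => f y k)
    (T : ℕ) : SampleCover μ F T Finset.univ 0 F.ncard :=
  have := hF.to_subtype
  let E : F ≃ Fin F.ncard := Finite.equivFinOfCardEq (Nat.card_coe_set_eq F)
  { num := F.ncard
    v := fun j xs t k => (E.symm j).1 (xs t) k
    v_mem := fun j xs t k => hF01 _ (E.symm j).2 _ _
    v_meas := fun j t k => (hFm _ (E.symm j).2 k).comp (measurable_pi_apply t)
    sel := fun _ => Finset.univ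
    sel_meas := fun _ => MeasurableSet.const _
    cover := fun f hf xs => ⟨E ⟨f, hf⟩, Finset.mem_univ _, by simp⟩
    card_le := by simp }

/-- The grid point next to `u`, clipped to `[0,1]`, in the grid of mesh `1 / q`. -/
noncomputable def gridRound (q : ℕ) (u : ℝ) : Fin (q + 1) :=
  ⟨⌊q * max 0 (min u 1)⌋₊, by
    have h : q * max 0 (min u 1) ≤ (q : ℝ) :=
      mul_le_of_le_one_right q.cast_nonneg (max_le zero_le_one (min_le_right _ _))
    exact Nat.lt_succ_of_le (by simpa using Nat.floor_le_floor h)⟩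

lemma abs_sub_gridRound_le {q : ℕ} (hq : 0 < q) {p : ℝ} (hp : p ∈ Icc (0 : ℝ) 1) (u : ℝ) :
    |p - (gridRound q u : ℕ) / q| ≤ |p - u| + 1 / q := by
  have hq' : (0 : ℝ) < q := Nat.cast_pos.2 hq
  set c := max 0 (min u 1) with hc
  have hc0 : 0 ≤ c := le_max_left _ _
  have h1 : |p - c| ≤ |p - u| := by
    have a1 := (abs_le.1 (le_refl |p - u|)).1
    have a2 := (abs_le.1 (le_refl |p - u|)).2
    have a3 := abs_nonneg (p - u)
    rw [abs_le, hc]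
    rcases le_total u 1 with h | h
    · rw [min_eq_left h]
      rcases le_total 0 u with h' | h'
      · rw [max_eq_right h']; exact ⟨a1, a2⟩
      · rw [max_eq_left h']; constructor <;> linarith [hp.1]
    · rw [min_eq_right h, max_eq_right zero_le_one]; constructor <;> linarith [hp.2]
  have h2 : ((gridRound q u : ℕ) : ℝ) = ⌊q * c⌋₊ := rfl
  have h3 : ((gridRound q u : ℕ) : ℝ) / q ≤ c := by
    rw [h2, div_le_iff₀ hq', mul_comm]
    exact Nat.floor_le (by positivity)
  have h4 : c ≤ ((gridRound q u : ℕ) : ℝ) / q + 1 / q := by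
    rw [h2, ← add_div, le_div_iff₀ hq', mul_comm]
    exact (Nat.lt_floor_add_one _).le
  have h5 : |c - (gridRound q u : ℕ) / q| ≤ 1 / q := abs_le.2
    ⟨by linarith [one_div_pos.2 hq'], by linarith⟩
  linarith [abs_sub_le p c ((gridRound q u : ℕ) / q)]

section Grid

variable {X : Type*} {K T : ℕ} {F : Set (X → Fin K → ℝ)}

lemma sum_abs_sub_gridRound_le {q : ℕ} (hq : 0 < q) {ε : ℝ} (hqε : 1 / (q : ℝ) ≤ ε)
    {p u : Fin T → ℝ} (hp : ∀ t, p t ∈ Icc (0 : ℝ) 1) :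
    ∑ t, |p t - (gridRound q (u t) : ℕ) / q| ≤ ∑ t, |p t - u t| + ε * T := by
  calc _ ≤ ∑ t, (|p t - u t| + ε) :=
        Finset.sum_le_sum fun t _ => (abs_sub_gridRound_le hq (hp t) (u t)).trans (by linarith)
    _ = _ := by
      rw [Finset.sum_add_distrib, Finset.sum_const, Finset.card_univ, Fintype.card_fin,
        nsmul_eq_mul, mul_comm ε]

/-- Rounding to the grid yields a cover of deterministic size. Hence the expected covering number is
finite, and `toReal` does not collapse it to 0. -/
lemma coveringNumber_le_card (hF01 : ∀ f ∈ F, ∀ y k, f y k ∈ Icc (0 : ℝ) 1) (hT : 1 ≤ T) {q : ℕ}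
    (hq : 0 < q) {ε : ℝ} (hqε : 1 / (q : ℝ) ≤ ε) (k : Fin K) (xs : Fin T → X) :
    coveringNumber ((fun f x => f x k) '' F) ε xs ≤ (Fintype.card (Fin T → Fin (q + 1)) : ℕ∞) := by
  classical
  set V : Finset (Fin T → ℝ) :=
    Finset.univ.image fun (g : Fin T → Fin (q + 1)) t => ((g t : ℕ) : ℝ) / q with hV
  have hVcard : V.card ≤ Fintype.card (Fin T → Fin (q + 1)) := Finset.card_image_le
  refine le_trans (iInf₂_le V ?_) (by exact_mod_cast hVcard)
  rintro _ ⟨f, hf, rfl⟩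
  refine ⟨fun t => (gridRound q (f (xs t) k) : ℕ) / q, Finset.mem_image.2
    ⟨fun t => gridRound q (f (xs t) k), Finset.mem_univ _, rfl⟩, ?_⟩
  have h := sum_abs_sub_gridRound_le hq hqε (p := fun t => f (xs t) k) (u := fun t => f (xs t) k)
    fun t => hF01 f hf _ k
  have hT' : (0 : ℝ) < T := by exact_mod_cast hT
  rw [one_div, inv_mul_le_iff₀ hT']
  simpa [mul_comm] using h

lemma one_le_coveringNumber (hF : F.Nonempty) (ε : ℝ) (k : Fin K) (xs : Fin T → X) :
    1 ≤ coveringNumber ((fun f x => f x k) '' F) ε xs := by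
  obtain ⟨f, hf⟩ := hF
  refine le_iInf₂ fun V hV => ?_
  obtain ⟨v, hv, -⟩ := hV _ ⟨f, hf, rfl⟩
  exact_mod_cast Finset.card_pos.2 ⟨v, hv⟩

variable [MeasurableSpace X] {D : Measure (X × (Fin K → ℝ))} [IsProbabilityMeasure D]

lemma exists_mesh {ε : ℝ} (hε : 0 < ε) : ∃ q : ℕ, 0 < q ∧ 1 / (q : ℝ) ≤ ε := by
  obtain ⟨n, hn⟩ := exists_nat_one_div_lt hε
  exact ⟨n + 1, n.succ_pos, by exact_mod_cast hn.le⟩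

lemma lintegral_coveringNumber_ne_top (hF01 : ∀ f ∈ F, ∀ y k, f y k ∈ Icc (0 : ℝ) 1) (hT : 1 ≤ T)
    {ε : ℝ} (hε : 0 < ε) (k : Fin K) :
    ∫⁻ xs : Fin T → X, (coveringNumber ((fun f x => f x k) '' F) ε xs : ENNReal)
      ∂(Measure.pi fun _ => D.map Prod.fst) ≠ ⊤ := by
  obtain ⟨q, hq, hqε⟩ := exists_mesh hε
  have : IsProbabilityMeasure (D.map Prod.fst) :=
    Measure.isProbabilityMeasure_map measurable_fst.aemeasurable
  refine ne_top_of_le_ne_top (b := ((Fintype.card (Fin T → Fin (q + 1)) : ℕ) : ENNReal))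
    (ENNReal.natCast_ne_top _) ?_
  calc _ ≤ ∫⁻ _xs : Fin T → X, ((Fintype.card (Fin T → Fin (q + 1)) : ℕ) : ENNReal)
        ∂(Measure.pi fun _ => D.map Prod.fst) := by
        refine lintegral_mono fun xs => ?_
        exact (ENat.toENNReal_le.2 (coveringNumber_le_card hF01 hT hq hqε k xs)).trans_eq
          (ENat.toENNReal_coe _)
    _ = _ := by simp

lemma one_le_expectedCover (hF01 : ∀ f ∈ F, ∀ y k, f y k ∈ Icc (0 : ℝ) 1) (hF : F.Nonempty)
    (hT : 1 ≤ T) {ε : ℝ} (hε : 0 < ε) (k : Fin K) : 1 ≤ expectedCover D F T ε k := by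
  have : IsProbabilityMeasure (D.map Prod.fst) :=
    Measure.isProbabilityMeasure_map measurable_fst.aemeasurable
  rw [expectedCover, ← ENNReal.toReal_one]
  refine ENNReal.toReal_mono (lintegral_coveringNumber_ne_top hF01 hT hε k) ?_
  calc (1 : ENNReal) = ∫⁻ _xs : Fin T → X, 1 ∂(Measure.pi fun _ => D.map Prod.fst) := by simp
    _ ≤ _ := lintegral_mono fun xs => by
      exact ENat.toENNReal_one.symm.trans_le (ENat.toENNReal_le.2 (one_le_coveringNumber hF ε k xs))

/-- Empirical covers in the grid for the values of one action. -/
lemma nonempty_sampleCover_singleton (hF01 : ∀ f ∈ F, ∀ y k, f y k ∈ Icc (0 : ℝ) 1)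
    (hFm : ∀ f ∈ F, ∀ k, Measurable fun y => f y k) {F₀ : Set (X → Fin K → ℝ)} (hF₀ : F₀ ⊆ F)
    (hF₀c : F₀.Countable) (hT : 1 ≤ T) {ε : ℝ} (hε : 0 < ε) (k : Fin K) :
    Nonempty (SampleCover (D.map Prod.fst) F₀ T {k} (2 * ε * T) (expectedCover D F T ε k)) := by
  classical
  obtain ⟨q, hq, hqε⟩ := exists_mesh hε
  have hT' : (0 : ℝ) < T := by exact_mod_cast hT
  set n := Fintype.card (Fin T → Fin (q + 1)) with hn
  set E : (Fin T → Fin (q + 1)) ≃ Fin n := Fintype.equivFin _ with hE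
  -- The samples at which the grid points in V form a cover. Rounding arbitrary centres to the grid
  -- doubles the error ε, but leaves only finitely many candidates V; countability of F₀ makes these
  -- sets measurable.
  set A : Finset (Fin n) → Set (Fin T → X) := fun V =>
    ⋂ f ∈ F₀, ⋃ j ∈ V, {xs | ∑ t, |f (xs t) k - ((E.symm j t : ℕ) : ℝ) / q| ≤ 2 * ε * T} with hA
  have hAm : ∀ V, MeasurableSet (A V) := by
    intro V
    refine MeasurableSet.biInter hF₀c fun f hf => Finset.measurableSet_biUnion _ fun j _ => ?_
    refine measurableSet_le (Finset.measurable_sum _ fun t _ => ?_) measurable_const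
    exact (((hFm f (hF₀ hf) k).comp (measurable_pi_apply t)).sub measurable_const).norm
  have hround : ∀ (xs : Fin T → X) (V : Finset (Fin T → ℝ)),
      (∀ g ∈ (fun f x => f x k) '' F, ∃ v ∈ V, (1 / (T : ℝ)) * ∑ t, |g (xs t) - v t| ≤ ε) →
      xs ∈ A (V.image fun v => E fun t => gridRound q (v t)) := by
    intro xs V hV
    refine mem_iInter₂.2 fun f hf => ?_
    obtain ⟨v, hv, hve⟩ := hV _ ⟨f, hF₀ hf, rfl⟩
    refine mem_iUnion₂.2 ⟨E fun t => gridRound q (v t), Finset.mem_image_of_mem _ hv, ?_⟩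
    have h := sum_abs_sub_gridRound_le hq hqε (p := fun t => f (xs t) k) (u := v)
      fun t => hF01 f (hF₀ hf) _ k
    rw [one_div, inv_mul_le_iff₀ hT'] at hve
    simp only [mem_ofPred_eq, Equiv.symm_apply_apply]
    linarith
  have hex : ∀ xs, ∃ V, xs ∈ A V := by
    intro xs
    refine ⟨_, hround xs (Finset.univ.image fun (g : Fin T → Fin (q + 1)) t => ((g t : ℕ) : ℝ) / q) ?_⟩
    rintro _ ⟨f, hf, rfl⟩
    refine ⟨fun t => (gridRound q (f (xs t) k) : ℕ) / q, Finset.mem_image.2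
      ⟨fun t => gridRound q (f (xs t) k), Finset.mem_univ _, rfl⟩, ?_⟩
    have h := sum_abs_sub_gridRound_le hq hqε (p := fun t => f (xs t) k)
      (u := fun t => f (xs t) k) fun t => hF01 f hf _ k
    rw [one_div, inv_mul_le_iff₀ hT']
    simpa [mul_comm] using h
  obtain ⟨sel, hsm, hsA, hsle⟩ := exists_measurable_argmin Finset.card hAm hex
  refine ⟨⟨n, fun j _ t _ => ((E.symm j t : ℕ) : ℝ) / q, ?_, fun _ _ _ => measurable_const, sel, hsm,
    ?_, ?_⟩⟩
  · intro j xs t k'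
    refine ⟨by positivity, div_le_one_of_le₀ ?_ (by positivity)⟩
    exact_mod_cast Nat.lt_succ_iff.1 (E.symm j t).2
  · intro f hf xs
    obtain ⟨j, hj, hje⟩ := mem_iUnion₂.1 (mem_iInter₂.1 (hsA xs) f hf)
    exact ⟨j, hj, by simpa using hje⟩
  -- The comparison is pointwise: rounding an optimal cover gives a candidate of no larger size, and
  -- a smallest candidate is selected. Monotonicity of the integral requires no measurability of the
  -- covering number.
  · rw [expectedCover, ENNReal.ofReal_toReal (lintegral_coveringNumber_ne_top hF01 hT hε k)]
    refine lintegral_mono fun xs => ?_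
    have h : ((sel xs).card : ℕ∞) ≤ coveringNumber ((fun f x => f x k) '' F) ε xs := by
      refine le_iInf₂ fun V hV => ?_
      exact_mod_cast (hsle xs _ (hround xs V hV)).trans Finset.card_image_le
    exact (ENat.toENNReal_coe _).symm.trans_le (ENat.toENNReal_le.2 h)

end Grid

/-! ### Confidence radii -/

/-- Sample covers for the blocks `S j` of a partition of the actions that are fine enough to yield
deviation bounds with the radius `C` and the confidence parameter `δ`. -/
structure BlockCover {X : Type*} [MeasurableSpace X] {K : ℕ} (μ : Measure X)
    (F₀ : Set (X → Fin K → ℝ)) (T : ℕ) (δ C : ℝ) where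
  /-- the number of blocks -/
  num : ℕ
  /-- the blocks -/
  S : Fin num → Finset (Fin K)
  sum_block : ∀ g : Fin K → ℝ, ∑ j, ∑ k ∈ S j, g k = ∑ k, g k
  /-- the errors of the covers -/
  e : Fin num → ℝ
  /-- the sizes of the covers -/
  N : Fin num → ℝ
  N_nonneg : ∀ j, 0 ≤ N j
  /-- the logarithmic confidence parameters -/
  l : Fin num → ℝ
  cover : ∀ j, SampleCover μ F₀ T (S j) (e j) (N j)
  excess_le : ∑ j, (16 / 3 * l j + 14 / 3 * e j) ≤ C / 3
  dev_le : ∑ j, (25 / 8 * (2 * l j) + 6 * e j) ≤ 2 / 5 * C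
  prob_le : ∑ j, N j * Real.exp (-l j) ≤ δ / (2 * T ^ 2)

lemma log_four_div_le_finiteRadius {X : Type*} {K T : ℕ} {F : Set (X → Fin K → ℝ)} {δ : ℝ}
    (hF : F.Finite) (hne : F.Nonempty) (hT : 2 ≤ T)
    (hδ : δ ∈ Ioo (0 : ℝ) 1) : Real.log (4 / δ) ≤ finiteRadius F T δ := by
  have hn : (1 : ℝ) ≤ F.ncard := by exact_mod_cast (Set.ncard_pos hF).2 hne
  have hT' : (2 : ℝ) ≤ T := by exact_mod_cast hT
  have h0 : 0 ≤ Real.log (4 / δ) :=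
    Real.log_nonneg (by rw [le_div_iff₀ hδ.1]; linarith [hδ.2])
  have h1 : Real.log (4 / δ) ≤ Real.log (2 * F.ncard * (T : ℝ) ^ 2 / δ) := by
    refine Real.log_le_log (div_pos (by norm_num) hδ.1) ?_
    have : 4 ≤ 2 * F.ncard * (T : ℝ) ^ 2 := by nlinarith
    have := hδ.1
    gcongr
  rw [finiteRadius]
  linarith

lemma log_four_div_pos {δ : ℝ} (hδ : δ ∈ Ioo (0 : ℝ) 1) : 1 ≤ Real.log (4 / δ) := by
  rw [Real.le_log_iff_exp_le (div_pos (by norm_num) hδ.1), le_div_iff₀ hδ.1]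
  have := Real.exp_one_lt_d9
  nlinarith [hδ.1, hδ.2]

section Radius

variable {X : Type*} [MeasurableSpace X] {K T : ℕ} {D : Measure (X × (Fin K → ℝ))}
  {F : Set (X → Fin K → ℝ)} {fstar : X → Fin K → ℝ} {pistar : X → Fin K} {δ C : ℝ}

lemma IsInstance.card_pos (hI : IsInstance D F fstar pistar) : 0 < K := by
  have := hI.prob
  obtain ⟨z⟩ : Nonempty (X × (Fin K → ℝ)) := nonempty_of_isProbabilityMeasure D
  exact Fin.pos (pistar z.1)

lemma coverTerm_ge (hI : IsInstance D F fstar pistar) (hT : 2 ≤ T) (hδ : δ ∈ Ioo (0 : ℝ) 1) {ε : ℝ}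
    (hε : 0 < ε) (k : Fin K) :
    8 * (K : ℝ) * T ^ 2 / 3 / δ ≤ 8 * expectedCover D F T ε k * K * (T : ℝ) ^ 2 * Real.log T / δ := by
  have := hI.prob
  have hN := one_le_expectedCover (D := D) hI.pred_mem ⟨fstar, hI.star_mem⟩ (by omega : 1 ≤ T) hε k
  have hT' : (2 : ℝ) ≤ T := by exact_mod_cast hT
  have hlog : 1 / 3 ≤ Real.log T := by
    have := Real.log_two_gt_d9
    linarith [Real.log_le_log (by norm_num) hT']
  have h2 := hδ.1
  have h1 : 1 / 3 ≤ expectedCover D F T ε k * Real.log T := by nlinarith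
  have h3 : 8 * (K : ℝ) * T ^ 2 / 3 ≤ 8 * expectedCover D F T ε k * K * (T : ℝ) ^ 2 * Real.log T := by
    have : 0 ≤ 8 * (K : ℝ) * T ^ 2 := by positivity
    nlinarith
  gcongr

lemma log_four_div_le_coverTerm (hI : IsInstance D F fstar pistar) (hT : 2 ≤ T)
    (hδ : δ ∈ Ioo (0 : ℝ) 1) {ε : ℝ} (hε : 0 < ε) (k : Fin K) :
    Real.log (4 / δ) ≤
      Real.log (8 * expectedCover D F T ε k * K * (T : ℝ) ^ 2 * Real.log T / δ) := by
  refine Real.log_le_log (div_pos (by norm_num) hδ.1) (le_trans ?_ (coverTerm_ge hI hT hδ hε k))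
  have hK : (1 : ℝ) ≤ K := by exact_mod_cast hI.card_pos
  have hT' : (2 : ℝ) ≤ T := by exact_mod_cast hT
  have : (4 : ℝ) ≤ 8 * K * T ^ 2 / 3 := by nlinarith [mul_le_mul hT' hT' (by norm_num) (by linarith)]
  have := hδ.1
  gcongr

lemma log_four_div_le_coverValue (hI : IsInstance D F fstar pistar) (hT : 2 ≤ T)
    (hδ : δ ∈ Ioo (0 : ℝ) 1) {ε : ℝ} (hε : 0 < ε) :
    Real.log (4 / δ) ≤ 100 * ε * K * T + 320 * ∑ k : Fin K,
      Real.log (8 * expectedCover D F T ε k * K * (T : ℝ) ^ 2 * Real.log T / δ) := by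
  have h0 := log_four_div_pos hδ
  have h1 : Real.log (4 / δ) ≤ ∑ k : Fin K,
      Real.log (8 * expectedCover D F T ε k * K * (T : ℝ) ^ 2 * Real.log T / δ) :=
    (log_four_div_le_coverTerm hI hT hδ hε ⟨0, hI.card_pos⟩).trans
      (Finset.single_le_sum (f := fun k : Fin K =>
        Real.log (8 * expectedCover D F T ε k * K * (T : ℝ) ^ 2 * Real.log T / δ))
        (fun k _ => by linarith [log_four_div_le_coverTerm hI hT hδ hε k]) (Finset.mem_univ _))
  have h2 : 0 ≤ 100 * ε * K * T := by positivity
  linarith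

lemma log_four_div_le_coverRadius (hI : IsInstance D F fstar pistar) (hT : 2 ≤ T)
    (hδ : δ ∈ Ioo (0 : ℝ) 1) : Real.log (4 / δ) ≤ coverRadius D F T δ := by
  refine le_csInf (nonempty_Ioi.image _) ?_
  rintro _ ⟨ε, hε, rfl⟩
  exact log_four_div_le_coverValue hI hT hδ hε

/-- Gives C ≥ 1 and lets C dominate the level log(4/δ) at which each of the two sums of reward noise
fails with probability at most δ/4. -/
lemma IsRadius.log_four_div_le (hI : IsInstance D F fstar pistar) (hT : 2 ≤ T)
    (hδ : δ ∈ Ioo (0 : ℝ) 1) (hC : IsRadius D F T δ C) : Real.log (4 / δ) ≤ C := by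
  have h1 := log_four_div_le_coverRadius hI hT hδ
  rcases hC with ⟨hF, rfl | rfl⟩ | ⟨-, rfl⟩
  · exact log_four_div_le_finiteRadius hF ⟨_, hI.star_mem⟩ hT hδ
  · exact le_min (log_four_div_le_finiteRadius hF ⟨_, hI.star_mem⟩ hT hδ) h1
  · exact h1

/-- `F₀` is a countable subclass of `F` that is dense for pointwise convergence of sequences. -/
def IsDenseSubclass (F₀ F : Set (X → Fin K → ℝ)) : Prop :=
  F₀ ⊆ F ∧ F₀.Countable ∧ ∀ f ∈ F, ∃ s : ℕ → X → Fin K → ℝ, (∀ n, s n ∈ F₀) ∧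
    ∀ x k, Filter.Tendsto (fun n => s n x k) Filter.atTop (nhds (f x k))

/-- A single block with error 0 and l = C/16: then 16/3 · l = C/3, 25/4 · l ≤ 2/5 · 16 l, and |F|
exp(-l) = δ/(2T²). -/
lemma nonempty_blockCover_finite (hI : IsInstance D F fstar pistar) (hF : F.Finite) (hT : 2 ≤ T)
    (hδ : δ ∈ Ioo (0 : ℝ) 1) :
    Nonempty (BlockCover (D.map Prod.fst) F T δ (finiteRadius F T δ)) := by
  have := hI.prob
  have : IsProbabilityMeasure (D.map Prod.fst) :=
    Measure.isProbabilityMeasure_map measurable_fst.aemeasurable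
  have hn : (1 : ℝ) ≤ F.ncard := by exact_mod_cast (Set.ncard_pos hF).2 ⟨_, hI.star_mem⟩
  have hT' : (2 : ℝ) ≤ T := by exact_mod_cast hT
  have hδ0 := hδ.1
  have hpos : 0 < 2 * F.ncard * (T : ℝ) ^ 2 / δ := by positivity
  refine ⟨⟨1, fun _ => Finset.univ, fun g => by simp, fun _ => 0, fun _ => F.ncard,
    fun _ => by positivity, fun _ => Real.log (2 * F.ncard * (T : ℝ) ^ 2 / δ),
    fun _ => SampleCover.ofFinite _ hF hI.pred_mem hI.pred_meas T, ?_, ?_, ?_⟩⟩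
  · simp [finiteRadius]; linarith
  · have h := log_four_div_le_finiteRadius hF ⟨_, hI.star_mem⟩ hT hδ
    have h' := log_four_div_pos hδ
    simp only [finiteRadius] at h
    simp [finiteRadius]; linarith
  · simp only [Finset.sum_const, Finset.card_univ, Fintype.card_fin, one_smul]
    rw [Real.exp_neg, Real.exp_log hpos]
    apply le_of_eq
    field_simp

/-- One block per action, since the covering numbers refer to the classes F|_k separately. The
factor K inside the logarithm shares the failure probability among the blocks. -/
lemma nonempty_blockCover_cover (hI : IsInstance D F fstar pistar) {F₀ : Set (X → Fin K → ℝ)}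
    (hF₀ : F₀ ⊆ F) (hF₀c : F₀.Countable) (hT : 2 ≤ T) (hδ : δ ∈ Ioo (0 : ℝ) 1) :
    Nonempty (BlockCover (D.map Prod.fst) F₀ T δ (coverRadius D F T δ)) := by
  have := hI.prob
  have hR := (log_four_div_pos hδ).trans (log_four_div_le_coverRadius hI hT hδ)
  -- The infimum need not be attained, so ε is optimal only up to a factor 2; the constants 100 and
  -- 320 leave room for it.
  obtain ⟨_, ⟨ε, hε, rfl⟩, hlt⟩ := exists_lt_of_csInf_lt (nonempty_Ioi.image _)
    (show coverRadius D F T δ < 2 * coverRadius D F T δ by linarith)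
  have hε : 0 < ε := hε
  have hT' : (2 : ℝ) ≤ T := by exact_mod_cast hT
  have hK : (1 : ℝ) ≤ K := by exact_mod_cast hI.card_pos
  have hδ0 := hδ.1
  set L : Fin K → ℝ := fun k =>
    Real.log (8 * expectedCover D F T ε k * K * (T : ℝ) ^ 2 * Real.log T / δ) with hL
  have hL0 : 0 ≤ ∑ k, L k := Finset.sum_nonneg fun k _ => by
    linarith [log_four_div_le_coverTerm hI hT hδ hε k, log_four_div_pos hδ]
  have hεKT : 0 ≤ ε * K * T := by positivity
  have hN : ∀ k, 1 ≤ expectedCover D F T ε k := fun k =>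
    one_le_expectedCover hI.pred_mem ⟨_, hI.star_mem⟩ (by omega) hε k
  refine ⟨⟨K, fun k => {k}, fun g => by simp, fun _ => 2 * ε * T, fun k => expectedCover D F T ε k,
    fun k => zero_le_one.trans (hN k), L,
    fun k => (nonempty_sampleCover_singleton hI.pred_mem hI.pred_meas hF₀ hF₀c (by omega) hε k).some,
    ?_, ?_, ?_⟩⟩
  · rw [Finset.sum_add_distrib, ← Finset.mul_sum, Finset.sum_const, Finset.card_univ,
      Fintype.card_fin, nsmul_eq_mul]
    nlinarith
  · rw [Finset.sum_add_distrib, ← Finset.mul_sum, ← Finset.mul_sum, Finset.sum_const,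
      Finset.card_univ, Fintype.card_fin, nsmul_eq_mul]
    nlinarith
  · have hlog : 1 / 2 ≤ Real.log T := by
      have := Real.log_two_gt_d9
      linarith [Real.log_le_log (by norm_num) hT']
    calc ∑ k, expectedCover D F T ε k * Real.exp (-L k)
        ≤ ∑ _k : Fin K, δ / (2 * T ^ 2) / K := by
          refine Finset.sum_le_sum fun k _ => ?_
          have h1 := hN k
          have hl : 0 < Real.log T := by linarith
          rw [Real.exp_neg, hL, Real.exp_log (by positivity), inv_div, mul_div_assoc',
            div_div, div_le_div_iff₀ (by positivity) (by positivity)]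
          have h2 : 0 ≤ expectedCover D F T ε k * δ * ((T : ℝ) ^ 2 * K) := by positivity
          nlinarith
      _ = _ := by
          rw [Finset.sum_const, Finset.card_univ, Fintype.card_fin, nsmul_eq_mul]
          field_simp

lemma IsRadius.exists_blockCover (hI : IsInstance D F fstar pistar) (hT : 2 ≤ T)
    (hδ : δ ∈ Ioo (0 : ℝ) 1) (hC : IsRadius D F T δ C) :
    ∃ F₀, IsDenseSubclass F₀ F ∧ Nonempty (BlockCover (D.map Prod.fst) F₀ T δ C) := by
  obtain ⟨F₀, h1, h2, h3⟩ := hI.separable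
  have hcov : ∃ F₀, IsDenseSubclass F₀ F ∧
      Nonempty (BlockCover (D.map Prod.fst) F₀ T δ (coverRadius D F T δ)) :=
    ⟨F₀, ⟨h1, h2, h3⟩, nonempty_blockCover_cover hI h1 h2 hT hδ⟩
  have hfin : F.Finite → ∃ F₀, IsDenseSubclass F₀ F ∧
      Nonempty (BlockCover (D.map Prod.fst) F₀ T δ (finiteRadius F T δ)) := fun hF =>
    ⟨F, ⟨Subset.rfl, hF.countable, fun f hf => ⟨fun _ => f, fun _ => hf, fun x k =>
      tendsto_const_nhds⟩⟩, nonempty_blockCover_finite hI hF hT hδ⟩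
  rcases hC with ⟨hF, rfl | rfl⟩ | ⟨-, rfl⟩
  · exact hfin hF
  · rcases min_choice (finiteRadius F T δ) (coverRadius D F T δ) with h | h <;> rw [h]
    · exact hfin hF
    · exact hcov
  · exact hcov

end Radius

/-! ### Deviation bounds for the whole class -/

section Block

variable {X : Type*} [MeasurableSpace X] {K T : ℕ} {D : Measure (X × (Fin K → ℝ))}
  {F F₀ : Set (X → Fin K → ℝ)} {fstar : X → Fin K → ℝ} {pistar : X → Fin K} {δ C : ℝ}

lemma BlockCover.sum_ite_mem {μ : Measure X} (c : BlockCover μ F₀ T δ C) (k : Fin K) (v : ℝ) :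
    ∑ j, (if k ∈ c.S j then v else 0) = v := by
  have h := c.sum_block fun k' => if k' = k then v else 0
  simpa using h

/-- Symmetrization squares the cover size, which is why it is used at level 2l: each term is the
square of N exp(-l) ≤ 1. -/
lemma BlockCover.sum_sq_le {μ : Measure X} (c : BlockCover μ F₀ T δ C) (hT : 1 ≤ T) (hδ : δ ≤ 1) :
    ∑ j, c.N j ^ 2 * Real.exp (-(2 * c.l j)) ≤ δ / (2 * T ^ 2) := by
  refine le_trans (Finset.sum_le_sum fun j _ => ?_) c.prob_le
  have h0 : ∀ j, 0 ≤ c.N j * Real.exp (-c.l j) := fun j =>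
    mul_nonneg (c.N_nonneg j) (Real.exp_pos _).le
  have h1 : c.N j * Real.exp (-c.l j) ≤ 1 := by
    refine ((Finset.single_le_sum (fun j _ => h0 j) (Finset.mem_univ j)).trans c.prob_le).trans ?_
    have hT' : (1 : ℝ) ≤ T := by exact_mod_cast hT
    rw [div_le_one (by positivity)]
    nlinarith
  calc c.N j ^ 2 * Real.exp (-(2 * c.l j)) = (c.N j * Real.exp (-c.l j)) ^ 2 := by
        rw [mul_pow, ← Real.exp_nat_mul]; ring_nf
    _ ≤ _ := by rw [sq]; exact mul_le_of_le_one_left (h0 j) h1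

variable {Ω : Type*} [mΩ : MeasurableSpace Ω] {P : Measure Ω} [IsProbabilityMeasure P]
  {x : ℕ → Ω → X} {r : ℕ → Ω → Fin K → ℝ} {a : ℕ → Ω → Fin K} {H : ℕ → MeasurableSpace Ω}

lemma ofReal_sum_le {m : ℕ} {q : Fin m → ℝ} (hq : ∀ j, 0 ≤ q j) {c : ℝ} (h : ∑ j, q j ≤ c) :
    ∑ j, ENNReal.ofReal (q j) ≤ ENNReal.ofReal c := by
  rw [← ENNReal.ofReal_sum_of_nonneg fun j _ => hq j]
  exact ENNReal.ofReal_le_ofReal h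

/-- Summing over the blocks recovers all actions. Off the exceptional event the inequality for F₀ is
not strict and involves finitely many values of f, so it survives pointwise limits and holds on F.
-/
lemma BlockCover.measure_excess_lt_le (hI : IsInstance D F fstar pistar)
    (hF₀ : IsDenseSubclass F₀ F) (c : BlockCover (D.map Prod.fst) F₀ T δ C)
    (hH : IsRewardFiltration fstar P T x r a H)
    (hr : ∀ t ∈ Finset.Icc 1 T, Measurable (r t))
    (hr01 : ∀ᵐ ω ∂P, ∀ t ∈ Finset.Icc 1 T, ∀ k, r t ω k ∈ Icc (0 : ℝ) 1)
    (hlaw : P.map (fun ω (t : Fin T) => x (t + 1) ω) = Measure.pi fun _ => D.map Prod.fst)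
    (hT : 1 ≤ T) {n : ℕ} (hn : n ≤ T) :
    P {ω | ∃ f ∈ F, 4 / 3 * ∑ s ∈ Finset.Icc 1 n,
        ((f (x s ω) (a s ω) - r s ω (a s ω)) ^ 2 - (fstar (x s ω) (a s ω) - r s ω (a s ω)) ^ 2)
        + C / 3 < ∑ s ∈ Finset.Icc 1 n, (f (x s ω) (a s ω) - fstar (x s ω) (a s ω)) ^ 2} ≤
    ENNReal.ofReal (δ / (2 * T ^ 2)) := by
  obtain ⟨hsub, -, hdense⟩ := hF₀
  have hblock := fun j => hH.measure_excess_lt_le (hI.pred_meas _ hI.star_mem)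
    (hI.pred_mem _ hI.star_mem) hr hr01 (fun f hf => hI.pred_mem f (hsub hf)) (c.cover j) hlaw hT hn
    (c.l j)
  refine le_trans (measure_mono ?_) ((measure_iUnion_fintype_le P _).trans
    ((Finset.sum_le_sum fun j _ => hblock j).trans
    (ofReal_sum_le (fun j => mul_nonneg (c.N_nonneg j) (Real.exp_pos _).le) c.prob_le)))
  intro ω hω
  by_contra hcon
  simp only [mem_iUnion, mem_ofPred_eq, not_exists, not_and, not_lt] at hcon
  obtain ⟨f, hf, hlt⟩ := hω
  refine absurd hlt (not_lt.2 ?_)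
  obtain ⟨s, hs, hlim⟩ := hdense f hf
  have hF₀le : ∀ g ∈ F₀, ∑ s ∈ Finset.Icc 1 n, (g (x s ω) (a s ω) - fstar (x s ω) (a s ω)) ^ 2 ≤
      4 / 3 * ∑ s ∈ Finset.Icc 1 n, ((g (x s ω) (a s ω) - r s ω (a s ω)) ^ 2 -
        (fstar (x s ω) (a s ω) - r s ω (a s ω)) ^ 2) + C / 3 := by
    intro g hg
    have h1 := Finset.sum_le_sum fun j (_ : j ∈ Finset.univ) => hcon j g hg
    have hcomm : ∀ u : ℕ → ℝ, ∑ j, ∑ s ∈ Finset.Icc 1 n, (if a s ω ∈ c.S j then u s else 0) =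
        ∑ s ∈ Finset.Icc 1 n, u s := fun u => by
      rw [Finset.sum_comm]
      exact Finset.sum_congr rfl fun s _ => c.sum_ite_mem _ _
    simp only [add_assoc] at h1
    rw [hcomm, Finset.sum_add_distrib, ← Finset.mul_sum, hcomm] at h1
    linarith [c.excess_le]
  refine le_of_tendsto_of_tendsto' (b := Filter.atTop (α := ℕ)) ?_ ?_ fun i => hF₀le (s i) (hs i)
  · exact tendsto_finsetSum _ fun t _ => ((hlim _ _).sub_const _).pow 2
  · exact ((tendsto_finsetSum _ fun t _ => (((hlim _ _).sub_const _).pow 2).sub_const _).const_mul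
      _).add_const _

/-- The same passage from F₀ to F, with dominated convergence for the expectations. -/
lemma BlockCover.measure_expectation_gt_le (hI : IsInstance D F fstar pistar)
    (hF₀ : IsDenseSubclass F₀ F) (c : BlockCover (D.map Prod.fst) F₀ T δ C) (hδ : δ ≤ 1) (hT : 1 ≤ T)
    (ν : Fin T → Measure (X × Fin K))
    [∀ i, IsProbabilityMeasure (ν i)] (hν : ∀ i, (ν i).map Prod.fst = D.map Prod.fst)
    {w : Fin T → X × Fin K → Fin K → ℝ} (hw : ∀ i k, Measurable fun y => w i y k)
    (hw0 : ∀ i y k, 0 ≤ w i y k) (hw1 : ∀ i y, ∑ k, w i y k ≤ 1) :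
    Measure.pi ν {y | ∃ f ∈ F, 3 / 2 * ∑ i, ∑ k, w i (y i) k *
        (f (y i).1 k - fstar (y i).1 k) ^ 2 + 2 / 5 * C <
      ∑ i, ∑ k, ∫ u, w i u k * (f u.1 k - fstar u.1 k) ^ 2 ∂ν i} ≤
    ENNReal.ofReal (δ / (2 * T ^ 2)) := by
  have := hI.prob
  have : IsProbabilityMeasure (D.map Prod.fst) :=
    Measure.isProbabilityMeasure_map measurable_fst.aemeasurable
  obtain ⟨hsub, hcount, hdense⟩ := hF₀
  have hfm := hI.pred_meas _ hI.star_mem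
  have hf01 := hI.pred_mem _ hI.star_mem
  have hblock := fun j => (c.cover j).measure_expectation_gt_le hcount
    (fun f hf => hI.pred_mem f (hsub hf)) (fun f hf => hI.pred_meas f (hsub hf)) hfm hf01 ν hν hw
    hw0 hw1 (c.N_nonneg j) (2 * c.l j)
  refine le_trans (measure_mono ?_) ((measure_iUnion_fintype_le _ _).trans
    ((Finset.sum_le_sum fun j _ => hblock j).trans
    (ofReal_sum_le (fun j => mul_nonneg (sq_nonneg _) (Real.exp_pos _).le) (c.sum_sq_le hT hδ))))
  have hwk : ∀ i y k, w i y k ≤ 1 := fun i y k =>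
    (Finset.single_le_sum (f := fun k => w i y k) (fun k _ => hw0 i y k)
      (Finset.mem_univ k)).trans (hw1 i y)
  have hterm : ∀ f ∈ F, ∀ i k u, ‖w i u k * (f u.1 k - fstar u.1 k) ^ 2‖ ≤ 1 := by
    intro f hf i k u
    have h1 := sq_sub_mem_Icc (hI.pred_mem f hf u.1 k) (hf01 u.1 k)
    rw [Real.norm_eq_abs, abs_of_nonneg (mul_nonneg (hw0 i u k) h1.1)]
    exact mul_le_one₀ (hwk i u k) h1.1 h1.2
  have hmeas : ∀ f ∈ F, ∀ i k, Measurable fun u : X × Fin K =>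
      w i u k * (f u.1 k - fstar u.1 k) ^ 2 := fun f hf i k =>
    (hw i k).mul ((((hI.pred_meas f hf k).comp measurable_fst).sub
      ((hfm k).comp measurable_fst)).pow_const 2)
  have hint : ∀ f ∈ F, ∀ i k, Integrable (fun u : X × Fin K =>
      w i u k * (f u.1 k - fstar u.1 k) ^ 2) (ν i) := fun f hf i k =>
    Integrable.of_bound (hmeas f hf i k).aestronglyMeasurable 1
      (Filter.Eventually.of_forall (hterm f hf i k))
  intro y hy
  by_contra hcon
  simp only [mem_iUnion, mem_ofPred_eq, not_exists, not_and, not_lt] at hcon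
  obtain ⟨f, hf, hlt⟩ := hy
  refine absurd hlt (not_lt.2 ?_)
  obtain ⟨s, hs, hlim⟩ := hdense f hf
  have hF₀le : ∀ g ∈ F₀, ∑ i, ∑ k, ∫ u, w i u k * (g u.1 k - fstar u.1 k) ^ 2 ∂ν i ≤
      3 / 2 * ∑ i, ∑ k, w i (y i) k * (g (y i).1 k - fstar (y i).1 k) ^ 2 + 2 / 5 * C := by
    intro g hg
    have h1 := Finset.sum_le_sum fun j (_ : j ∈ Finset.univ) => hcon j g hg
    have hcomm : ∀ u : Fin T → Fin K → ℝ, ∑ j, ∑ i, ∑ k ∈ c.S j, u i k = ∑ i, ∑ k, u i k :=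
      fun u => by
        rw [Finset.sum_comm]
        exact Finset.sum_congr rfl fun i _ => c.sum_block _
    have hinteq : ∀ j i, ∫ u, ∑ k ∈ c.S j, w i u k * (g u.1 k - fstar u.1 k) ^ 2 ∂ν i =
        ∑ k ∈ c.S j, ∫ u, w i u k * (g u.1 k - fstar u.1 k) ^ 2 ∂ν i := fun j i =>
      integral_finsetSum _ fun k _ => hint g (hsub hg) i k
    simp only [hinteq, add_assoc] at h1
    rw [hcomm, Finset.sum_add_distrib, ← Finset.mul_sum, hcomm] at h1
    linarith [c.dev_le]
  refine le_of_tendsto_of_tendsto' (b := Filter.atTop (α := ℕ)) ?_ ?_ fun i => hF₀le (s i) (hs i)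
  · refine tendsto_finsetSum _ fun i _ => tendsto_finsetSum _ fun k _ => ?_
    refine tendsto_integral_of_dominated_convergence (fun _ => 1)
      (fun n => (hmeas _ (hsub (hs n)) i k).aestronglyMeasurable) (integrable_const _)
      (fun n => Filter.Eventually.of_forall (hterm _ (hsub (hs n)) i k))
      (Filter.Eventually.of_forall fun u => ?_)
    exact (((hlim _ _).sub_const _).pow 2).const_mul _
  · refine (Filter.Tendsto.const_mul _ (tendsto_finsetSum _ fun i _ =>
      tendsto_finsetSum _ fun k _ => ?_)).add_const _
    exact (((hlim _ _).sub_const _).pow 2).const_mul _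

end Block

/-! ### The law of the contexts and of the exploratory actions -/

section Law

variable {X Ω : Type*} [MeasurableSpace X] [mΩ : MeasurableSpace Ω] {K : ℕ}
  {D : Measure (X × (Fin K → ℝ))} {F : Set (X → Fin K → ℝ)} {fstar : X → Fin K → ℝ}
  {pistar : X → Fin K} {T M₀ : ℕ} {β : ℕ → ℝ} {P : Measure Ω} {x : ℕ → Ω → X}
  {r : ℕ → Ω → Fin K → ℝ} {a : ℕ → Ω → Fin K}

/-- The actions before round `τ`, and a fixed action from then on. -/
def earlyAction (a : ℕ → Ω → Fin K) (τ : ℕ) (k₀ : Fin K) (t : ℕ) (ω : Ω) : Fin K :=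
  if t < τ then a t ω else k₀

lemma IsOptimisticRun.measurable_earlyAction (hR : IsOptimisticRun D F T M₀ β P x r a) (τ : ℕ)
    (k₀ : Fin K) {t : ℕ} (ht : t ∈ Finset.Icc 1 T) : Measurable (earlyAction a τ k₀ t) := by
  unfold earlyAction
  by_cases h : t < τ
  · simpa [h] using (hR.meas t ht).2.2
  · simp [h]

/-- Before `epochStart M₀` the action is independent of the past and of the current round, hence so
is the pair with the context. Later actions depend on the past and are frozen at k₀; τ = 0 retains
the contexts alone. -/
lemma IsOptimisticRun.indep_earlyAction (hR : IsOptimisticRun D F T M₀ β P x r a) {τ : ℕ}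
    (hτ : τ ≤ epochStart M₀) (k₀ : Fin K) {t : ℕ} (ht : t ∈ Finset.Icc 1 T) :
    Indep (MeasurableSpace.comap (fun ω => (x t ω, earlyAction a τ k₀ t ω)) inferInstance)
      (⨆ s ∈ Finset.Ico 1 t,
        MeasurableSpace.comap (fun ω => (x s ω, earlyAction a τ k₀ s ω)) inferInstance) P := by
  have := hR.prob
  obtain ⟨G, hG⟩ := hR.nonanticipating
  have htT := Finset.mem_Icc.1 ht
  obtain ⟨hxt, hrt, hat⟩ := hR.meas t ht
  have hcurle : MeasurableSpace.comap (fun ω => (x t ω, r t ω)) inferInstance ≤ mΩ :=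
    (hxt.prodMk hrt).comap_le
  have hex := fun h : t < τ => (hR.explore t ht (h.trans_le hτ)).2
  have hatle : MeasurableSpace.comap (a t) inferInstance ≤ mΩ := hat.comap_le
  set past : MeasurableSpace Ω := ⨆ s ∈ Finset.Ico 1 t,
    MeasurableSpace.comap (fun ω => (x s ω, r s ω, a s ω)) inferInstance with hpast
  set cur : MeasurableSpace Ω := MeasurableSpace.comap (fun ω => (x t ω, r t ω)) inferInstance
    with hcur
  have hpastG : past ≤ G t := iSup₂_le fun s hs => by
    obtain ⟨h1, h2, h3⟩ := (hG t ht).1 s hs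
    exact (h1.prodMk (h2.prodMk h3)).comap_le
  have hearly : (⨆ s ∈ Finset.Ico 1 t,
      MeasurableSpace.comap (fun ω => (x s ω, earlyAction a τ k₀ s ω)) inferInstance) ≤ past := by
    refine iSup₂_mono fun s _ => ?_
    have hm := comap_measurable (m := inferInstance) (fun ω => (x s ω, r s ω, a s ω))
    refine Measurable.comap_le ((measurable_fst.comp hm).prodMk ?_)
    unfold earlyAction
    by_cases h : s < τ
    · simpa [h] using! (measurable_snd.comp measurable_snd).comp hm
    · simp [h]
  have hcurpast : Indep cur past P := indep_of_indep_of_le_right (hG t ht).2.1 hpastG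
  have hm := comap_measurable (m := inferInstance) (fun ω => (x t ω, r t ω))
  by_cases h : t < τ
  · have h3 : Indep past (cur ⊔ MeasurableSpace.comap (a t) inferInstance) P :=
      indep_sup_right_of_indep (hpastG.trans (G.le t)) hcurle hatle hcurpast.symm (hex h)
    refine indep_of_indep_of_le h3.symm ?_ hearly
    refine Measurable.comap_le (Measurable.prodMk ?_ ?_)
    · exact (measurable_fst.comp hm).mono le_sup_left le_rfl
    · have : earlyAction a τ k₀ t = a t := by funext ω; simp [earlyAction, h]
      rw [this]
      exact (comap_measurable (a t)).mono le_sup_right le_rfl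
  · refine indep_of_indep_of_le hcurpast ?_ hearly
    refine Measurable.comap_le ((measurable_fst.comp hm).prodMk ?_)
    unfold earlyAction
    simp [h]

lemma IsOptimisticRun.map_earlyAction_eq_pi (hR : IsOptimisticRun D F T M₀ β P x r a) {τ : ℕ}
    (hτ : τ ≤ epochStart M₀) (k₀ : Fin K) :
    P.map (fun ω (t : Fin T) => (x (t + 1) ω, earlyAction a τ k₀ (t + 1) ω)) =
      Measure.pi fun t : Fin T => P.map fun ω => (x (t + 1) ω, earlyAction a τ k₀ (t + 1) ω) := by
  have := hR.prob
  have hmem : ∀ t : Fin T, (t : ℕ) + 1 ∈ Finset.Icc 1 T := fun t =>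
    Finset.mem_Icc.2 ⟨by omega, t.2⟩
  have h1 := iIndep_of_sequential (P := P) fun t ht => hR.indep_earlyAction hτ k₀ ht
  have h2 : iIndepFun (fun (t : Fin T) ω => (x (t + 1) ω, earlyAction a τ k₀ (t + 1) ω)) P := by
    rw [iIndepFun_iff_iIndep]; exact h1
  exact (iIndepFun_iff_map_fun_eq_pi_map fun t => ((hR.meas _ (hmem t)).1.prodMk
    (hR.measurable_earlyAction τ k₀ (hmem t))).aemeasurable).1 h2

lemma IsOptimisticRun.map_context (hR : IsOptimisticRun D F T M₀ β P x r a) {t : ℕ}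
    (ht : t ∈ Finset.Icc 1 T) : P.map (x t) = D.map Prod.fst := by
  rw [← hR.law t ht, Measure.map_map measurable_fst ((hR.meas t ht).1.prodMk (hR.meas t ht).2.1)]
  rfl

lemma IsOptimisticRun.map_contexts_eq_pi (hR : IsOptimisticRun D F T M₀ β P x r a) (k₀ : Fin K) :
    P.map (fun ω (t : Fin T) => x (t + 1) ω) = Measure.pi fun _ => D.map Prod.fst := by
  have := hR.prob
  have hmem : ∀ t : Fin T, (t : ℕ) + 1 ∈ Finset.Icc 1 T := fun t =>
    Finset.mem_Icc.2 ⟨by omega, t.2⟩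
  have hm : ∀ t : Fin T, Measurable fun ω => (x (t + 1) ω, earlyAction a 0 k₀ (t + 1) ω) := fun t =>
    (hR.meas _ (hmem t)).1.prodMk (hR.measurable_earlyAction 0 k₀ (hmem t))
  have : ∀ t : Fin T,
      IsProbabilityMeasure (P.map fun ω => (x (t + 1) ω, earlyAction a 0 k₀ (t + 1) ω)) := fun t =>
    Measure.isProbabilityMeasure_map (hm t).aemeasurable
  have hp : ∀ t : Fin T, MeasurePreserving Prod.fst
      (P.map fun ω => (x (t + 1) ω, earlyAction a 0 k₀ (t + 1) ω)) (P.map (x (t + 1))) := fun t =>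
    ⟨measurable_fst, by rw [Measure.map_map measurable_fst (hm t)]; rfl⟩
  have : ∀ t : Fin T, IsProbabilityMeasure (P.map (x (t + 1))) := fun t =>
    Measure.isProbabilityMeasure_map (hR.meas _ (hmem t)).1.aemeasurable
  have h := measurePreserving_pi _ _ hp
  have h2 := h.map_eq
  rw [← hR.map_earlyAction_eq_pi (Nat.zero_le _) k₀, Measure.map_map h.measurable
    (measurable_pi_lambda _ hm)] at h2
  rw [show (fun ω (t : Fin T) => x (t + 1) ω) =
    (fun (y : Fin T → X × Fin K) t => (y t).1) ∘
      fun ω (t : Fin T) => (x (t + 1) ω, earlyAction a 0 k₀ (t + 1) ω) from rfl, h2]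
  exact congrArg _ (funext fun t => hR.map_context (hmem t))

end Law

/-! ### The event on which all deviation bounds hold -/

lemma two_le_warmStart (T : ℕ) (L₁ C lam : ℝ) : 2 ≤ warmStart T L₁ C lam := Nat.le_add_right _ _

lemma epochStart_pos (m : ℕ) : 1 ≤ epochStart m := Nat.one_le_two_pow

lemma epochStart_mono {m n : ℕ} (h : m ≤ n) : epochStart m ≤ epochStart n :=
  Nat.pow_le_pow_right (by norm_num) (by omega)

lemma epochStart_le {T m : ℕ} (hT : 1 ≤ T) (hm : m ≤ numEpochs T) : epochStart m ≤ T :=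
  (Nat.pow_le_pow_right (by norm_num) (by rw [numEpochs] at hm; omega)).trans
    (Nat.pow_log_le_self 2 (by omega))

lemma numEpochs_le {T : ℕ} (hT : 1 ≤ T) : numEpochs T ≤ T := Nat.log_lt_self 2 (by omega)

/-- The paths on which all deviation bounds hold. -/
structure IsGoodPath {X : Type*} [MeasurableSpace X] {K : ℕ} (D : Measure (X × (Fin K → ℝ)))
    (F : Set (X → Fin K → ℝ)) (fstar : X → Fin K → ℝ) (T : ℕ) (C lam : ℝ) (M₀ : ℕ)
    (x : ℕ → X) (r : ℕ → Fin K → ℝ) (a : ℕ → Fin K) : Prop where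
  reward : ∀ t ∈ Finset.Icc 1 T, ∀ k, r t k ∈ Icc (0 : ℝ) 1
  optimistic : ∀ m, M₀ ≤ m → ∀ t ∈ Finset.Icc 1 T, epochStart m ≤ t → t < epochStart (m + 1) →
    ∀ k, high (versionSpace F x a (fun s => r s (a s)) m (tolerance T C m)) (x t) k ≤
      high (versionSpace F x a (fun s => r s (a s)) m (tolerance T C m)) (x t) (a t)
  excess : ∀ m ∈ Finset.Icc 2 (numEpochs T), ∀ f ∈ F,
    ∑ s ∈ Finset.Ico 1 (epochStart m), (f (x s) (a s) - fstar (x s) (a s)) ^ 2 ≤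
      4 / 3 * ∑ s ∈ Finset.Ico 1 (epochStart m),
        ((f (x s) (a s) - r s (a s)) ^ 2 - (fstar (x s) (a s) - r s (a s)) ^ 2) + C / 3
  warm : M₀ ≤ numEpochs T → ∀ f ∈ F,
    ((epochStart M₀ : ℝ) - 1) * ∫ x', (1 / (K : ℝ)) * ∑ k, (f x' k - fstar x' k) ^ 2
      ∂(D.map Prod.fst) ≤
    3 / 2 * ∑ s ∈ Finset.Ico 1 (epochStart M₀), (f (x s) (a s) - fstar (x s) (a s)) ^ 2 + 2 / 5 * C
  margin : ∀ m ∈ Finset.Icc M₀ (numEpochs T), ∀ f ∈ F,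
    ((epochStart m : ℝ) - epochStart M₀) * ∫ x', ∑ k, (marginSet fstar lam k).indicator
      (fun y => (f y k - fstar y k) ^ 2) x' ∂(D.map Prod.fst) ≤
    3 / 2 * ∑ s ∈ Finset.Ico (epochStart M₀) (epochStart m), ∑ k,
      (marginSet fstar lam k).indicator (fun y => (f y k - fstar y k) ^ 2) (x s) + 2 / 5 * C

lemma sum_fin_ite_eq {T σ τ : ℕ} (hσ : 1 ≤ σ) (hτ : τ ≤ T) (g : ℕ → ℝ) :
    ∑ i : Fin T, (if σ ≤ (i : ℕ) + 1 ∧ (i : ℕ) + 1 < τ then g (i + 1) else 0) =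
      ∑ s ∈ Finset.Ico σ τ, g s := by
  rw [Fin.sum_univ_eq_sum_range (fun i => if σ ≤ i + 1 ∧ i + 1 < τ then g (i + 1) else 0) T,
    Finset.range_eq_Ico, Finset.sum_Ico_add' (fun i => if σ ≤ i ∧ i < τ then g i else 0),
    ← Finset.sum_filter]
  refine Finset.sum_congr ?_ fun _ _ => rfl
  ext s
  simp only [Finset.mem_filter, Finset.mem_Ico]
  omega

lemma measurableSet_marginSet {X : Type*} [MeasurableSpace X] {K : ℕ} {fstar : X → Fin K → ℝ}
    (hf : ∀ k, Measurable fun y => fstar y k) (lam : ℝ) (k : Fin K) :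
    MeasurableSet (marginSet fstar lam k) := by
  have : marginSet fstar lam k = ⋂ k', {y | k' ≠ k → fstar y k' + lam ≤ fstar y k} := by
    ext y; simp [marginSet]
  rw [this]
  refine MeasurableSet.iInter fun k' => ?_
  by_cases h : k' = k
  · simp [h]
  · simpa [h] using measurableSet_le ((hf k').add_const lam) (hf k)

lemma sum_indicator_marginSet {X : Type*} {K : ℕ} {fstar : X → Fin K → ℝ} {lam : ℝ} (hlam : 0 < lam)
    {y : X} {k : Fin K} (hk : y ∈ marginSet fstar lam k) (g : Fin K → X → ℝ) :
    ∑ k', (marginSet fstar lam k').indicator (g k') y = g k y := by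
  rw [Finset.sum_eq_single k, indicator_of_mem hk]
  · intro k' _ hne
    refine indicator_of_notMem (fun hk' => ?_) _
    linarith [hk k' hne, hk' k hne.symm]
  · simp

section Good

variable {X Ω : Type*} [MeasurableSpace X] [mΩ : MeasurableSpace Ω] {K : ℕ}
  {D : Measure (X × (Fin K → ℝ))} {F F₀ : Set (X → Fin K → ℝ)} {fstar : X → Fin K → ℝ}
  {pistar : X → Fin K} {T M₀ : ℕ} {β : ℕ → ℝ} {P : Measure Ω} {x : ℕ → Ω → X}
  {r : ℕ → Ω → Fin K → ℝ} {a : ℕ → Ω → Fin K} {δ C : ℝ}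

/-- Rounds outside [σ, τ) get weight 0, so that the bound for T independent coordinates applies to
any stretch of rounds. -/
lemma IsOptimisticRun.measure_expectation_gt_le (hI : IsInstance D F fstar pistar)
    (hR : IsOptimisticRun D F T M₀ β P x r a) (hF₀ : IsDenseSubclass F₀ F)
    (c : BlockCover (D.map Prod.fst) F₀ T δ C) (hδ : δ ≤ 1) (hT : 1 ≤ T) {τ₀ : ℕ}
    (hτ₀ : τ₀ ≤ epochStart M₀) (k₀ : Fin K) {W : X × Fin K → Fin K → ℝ}
    (hW : ∀ k, Measurable fun y => W y k) (hW0 : ∀ y k, 0 ≤ W y k) (hW1 : ∀ y, ∑ k, W y k ≤ 1)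
    {σ τ : ℕ} (hσ : 1 ≤ σ) (hτ : τ ≤ T) :
    P {ω | ∃ f ∈ F, 3 / 2 * ∑ s ∈ Finset.Ico σ τ, ∑ k, W (x s ω, earlyAction a τ₀ k₀ s ω) k *
        (f (x s ω) k - fstar (x s ω) k) ^ 2 + 2 / 5 * C <
      ∑ s ∈ Finset.Ico σ τ, ∑ k, ∫ ω, W (x s ω, earlyAction a τ₀ k₀ s ω) k *
        (f (x s ω) k - fstar (x s ω) k) ^ 2 ∂P} ≤ ENNReal.ofReal (δ / (2 * T ^ 2)) := by
  have := hR.prob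
  have hmem : ∀ t : Fin T, (t : ℕ) + 1 ∈ Finset.Icc 1 T := fun t =>
    Finset.mem_Icc.2 ⟨by omega, t.2⟩
  have hm : ∀ t : Fin T, Measurable fun ω => (x (t + 1) ω, earlyAction a τ₀ k₀ (t + 1) ω) := fun t =>
    (hR.meas _ (hmem t)).1.prodMk (hR.measurable_earlyAction τ₀ k₀ (hmem t))
  set ν : Fin T → Measure (X × Fin K) := fun t =>
    P.map fun ω => (x (t + 1) ω, earlyAction a τ₀ k₀ (t + 1) ω) with hν
  have : ∀ t, IsProbabilityMeasure (ν t) := fun t =>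
    Measure.isProbabilityMeasure_map (hm t).aemeasurable
  have hνfst : ∀ t, (ν t).map Prod.fst = D.map Prod.fst := fun t => by
    rw [hν, Measure.map_map measurable_fst (hm t), ← hR.map_context (hmem t)]
    rfl
  set w : Fin T → X × Fin K → Fin K → ℝ := fun i y k =>
    if σ ≤ (i : ℕ) + 1 ∧ (i : ℕ) + 1 < τ then W y k else 0 with hw
  have key := c.measure_expectation_gt_le hI hF₀ hδ hT ν hνfst (w := w)
    (fun i k => by
      simp only [hw]; split_ifs
      exacts [hW k, measurable_const])
    (fun i y k => by
      simp only [hw]; split_ifs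
      exacts [hW0 y k, le_rfl])
    (fun i y => by
      simp only [hw]; split_ifs
      exacts [hW1 y, by simp])
  set Y : Ω → Fin T → X × Fin K := fun ω t => (x (t + 1) ω, earlyAction a τ₀ k₀ (t + 1) ω) with hY
  have hYm : Measurable Y := measurable_pi_lambda _ hm
  refine le_trans ?_ ((Measure.le_map_apply (μ := P) hYm.aemeasurable _).trans
    ((hR.map_earlyAction_eq_pi hτ₀ k₀).symm ▸ key))
  refine measure_mono ?_
  rintro ω ⟨f, hf, hlt⟩
  refine ⟨f, hf, ?_⟩
  have e1 : ∑ i, ∑ k, w i (Y ω i) k * (f (Y ω i).1 k - fstar (Y ω i).1 k) ^ 2 =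
      ∑ s ∈ Finset.Ico σ τ, ∑ k, W (x s ω, earlyAction a τ₀ k₀ s ω) k *
        (f (x s ω) k - fstar (x s ω) k) ^ 2 := by
    rw [← sum_fin_ite_eq hσ hτ]
    refine Finset.sum_congr rfl fun i _ => ?_
    simp only [hw, hY]
    split_ifs <;> simp
  have e2 : ∑ i, ∑ k, ∫ u, w i u k * (f u.1 k - fstar u.1 k) ^ 2 ∂ν i =
      ∑ s ∈ Finset.Ico σ τ, ∑ k, ∫ ω, W (x s ω, earlyAction a τ₀ k₀ s ω) k *
        (f (x s ω) k - fstar (x s ω) k) ^ 2 ∂P := by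
    rw [← sum_fin_ite_eq hσ hτ]
    refine Finset.sum_congr rfl fun i _ => ?_
    simp only [hw]
    split_ifs
    · refine Finset.sum_congr rfl fun k _ => ?_
      have hmf : Measurable fun u : X × Fin K => W u k * (f u.1 k - fstar u.1 k) ^ 2 :=
        (hW k).mul ((((hI.pred_meas f hf k).comp measurable_fst).sub
          ((hI.pred_meas _ hI.star_mem k).comp measurable_fst)).pow_const 2)
      rw [hν, integral_map (hm i).aemeasurable hmf.aestronglyMeasurable]
    · simp
  rw [e1, e2]
  exact hlt

/-- Independence of action and context separates the factor 1/K; summing over k then gives the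
average over actions in the definition of L₁. -/
lemma IsOptimisticRun.integral_explore (hI : IsInstance D F fstar pistar)
    (hR : IsOptimisticRun D F T M₀ β P x r a) {f : X → Fin K → ℝ} (hf : f ∈ F) {t : ℕ}
    (ht : t ∈ Finset.Icc 1 T) (htM : t < epochStart M₀) (k : Fin K) :
    ∫ ω, (if a t ω = k then 1 else 0) * (f (x t ω) k - fstar (x t ω) k) ^ 2 ∂P =
      1 / K * ∫ y, (f y k - fstar y k) ^ 2 ∂(D.map Prod.fst) := by
  have := hR.prob
  obtain ⟨hxt, hrt, hat⟩ := hR.meas t ht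
  obtain ⟨hunif, hind⟩ := hR.explore t ht htM
  have hm : Measurable fun y => (f y k - fstar y k) ^ 2 :=
    ((hI.pred_meas f hf k).sub (hI.pred_meas _ hI.star_mem k)).pow_const 2
  have hb : MeasurableSet {ω | a t ω = k} := hat (measurableSet_singleton k)
  have hxp := comap_measurable (m := inferInstance) (fun ω => (x t ω, r t ω))
  have hind' : Indep (MeasurableSpace.comap (fun ω => (x t ω, r t ω)) inferInstance)
      (MeasurableSpace.comap (a t) inferInstance) P :=
    (indep_of_indep_of_le_right hind le_sup_right).symm
  have hset : ∫ ω in {ω | a t ω = k}, (f (x t ω) k - fstar (x t ω) k) ^ 2 ∂P =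
      P.real {ω | a t ω = k} * ∫ ω, (f (x t ω) k - fstar (x t ω) k) ^ 2 ∂P :=
    setIntegral_of_indep (hxt.prodMk hrt).comap_le hat.comap_le hind'
      (hm.comp (measurable_fst.comp hxp)).stronglyMeasurable
      (Integrable.of_bound (hm.comp hxt).aestronglyMeasurable 1
        (Filter.Eventually.of_forall fun ω => by
          have := sq_sub_mem_Icc (hI.pred_mem f hf (x t ω) k) (hI.pred_mem _ hI.star_mem (x t ω) k)
          rw [Real.norm_eq_abs]
          exact abs_le.2 ⟨le_trans (by norm_num) this.1, this.2⟩))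
      ⟨{k}, measurableSet_singleton k, rfl⟩
  rw [← hR.map_context ht, integral_map hxt.aemeasurable hm.aestronglyMeasurable, ← hunif k,
    ← hset, ← integral_indicator hb]
  refine integral_congr_ae (Filter.Eventually.of_forall fun ω => ?_)
  by_cases h : a t ω = k <;> simp [h]

/-- All deviation bounds hold with probability at least `1 - δ / 2`. -/
lemma IsOptimisticRun.measure_not_isGoodPath_le (hI : IsInstance D F fstar pistar)
    (hR : IsOptimisticRun D F T M₀ (tolerance T C) P x r a) (hT : 2 ≤ T) (hδ : δ ∈ Ioo (0 : ℝ) 1)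
    (hC : IsRadius D F T δ C) (hM₀ : 2 ≤ M₀) {lam : ℝ} (hlam : 0 < lam) :
    P {ω | ¬ IsGoodPath D F fstar T C lam M₀ (fun t => x t ω) (fun t => r t ω) (fun t => a t ω)} ≤
      ENNReal.ofReal (δ / 2) := by
  classical
  have := hR.prob
  have := hI.prob
  have hT1 : 1 ≤ T := by omega
  obtain ⟨F₀, hF₀, ⟨c⟩⟩ := hC.exists_blockCover hI hT hδ
  obtain ⟨H, hH⟩ := hR.exists_rewardFiltration hI
  set k₀ : Fin K := ⟨0, hI.card_pos⟩ with hk₀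
  have hr01 := hR.reward_mem hI
  have hfm := hI.pred_meas _ hI.star_mem
  have hf01 := hI.pred_mem _ hI.star_mem
  set p : ENNReal := ENNReal.ofReal (δ / (2 * T ^ 2)) with hp
  set E1 : ℕ → Set Ω := fun m => {ω | ∃ f ∈ F, 4 / 3 * ∑ s ∈ Finset.Icc 1 (epochStart m - 1),
      ((f (x s ω) (a s ω) - r s ω (a s ω)) ^ 2 - (fstar (x s ω) (a s ω) - r s ω (a s ω)) ^ 2)
      + C / 3 < ∑ s ∈ Finset.Icc 1 (epochStart m - 1),
        (f (x s ω) (a s ω) - fstar (x s ω) (a s ω)) ^ 2} with hE1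
  -- These weights select the played action, for the warm start. The weights `W3` below select the
  -- action that is best by lam; they sum to at most 1 because the margin sets are disjoint for lam
  -- > 0.
  set W2 : X × Fin K → Fin K → ℝ := fun y k => if y.2 = k then 1 else 0 with hW2
  set E2 : Set Ω := {ω | ∃ f ∈ F, 3 / 2 * ∑ s ∈ Finset.Ico 1 (epochStart M₀), ∑ k,
      W2 (x s ω, earlyAction a (epochStart M₀) k₀ s ω) k * (f (x s ω) k - fstar (x s ω) k) ^ 2
      + 2 / 5 * C <
    ∑ s ∈ Finset.Ico 1 (epochStart M₀), ∑ k, ∫ ω,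
      W2 (x s ω, earlyAction a (epochStart M₀) k₀ s ω) k *
        (f (x s ω) k - fstar (x s ω) k) ^ 2 ∂P} with hE2
  set W3 : X × Fin K → Fin K → ℝ := fun y k =>
    (marginSet fstar lam k).indicator (fun _ => 1) y.1 with hW3
  set E3 : ℕ → Set Ω := fun m => {ω | ∃ f ∈ F,
      3 / 2 * ∑ s ∈ Finset.Ico (epochStart M₀) (epochStart m), ∑ k,
        W3 (x s ω, earlyAction a 0 k₀ s ω) k * (f (x s ω) k - fstar (x s ω) k) ^ 2 + 2 / 5 * C <
    ∑ s ∈ Finset.Ico (epochStart M₀) (epochStart m), ∑ k, ∫ ω,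
      W3 (x s ω, earlyAction a 0 k₀ s ω) k * (f (x s ω) k - fstar (x s ω) k) ^ 2 ∂P} with hE3
  have hP1 : ∀ m ∈ Finset.Icc 2 (numEpochs T), P (E1 m) ≤ p := fun m hm =>
    c.measure_excess_lt_le hI hF₀ hH (fun t ht => (hR.meas t ht).2.1) hr01
      (hR.map_contexts_eq_pi k₀) hT1
      (by have := epochStart_le hT1 (Finset.mem_Icc.1 hm).2; omega)
  have hP2 : M₀ ≤ numEpochs T → P E2 ≤ p := fun h =>
    hR.measure_expectation_gt_le hI hF₀ c hδ.2.le hT1 le_rfl k₀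
      (fun k => Measurable.ite (measurable_snd (measurableSet_singleton k)) measurable_const
        measurable_const)
      (fun y k => by split_ifs <;> norm_num) (fun y => by simp) le_rfl
      (epochStart_le hT1 h)
  have hP3 : ∀ m ∈ Finset.Icc M₀ (numEpochs T), P (E3 m) ≤ p := fun m hm =>
    hR.measure_expectation_gt_le hI hF₀ c hδ.2.le hT1 (Nat.zero_le _) k₀
      (fun k => (measurable_const.indicator (measurableSet_marginSet hfm lam k)).comp measurable_fst)
      (fun y k => indicator_nonneg (fun _ _ => zero_le_one) _)
      (fun y => by
        by_cases h : ∃ k, y.1 ∈ marginSet fstar lam k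
        · obtain ⟨k, hk⟩ := h
          exact (sum_indicator_marginSet hlam hk fun _ _ => 1).le
        · push Not at h
          simp [h])
      (epochStart_pos _) (epochStart_le hT1 (Finset.mem_Icc.1 hm).2)
  -- If the warm start exceeds the horizon, the bound on it is neither available nor needed.
  set E2' : Set Ω := if M₀ ≤ numEpochs T then E2 else ∅ with hE2'
  have hP2' : P E2' ≤ p := by
    rw [hE2']; split_ifs with h
    · exact hP2 h
    · simp
  have hsub : {ω | ¬ IsGoodPath D F fstar T C lam M₀ (fun t => x t ω) (fun t => r t ω)
      (fun t => a t ω)} ≤ᵐ[P] ((⋃ m ∈ Finset.Icc 2 (numEpochs T), E1 m) ∪ E2' ∪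
        ⋃ m ∈ Finset.Icc M₀ (numEpochs T), E3 m : Set Ω) := by
    filter_upwards [hr01, hR.optimistic] with ω hr hopt
    intro hbad
    by_contra hcon
    refine hbad ?_
    have hcon' : ¬ (ω ∈ ((⋃ m ∈ Finset.Icc 2 (numEpochs T), E1 m) ∪ E2' ∪
        ⋃ m ∈ Finset.Icc M₀ (numEpochs T), E3 m : Set Ω)) := hcon
    rw [mem_union, mem_union, not_or, not_or, mem_iUnion₂, mem_iUnion₂] at hcon'
    push Not at hcon'
    obtain ⟨⟨h1, h2⟩, h3⟩ := hcon'
    refine ⟨hr, hopt, fun m hm f hf => ?_, fun hM f hf => ?_, fun m hm f hf => ?_⟩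
    · have h := h1 m hm
      simp only [hE1, mem_ofPred_eq, not_exists, not_and, not_lt] at h
      have hI : Finset.Ico 1 (epochStart m) = Finset.Icc 1 (epochStart m - 1) := by
        have := epochStart_pos m
        ext s; simp only [Finset.mem_Ico, Finset.mem_Icc]; omega
      rw [hI]
      exact h f hf
    · rw [hE2', if_pos hM] at h2
      simp only [hE2, mem_ofPred_eq, not_exists, not_and, not_lt] at h2
      have h := h2 f hf
      have e1 : ∀ s ∈ Finset.Ico 1 (epochStart M₀), earlyAction a (epochStart M₀) k₀ s = a s := by
        intro s hs
        funext ω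
        simp [earlyAction, (Finset.mem_Ico.1 hs).2]
      have hsT : ∀ s ∈ Finset.Ico 1 (epochStart M₀), s ∈ Finset.Icc 1 T := by
        intro s hs
        have := epochStart_le hT1 hM
        rw [Finset.mem_Ico] at hs
        exact Finset.mem_Icc.2 ⟨hs.1, by omega⟩
      have e2 : ∑ s ∈ Finset.Ico 1 (epochStart M₀), ∑ k,
          W2 (x s ω, earlyAction a (epochStart M₀) k₀ s ω) k * (f (x s ω) k - fstar (x s ω) k) ^ 2 =
          ∑ s ∈ Finset.Ico 1 (epochStart M₀), (f (x s ω) (a s ω) - fstar (x s ω) (a s ω)) ^ 2 := by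
        refine Finset.sum_congr rfl fun s hs => ?_
        rw [e1 s hs]
        simp [hW2]
      have hm : ∀ k, Integrable (fun y => (f y k - fstar y k) ^ 2) (D.map Prod.fst) := by
        intro k
        have : IsProbabilityMeasure (D.map Prod.fst) :=
          Measure.isProbabilityMeasure_map measurable_fst.aemeasurable
        refine Integrable.of_bound
          (((hI.pred_meas f hf k).sub (hfm k)).pow_const 2).aestronglyMeasurable 1
          (Filter.Eventually.of_forall fun y => ?_)
        have := sq_sub_mem_Icc (hI.pred_mem f hf y k) (hf01 y k)
        rw [Real.norm_eq_abs]
        exact abs_le.2 ⟨by linarith [this.1], this.2⟩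
      have e3 : ∑ s ∈ Finset.Ico 1 (epochStart M₀), ∑ k, ∫ ω,
          W2 (x s ω, earlyAction a (epochStart M₀) k₀ s ω) k *
            (f (x s ω) k - fstar (x s ω) k) ^ 2 ∂P =
          ((epochStart M₀ : ℝ) - 1) * ∫ x', (1 / (K : ℝ)) * ∑ k, (f x' k - fstar x' k) ^ 2
            ∂(D.map Prod.fst) := by
        rw [integral_const_mul, integral_finsetSum _ fun k _ => hm k, Finset.mul_sum]
        calc _ = ∑ s ∈ Finset.Ico 1 (epochStart M₀), ∑ k : Fin K,
              1 / (K : ℝ) * ∫ y, (f y k - fstar y k) ^ 2 ∂(D.map Prod.fst) := by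
              refine Finset.sum_congr rfl fun s hs => Finset.sum_congr rfl fun k _ => ?_
              rw [e1 s hs]
              exact hR.integral_explore hI hf (hsT s hs) (Finset.mem_Ico.1 hs).2 k
          _ = _ := by
              rw [Finset.sum_const, Nat.card_Ico, nsmul_eq_mul, Nat.cast_sub (epochStart_pos _)]
              simp
      rw [e2, e3] at h
      exact h
    · have h := h3 m hm
      simp only [hE3, mem_ofPred_eq, not_exists, not_and, not_lt] at h
      replace h := h f hf
      have hW : ∀ (y : X) (b : Fin K) (k : Fin K), W3 (y, b) k * (f y k - fstar y k) ^ 2 =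
          (marginSet fstar lam k).indicator (fun y => (f y k - fstar y k) ^ 2) y := by
        intro y b k
        by_cases hy : y ∈ marginSet fstar lam k <;> simp [hW3, hy]
      simp only [hW] at h
      have hmk : ∀ k, Measurable ((marginSet fstar lam k).indicator
          (fun y => (f y k - fstar y k) ^ 2)) := fun k =>
        (((hI.pred_meas f hf k).sub (hfm k)).pow_const 2).indicator
          (measurableSet_marginSet hfm lam k)
      have hm' : ∀ k, Integrable ((marginSet fstar lam k).indicator
          (fun y => (f y k - fstar y k) ^ 2)) (D.map Prod.fst) := by
        intro k
        have : IsProbabilityMeasure (D.map Prod.fst) :=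
          Measure.isProbabilityMeasure_map measurable_fst.aemeasurable
        refine Integrable.of_bound (hmk k).aestronglyMeasurable 1
          (Filter.Eventually.of_forall fun y => ?_)
        have := sq_sub_mem_Icc (hI.pred_mem f hf y k) (hf01 y k)
        refine (norm_indicator_le_norm_self _ _).trans ?_
        rw [Real.norm_eq_abs]
        exact abs_le.2 ⟨by linarith [this.1], this.2⟩
      have e3 : ∑ s ∈ Finset.Ico (epochStart M₀) (epochStart m), ∑ k, ∫ ω,
          (marginSet fstar lam k).indicator (fun y => (f y k - fstar y k) ^ 2) (x s ω) ∂P =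
          ((epochStart m : ℝ) - epochStart M₀) * ∫ x', ∑ k, (marginSet fstar lam k).indicator
            (fun y => (f y k - fstar y k) ^ 2) x' ∂(D.map Prod.fst) := by
        rw [integral_finsetSum _ fun k _ => hm' k]
        calc _ = ∑ s ∈ Finset.Ico (epochStart M₀) (epochStart m), ∑ k : Fin K,
              ∫ y, (marginSet fstar lam k).indicator
                (fun y => (f y k - fstar y k) ^ 2) y ∂(D.map Prod.fst) := by
              refine Finset.sum_congr rfl fun s hs => Finset.sum_congr rfl fun k _ => ?_
              have hs' : s ∈ Finset.Icc 1 T := by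
                have h1 := epochStart_le hT1 (Finset.mem_Icc.1 hm).2
                have h2 := epochStart_pos M₀
                rw [Finset.mem_Ico] at hs
                exact Finset.mem_Icc.2 ⟨by omega, by omega⟩
              rw [← hR.map_context hs', integral_map (hR.meas s hs').1.aemeasurable
                (hmk k).aestronglyMeasurable]
          _ = _ := by
              rw [Finset.sum_const, Nat.card_Ico, nsmul_eq_mul,
                Nat.cast_sub (epochStart_mono (Finset.mem_Icc.1 hm).1)]
      rw [e3] at h
      exact h
  -- At most 2(M - 1) + 1 ≤ 2T events of probability δ/(2T²) each: in total δ/T, which is at most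
  -- δ/2 as T ≥ 2.
  have hcount : ((numEpochs T - 1 : ℕ) : ENNReal) * p + p + ((numEpochs T - 1 : ℕ) : ENNReal) * p ≤
      ENNReal.ofReal (δ / 2) := by
    have hM := numEpochs_le hT1
    have hM1 : 1 ≤ numEpochs T := by unfold numEpochs; omega
    have hT' : (2 : ℝ) ≤ T := by exact_mod_cast hT
    have hδ0 := hδ.1
    rw [hp, ← ENNReal.ofReal_natCast, ← ENNReal.ofReal_mul (Nat.cast_nonneg _),
      ← ENNReal.ofReal_add (by positivity) (by positivity),
      ← ENNReal.ofReal_add (by positivity) (by positivity)]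
    refine ENNReal.ofReal_le_ofReal ?_
    have h1 : ((numEpochs T - 1 : ℕ) : ℝ) ≤ T - 1 := by
      rw [Nat.cast_sub hM1, Nat.cast_one]
      have : (numEpochs T : ℝ) ≤ T := by exact_mod_cast hM
      linarith
    have h2 : 0 ≤ δ / (2 * (T : ℝ) ^ 2) := by positivity
    calc _ = (2 * ((numEpochs T - 1 : ℕ) : ℝ) + 1) * (δ / (2 * (T : ℝ) ^ 2)) := by ring
      _ ≤ (2 * (T : ℝ)) * (δ / (2 * (T : ℝ) ^ 2)) := mul_le_mul_of_nonneg_right (by linarith) h2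
      _ = δ / T := by field_simp
      _ ≤ δ / 2 := by gcongr
  refine (measure_mono_ae hsub).trans (le_trans ?_ hcount)
  refine (measure_union_le _ _).trans (add_le_add ((measure_union_le _ _).trans
    (add_le_add ?_ hP2')) ?_)
  · refine (measure_biUnion_finset_le _ _).trans ((Finset.sum_le_sum hP1).trans ?_)
    rw [Finset.sum_const, Nat.card_Icc, nsmul_eq_mul]
    exact mul_le_mul_left (Nat.cast_le.2 (by omega)) _
  · refine (measure_biUnion_finset_le _ _).trans ((Finset.sum_le_sum hP3).trans ?_)
    rw [Finset.sum_const, Nat.card_Icc, nsmul_eq_mul]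
    exact mul_le_mul_left (Nat.cast_le.2 (by omega)) _

end Good

/-! ### Constants -/

/-- If L < 1, the supremum s of the squared distances satisfies s ≤ L s, so it vanishes and f =
`fstar` for all f. Then L/2 is admissible too, contrary to minimality. The bound L ≥ 1 lets the
leading terms absorb additive constants. -/
lemma one_le_of_isLeast {X : Type*} {K : ℕ} {F : Set (X → Fin K → ℝ)} {fstar : X → Fin K → ℝ}
    (hd : ∀ f ∈ F, ∀ x k, (f x k - fstar x k) ^ 2 ≤ 1) {Q : (X → Fin K → ℝ) → ℝ}
    (hQ : ∀ f ∈ F, ∀ B, 0 ≤ B → (∀ x k, (f x k - fstar x k) ^ 2 ≤ B) → Q f ≤ B) {L : ℝ}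
    (hL : IsLeast {L : ℝ | 0 < L ∧ ∀ f ∈ F, ∀ x k, (f x k - fstar x k) ^ 2 ≤ L * Q f} L) :
    1 ≤ L := by
  obtain ⟨⟨hL0, hLb⟩, hmin⟩ := hL
  by_contra! hlt
  have hzero : ∀ f ∈ F, ∀ x k, (f x k - fstar x k) ^ 2 ≤ 0 := by
    intro f hf x k
    set S : Set ℝ := range fun p : X × Fin K => (f p.1 p.2 - fstar p.1 p.2) ^ 2 with hS
    have hbdd : BddAbove S := ⟨1, by rintro _ ⟨p, rfl⟩; exact hd f hf _ _⟩
    have hle : ∀ x k, (f x k - fstar x k) ^ 2 ≤ sSup S := fun x k => le_csSup hbdd ⟨(x, k), rfl⟩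
    have h0 : 0 ≤ sSup S := (sq_nonneg _).trans (hle x k)
    have h1 : sSup S ≤ L * sSup S := by
      refine csSup_le ⟨_, ⟨(x, k), rfl⟩⟩ ?_
      rintro _ ⟨p, rfl⟩
      exact (hLb f hf p.1 p.2).trans (mul_le_mul_of_nonneg_left (hQ f hf _ h0 hle) hL0.le)
    exact (hle x k).trans (by nlinarith)
  have hmem : L / 2 ∈ {L : ℝ | 0 < L ∧ ∀ f ∈ F, ∀ x k, (f x k - fstar x k) ^ 2 ≤ L * Q f} := by
    refine ⟨by linarith, fun f hf x k => ?_⟩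
    have h1 := hzero f hf x k
    have h2 := hLb f hf x k
    have h3 : 0 ≤ L * Q f := (sq_nonneg _).trans h2
    linarith
  linarith [hmin hmem]

section Constants

variable {X : Type*} [MeasurableSpace X] {K : ℕ} {D : Measure (X × (Fin K → ℝ))}
  {F : Set (X → Fin K → ℝ)} {fstar : X → Fin K → ℝ} {pistar : X → Fin K} {lam L₁ L₂ : ℝ}

lemma integral_average_le (hI : IsInstance D F fstar pistar) {u : X → Fin K → ℝ} {B : ℝ}
    (hu0 : ∀ y k, 0 ≤ u y k) (hu : ∀ y k, u y k ≤ B) :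
    ∫ y, (1 / (K : ℝ)) * ∑ k, u y k ∂(D.map Prod.fst) ≤ B := by
  have := hI.prob
  have : IsProbabilityMeasure (D.map Prod.fst) :=
    Measure.isProbabilityMeasure_map measurable_fst.aemeasurable
  have hK : (0 : ℝ) < K := by exact_mod_cast hI.card_pos
  calc _ ≤ ∫ _y, B ∂(D.map Prod.fst) := by
        refine integral_mono_of_nonneg (Filter.Eventually.of_forall fun y =>
          mul_nonneg (by positivity) (Finset.sum_nonneg fun k _ => hu0 y k)) (integrable_const _)
          (Filter.Eventually.of_forall fun y => ?_)
        have h : ∑ k, u y k ≤ K * B := by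
          refine (Finset.sum_le_sum fun k _ => hu y k).trans ?_
          simp
        simp only
        rw [one_div, inv_mul_le_iff₀ hK]
        exact h
    _ = B := by simp

lemma IsSurpriseBound.one_le (hI : IsInstance D F fstar pistar)
    (h : IsSurpriseBound D F fstar L₁) : 1 ≤ L₁ :=
  one_le_of_isLeast (fun f hf x k =>
    (sq_sub_mem_Icc (hI.pred_mem f hf x k) (hI.pred_mem _ hI.star_mem x k)).2)
    (fun _ _ _ _ hB => integral_average_le hI (fun _ _ => sq_nonneg _) hB) h

lemma IsIEC.one_le (hI : IsInstance D F fstar pistar) (h : IsIEC D F fstar lam L₂) : 1 ≤ L₂ :=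
  one_le_of_isLeast (fun f hf x k =>
    (sq_sub_mem_Icc (hI.pred_mem f hf x k) (hI.pred_mem _ hI.star_mem x k)).2)
    (fun _ _ _ hB0 hB => integral_average_le hI
      (fun _ _ => indicator_nonneg (fun _ _ => sq_nonneg _) _)
      (fun y k => indicator_le' (fun y _ => hB y k) (fun _ _ => hB0) y)) h

end Constants

/-- With A = 1 + (2M + 3) L₁ C / lam², the first round after the warm start is 2 · 2^⌊log₂ A⌋, which
lies in (A, 2A]. -/
lemma warmStart_bounds {T : ℕ} {L₁ C lam : ℝ} (hL₁ : 0 ≤ L₁) (hC : 0 ≤ C) :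
    1 + (2 * (numEpochs T : ℝ) + 3) * L₁ * C / lam ^ 2 < epochStart (warmStart T L₁ C lam) ∧
    (epochStart (warmStart T L₁ C lam) : ℝ) ≤
      2 * (1 + (2 * (numEpochs T : ℝ) + 3) * L₁ * C / lam ^ 2) := by
  set A := 1 + (2 * (numEpochs T : ℝ) + 3) * L₁ * C / lam ^ 2 with hA
  have hA1 : 1 ≤ A := by
    have : 0 ≤ (2 * (numEpochs T : ℝ) + 3) * L₁ * C / lam ^ 2 := by positivity
    linarith
  have hA0 : 0 < A := by linarith
  have e : (epochStart (warmStart T L₁ C lam) : ℝ) = 2 * (2 : ℝ) ^ (⌊Real.logb 2 A⌋₊ : ℝ) := by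
    rw [epochStart, warmStart, ← hA, show 2 + ⌊Real.logb 2 A⌋₊ - 1 = ⌊Real.logb 2 A⌋₊ + 1 by omega,
      Real.rpow_natCast]
    push_cast
    ring
  have h0 : 0 ≤ Real.logb 2 A := Real.logb_nonneg (by norm_num) hA1
  have h1 : (2 : ℝ) ^ (⌊Real.logb 2 A⌋₊ : ℝ) ≤ A := by
    rw [← Real.le_logb_iff_rpow_le (by norm_num) hA0]
    exact Nat.floor_le h0
  have h2 : A < (2 : ℝ) ^ ((⌊Real.logb 2 A⌋₊ : ℝ) + 1) := by
    rw [← Real.logb_lt_iff_lt_rpow (by norm_num) hA0]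
    exact Nat.lt_floor_add_one _
  rw [Real.rpow_add_one (by norm_num)] at h2
  constructor <;> rw [e] <;> linarith

/-! ### The behaviour of the algorithm on good paths -/

lemma empRisk_sub {X : Type*} {K : ℕ} (x : ℕ → X) (a : ℕ → Fin K) (y : ℕ → ℝ) (m : ℕ) (f g : X → Fin K → ℝ) :
    empRisk x a y m f - empRisk x a y m g = (1 / ((epochStart m : ℝ) - 1)) *
      ∑ s ∈ Finset.Ico 1 (epochStart m), ((f (x s) (a s) - y s) ^ 2 - (g (x s) (a s) - y s) ^ 2) := by
  rw [empRisk, empRisk, Finset.sum_sub_distrib]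
  ring

lemma bddBelow_empRisk {X : Type*} {K : ℕ} (F : Set (X → Fin K → ℝ)) (x : ℕ → X)
    (a : ℕ → Fin K) (y : ℕ → ℝ) (m : ℕ) :
    BddBelow (empRisk x a y m '' F) := by
  refine ⟨0, ?_⟩
  rintro _ ⟨f, -, rfl⟩
  have : (1 : ℝ) ≤ epochStart m := by exact_mod_cast epochStart_pos m
  exact mul_nonneg (one_div_nonneg.2 (by linarith)) (Finset.sum_nonneg fun s _ => sq_nonneg _)

/-- Optimism: the value of k is at most its upper bound, hence at most that of b, which
overestimates b by at most w. -/
lemma star_le_add_of_high_le {X : Type*} {K : ℕ} {fstar : X → Fin K → ℝ}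
    {V : Set (X → Fin K → ℝ)} (hV : ∀ f ∈ V, ∀ y k, f y k ≤ 1)
    (hs : fstar ∈ V) {w : ℝ} (hw : ∀ f ∈ V, ∀ y k, |f y k - fstar y k| ≤ w) {y : X} {b : Fin K}
    (hb : ∀ k, high V y k ≤ high V y b) (k : Fin K) : fstar y k ≤ fstar y b + w := by
  have hbdd : BddAbove ((fun f => f y k) '' V) := ⟨1, by rintro _ ⟨f, hf, rfl⟩; exact hV f hf y k⟩
  have h1 : fstar y k ≤ high V y k := le_csSup hbdd ⟨fstar, hs, rfl⟩
  have h2 : high V y b ≤ fstar y b + w := by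
    refine csSup_le ⟨_, ⟨fstar, hs, rfl⟩⟩ ?_
    rintro _ ⟨f, hf, rfl⟩
    linarith [(abs_le.1 (hw f hf y b)).2]
  linarith [hb k]

section Path

variable {X : Type*} [MeasurableSpace X] {K : ℕ} {D : Measure (X × (Fin K → ℝ))}
  {F : Set (X → Fin K → ℝ)} {fstar : X → Fin K → ℝ} {pistar : X → Fin K} {T M₀ : ℕ}
  {C lam L₁ L₂ : ℝ} {x : ℕ → X} {r : ℕ → Fin K → ℝ} {a : ℕ → Fin K}

lemma two_le_epochStart {m : ℕ} (hm : 2 ≤ m) : 2 ≤ epochStart m := by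
  calc 2 = 2 ^ 1 := by norm_num
    _ ≤ _ := Nat.pow_le_pow_right (by norm_num) (by omega)

lemma epochStart_succ {m : ℕ} (hm : 1 ≤ m) : epochStart (m + 1) = 2 * epochStart m := by
  rw [epochStart, epochStart, show m + 1 - 1 = (m - 1) + 1 by omega, pow_succ]
  ring

/-- Squared distances are nonnegative, so total excess losses are at least -C/4, whereas the
tolerance allows (M - m + 1) C ≥ C. -/
lemma IsGoodPath.star_mem (hI : IsInstance D F fstar pistar)
    (hG : IsGoodPath D F fstar T C lam M₀ x r a) (hC : 0 ≤ C) {m : ℕ}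
    (hm : m ∈ Finset.Icc 2 (numEpochs T)) :
    fstar ∈ versionSpace F x a (fun s => r s (a s)) m (tolerance T C m) := by
  refine ⟨hI.star_mem, fun _ => ?_⟩
  obtain ⟨hm2, hmM⟩ := Finset.mem_Icc.1 hm
  have hτ : (0 : ℝ) < (epochStart m : ℝ) - 1 := by
    have : (2 : ℝ) ≤ epochStart m := by exact_mod_cast two_le_epochStart hm2
    linarith
  rw [sub_le_comm]
  refine le_csInf ⟨_, ⟨fstar, hI.star_mem, rfl⟩⟩ ?_
  rintro _ ⟨f, hf, rfl⟩
  have h1 := hG.excess m hm f hf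
  have h2 := empRisk_sub x a (fun s => r s (a s)) m f fstar
  have h3 : 0 ≤ ∑ s ∈ Finset.Ico 1 (epochStart m), (f (x s) (a s) - fstar (x s) (a s)) ^ 2 :=
    Finset.sum_nonneg fun s _ => sq_nonneg _
  have h4 : -(tolerance T C m) ≤ (1 / ((epochStart m : ℝ) - 1)) *
      ∑ s ∈ Finset.Ico 1 (epochStart m),
        ((f (x s) (a s) - r s (a s)) ^ 2 - (fstar (x s) (a s) - r s (a s)) ^ 2) := by
    rw [tolerance, ← neg_div, one_div, ← div_eq_inv_mul]
    gcongr
    have : (m : ℝ) ≤ numEpochs T := by exact_mod_cast hmM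
    nlinarith
  linarith

/-- As `fstar` competes in the infimum, a member of the version space has total excess loss at most
(M - m + 1) C. -/
lemma IsGoodPath.sum_sq_le (hI : IsInstance D F fstar pistar)
    (hG : IsGoodPath D F fstar T C lam M₀ x r a) {m : ℕ}
    (hm : m ∈ Finset.Icc 2 (numEpochs T)) {f : X → Fin K → ℝ}
    (hf : f ∈ versionSpace F x a (fun s => r s (a s)) m (tolerance T C m)) :
    ∑ s ∈ Finset.Ico 1 (epochStart m), (f (x s) (a s) - fstar (x s) (a s)) ^ 2 ≤
      4 / 3 * ((numEpochs T : ℝ) - m + 1) * C + C / 3 := by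
  obtain ⟨hm2, hmM⟩ := Finset.mem_Icc.1 hm
  have hτ : (0 : ℝ) < (epochStart m : ℝ) - 1 := by
    have : (2 : ℝ) ≤ epochStart m := by exact_mod_cast two_le_epochStart hm2
    linarith
  have h1 := hG.excess m hm f hf.1
  have h2 := empRisk_sub x a (fun s => r s (a s)) m f fstar
  have h3 : sInf (empRisk x a (fun s => r s (a s)) m '' F) ≤
      empRisk x a (fun s => r s (a s)) m fstar :=
    csInf_le (bddBelow_empRisk F x a _ m) ⟨fstar, hI.star_mem, rfl⟩
  have h4 := hf.2 hm2
  have h5 : (1 / ((epochStart m : ℝ) - 1)) * ∑ s ∈ Finset.Ico 1 (epochStart m),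
      ((f (x s) (a s) - r s (a s)) ^ 2 - (fstar (x s) (a s) - r s (a s)) ^ 2) ≤
      tolerance T C m := by linarith
  rw [tolerance, one_div, ← div_eq_inv_mul, div_le_div_iff_of_pos_right hτ] at h5
  linarith

/-- After the warm start, the width of the version spaces is less than `lam`. -/
lemma IsGoodPath.exists_width (hI : IsInstance D F fstar pistar)
    (hG : IsGoodPath D F fstar T C lam (warmStart T L₁ C lam) x r a) (hC : 0 < C) (hlam : 0 < lam)
    (hL₁ : IsSurpriseBound D F fstar L₁) :
    ∃ w < lam, ∀ m ∈ Finset.Icc (warmStart T L₁ C lam) (numEpochs T),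
      ∀ f ∈ versionSpace F x a (fun s => r s (a s)) m (tolerance T C m), ∀ y k,
        |f y k - fstar y k| ≤ w := by
  set M₀ := warmStart T L₁ C lam with hM₀
  have hL := hL₁.one_le hI
  set M : ℝ := (numEpochs T : ℝ) with hM
  have hM0 : 0 ≤ M := by positivity
  obtain ⟨hτ, -⟩ := warmStart_bounds (T := T) (lam := lam) (by linarith : 0 ≤ L₁) hC.le
  rw [← hM₀, ← hM] at hτ
  have hQ0 : 0 ≤ (2 * M + 3) * L₁ * C / lam ^ 2 := by positivity
  have hτ0 : 0 < (epochStart M₀ : ℝ) - 1 := by linarith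
  -- For m ≥ 2, 3/2 · (4/3 · (M - m + 1) C + C/3) + 2/5 · C ≤ 2MC. One w < lam for all f is needed:
  -- pointwise strict inequalities would not survive the supremum in `high`.
  refine ⟨√(L₁ * (2 * M * C) / ((epochStart M₀ : ℝ) - 1)), ?_, fun m hm f hf y k => ?_⟩
  · rw [Real.sqrt_lt' hlam, div_lt_iff₀ hτ0]
    have h1 : (2 * M + 3) * L₁ * C < lam ^ 2 * ((epochStart M₀ : ℝ) - 1) := by
      have : (2 * M + 3) * L₁ * C / lam ^ 2 < (epochStart M₀ : ℝ) - 1 := by linarith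
      rw [div_lt_iff₀ (by positivity)] at this
      linarith
    have h2 : 0 ≤ L₁ * C := by positivity
    nlinarith
  · obtain ⟨hm1, hmM⟩ := Finset.mem_Icc.1 hm
    have hM₀2 : 2 ≤ M₀ := two_le_warmStart T L₁ C lam
    have h1 := hG.sum_sq_le hI (Finset.mem_Icc.2 ⟨hM₀2.trans hm1, hmM⟩) hf
    have h2 := hG.warm (hm1.trans hmM) f hf.1
    have h3 : ∑ s ∈ Finset.Ico 1 (epochStart M₀), (f (x s) (a s) - fstar (x s) (a s)) ^ 2 ≤
        ∑ s ∈ Finset.Ico 1 (epochStart m), (f (x s) (a s) - fstar (x s) (a s)) ^ 2 :=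
      Finset.sum_le_sum_of_subset_of_nonneg (Finset.Ico_subset_Ico_right (epochStart_mono hm1))
        fun _ _ _ => sq_nonneg _
    have h4 : (2 : ℝ) ≤ m := by exact_mod_cast hM₀2.trans hm1
    have h5 := hL₁.1.2 f hf.1 y k
    set Q := ∫ x', (1 / (K : ℝ)) * ∑ k', (f x' k' - fstar x' k') ^ 2 ∂(D.map Prod.fst) with hQ
    have h6 : ((epochStart M₀ : ℝ) - 1) * Q ≤ 2 * M * C := by
      rw [← hM] at h1
      nlinarith
    rw [← Real.sqrt_sq_eq_abs]
    refine Real.sqrt_le_sqrt ?_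
    rw [le_div_iff₀ hτ0]
    nlinarith

lemma exists_epoch {t m₀ : ℕ} (hm₀ : 1 ≤ m₀) (ht : t ≤ T) (hτ : epochStart m₀ ≤ t) :
    ∃ m ∈ Finset.Icc m₀ (numEpochs T), epochStart m ≤ t ∧ t < epochStart (m + 1) := by
  have ht0 : t ≠ 0 := by have := epochStart_pos m₀; omega
  have h1 : m₀ - 1 ≤ Nat.log 2 t := Nat.le_log_of_pow_le (by norm_num) hτ
  refine ⟨Nat.log 2 t + 1, Finset.mem_Icc.2 ⟨by omega, ?_⟩, ?_, ?_⟩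
  · exact Nat.succ_le_succ (Nat.log_mono_right ht)
  · exact Nat.pow_log_le_self 2 ht0
  · exact Nat.lt_pow_succ_log_self (by norm_num) t

lemma IsGoodPath.star_le_add (hI : IsInstance D F fstar pistar)
    (hG : IsGoodPath D F fstar T C lam M₀ x r a) (hM₀ : 2 ≤ M₀) (hC : 0 ≤ C) {m t : ℕ}
    (hm : m ∈ Finset.Icc M₀ (numEpochs T)) (ht : t ≤ T) (h1 : epochStart m ≤ t)
    (h2 : t < epochStart (m + 1)) {w : ℝ}
    (hw : ∀ f ∈ versionSpace F x a (fun s => r s (a s)) m (tolerance T C m), ∀ y k,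
      |f y k - fstar y k| ≤ w) (k : Fin K) : fstar (x t) k ≤ fstar (x t) (a t) + w := by
  obtain ⟨hm1, hmM⟩ := Finset.mem_Icc.1 hm
  refine star_le_add_of_high_le (fun f hf y k => (hI.pred_mem f hf.1 y k).2)
    (hG.star_mem hI hC (Finset.mem_Icc.2 ⟨hM₀.trans hm1, hmM⟩)) hw ?_ k
  exact hG.optimistic m hm1 t (Finset.mem_Icc.2 ⟨(epochStart_pos m).trans h1, ht⟩) h1 h2

/-- After the warm start, the algorithm plays optimal actions wherever they are best by `lam`. -/
lemma IsGoodPath.action_eq (hI : IsInstance D F fstar pistar)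
    (hG : IsGoodPath D F fstar T C lam (warmStart T L₁ C lam) x r a) (hC : 0 < C) (hlam : 0 < lam)
    (hL₁ : IsSurpriseBound D F fstar L₁) {t : ℕ} (ht : t ≤ T)
    (hτ : epochStart (warmStart T L₁ C lam) ≤ t) {k : Fin K} (hk : x t ∈ marginSet fstar lam k) :
    a t = k := by
  have hM₀2 := two_le_warmStart T L₁ C lam
  obtain ⟨w, hw, hwidth⟩ := hG.exists_width hI hC hlam hL₁
  obtain ⟨m, hm, h1, h2⟩ := exists_epoch (by omega) ht hτ
  by_contra hne
  have h3 := hG.star_le_add hI hM₀2 hC.le hm ht h1 h2 (hwidth m hm) k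
  linarith [hk (a t) hne]

/-- Implicit exploration: in a round after the warm start whose context lies in U_lam(k), the action
k is played. So the data contain every term of the empirical version of the expectation that defines
L₂. -/
lemma IsGoodPath.width_le (hI : IsInstance D F fstar pistar)
    (hG : IsGoodPath D F fstar T C lam (warmStart T L₁ C lam) x r a) (hC : 0 < C) (hlam : 0 < lam)
    (hL₁ : IsSurpriseBound D F fstar L₁) (hL₂ : IsIEC D F fstar lam L₂) (hT : 1 ≤ T) {m : ℕ}
    (hm : m ∈ Finset.Icc (warmStart T L₁ C lam + 1) (numEpochs T)) {f : X → Fin K → ℝ}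
    (hf : f ∈ versionSpace F x a (fun s => r s (a s)) m (tolerance T C m)) (y : X) (k : Fin K) :
    (f y k - fstar y k) ^ 2 ≤ 4 * L₂ * numEpochs T * C / epochStart m := by
  set M₀ := warmStart T L₁ C lam with hM₀
  obtain ⟨hm1, hmM⟩ := Finset.mem_Icc.1 hm
  have hM₀2 : 2 ≤ M₀ := two_le_warmStart T L₁ C lam
  have hL := hL₂.one_le hI
  set M : ℝ := (numEpochs T : ℝ) with hM
  have hM0 : 0 ≤ M := by positivity
  have h1 := hG.sum_sq_le hI (Finset.mem_Icc.2 ⟨by omega, hmM⟩) hf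
  have h2 := hG.margin m (Finset.mem_Icc.2 ⟨by omega, hmM⟩) f hf.1
  have h3 : ∑ s ∈ Finset.Ico (epochStart M₀) (epochStart m), ∑ k,
      (marginSet fstar lam k).indicator (fun y => (f y k - fstar y k) ^ 2) (x s) ≤
      ∑ s ∈ Finset.Ico 1 (epochStart m), (f (x s) (a s) - fstar (x s) (a s)) ^ 2 := by
    refine (Finset.sum_le_sum fun s hs => ?_).trans (Finset.sum_le_sum_of_subset_of_nonneg
      (Finset.Ico_subset_Ico_left (epochStart_pos M₀)) fun _ _ _ => sq_nonneg _)
    by_cases h : ∃ k, x s ∈ marginSet fstar lam k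
    · obtain ⟨k, hk⟩ := h
      have hs' := Finset.mem_Ico.1 hs
      have hsT : s ≤ T := by have := epochStart_le hT hmM; omega
      rw [hG.action_eq hI hC hlam hL₁ hsT hs'.1 hk]
      exact (sum_indicator_marginSet hlam hk fun k y => (f y k - fstar y k) ^ 2).le
    · push Not at h
      rw [Finset.sum_eq_zero fun k _ => indicator_of_notMem (h k) _]
      exact sq_nonneg _
  have h4 : (3 : ℝ) ≤ m := by exact_mod_cast (show 3 ≤ m by omega)
  have h5 := hL₂.1.2 f hf.1 y k
  have hK : (1 : ℝ) ≤ K := by exact_mod_cast hI.card_pos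
  rw [integral_const_mul] at h5
  set Q := ∫ x', ∑ k', (marginSet fstar lam k').indicator
      (fun y => (f y k' - fstar y k') ^ 2) x' ∂(D.map Prod.fst) with hQ
  have hQ0 : 0 ≤ Q := integral_nonneg fun y => Finset.sum_nonneg fun k _ =>
    indicator_nonneg (fun _ _ => sq_nonneg _) _
  have h6 : ((epochStart m : ℝ) - epochStart M₀) * Q ≤ 2 * M * C := by
    rw [← hM] at h1
    nlinarith
  have h7 : (epochStart M₀ : ℝ) * 2 ≤ epochStart m := by
    have : 2 * epochStart M₀ ≤ epochStart m := by
      rw [← epochStart_succ (by omega)]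
      exact epochStart_mono hm1
    have : (2 * epochStart M₀ : ℝ) ≤ epochStart m := by exact_mod_cast this
    linarith
  -- The gain of a factor 1/K from the uniform average is given away here.
  have h8 : 1 / (K : ℝ) * Q ≤ Q := mul_le_of_le_one_left hQ0 (by
    rw [div_le_one (by linarith)]; exact hK)
  have hτ : (0 : ℝ) < epochStart m := by exact_mod_cast epochStart_pos m
  have h9 : (epochStart m : ℝ) * Q ≤ 4 * M * C := by nlinarith
  rw [le_div_iff₀ hτ]
  calc (f y k - fstar y k) ^ 2 * epochStart m ≤ (L₂ * Q) * epochStart m :=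
        mul_le_mul_of_nonneg_right (h5.trans (mul_le_mul_of_nonneg_left h8 (by linarith))) hτ.le
    _ = L₂ * (epochStart m * Q) := by ring
    _ ≤ L₂ * (4 * M * C) := mul_le_mul_of_nonneg_left h9 (by linarith)
    _ = _ := by ring

/-- Rounds after the epoch `M₀` have a small gap. -/
lemma IsGoodPath.gap_le (hI : IsInstance D F fstar pistar)
    (hG : IsGoodPath D F fstar T C lam (warmStart T L₁ C lam) x r a) (hC : 0 < C) (hlam : 0 < lam)
    (hL₁ : IsSurpriseBound D F fstar L₁) (hL₂ : IsIEC D F fstar lam L₂) (hT : 1 ≤ T) {t : ℕ}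
    (ht : t ≤ T) (hτ : 2 * epochStart (warmStart T L₁ C lam) ≤ t) (k : Fin K) :
    fstar (x t) k ≤ fstar (x t) (a t) + √(8 * L₂ * numEpochs T * C / t) := by
  have hM₀2 := two_le_warmStart T L₁ C lam
  rw [← epochStart_succ (by omega)] at hτ
  obtain ⟨m, hm, h1, h2⟩ := exists_epoch (by omega) ht hτ
  have hm' := Finset.mem_Icc.1 hm
  refine hG.star_le_add hI hM₀2 hC.le (Finset.mem_Icc.2 ⟨by omega, hm'.2⟩) ht h1 h2
    (fun f hf y k => ?_) k
  rw [← Real.sqrt_sq_eq_abs]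
  refine Real.sqrt_le_sqrt ((hG.width_le hI hC hlam hL₁ hL₂ hT hm hf y k).trans ?_)
  have hL := hL₂.one_le hI
  rw [epochStart_succ (by omega)] at h2
  have h3 : (t : ℝ) ≤ 2 * epochStart m := by exact_mod_cast h2.le
  have hτ : (0 : ℝ) < epochStart m := by exact_mod_cast epochStart_pos m
  have ht0 : (0 : ℝ) < t := by
    have := epochStart_pos m
    exact_mod_cast (show 0 < t by omega)
  rw [div_le_div_iff₀ hτ ht0]
  have : 0 ≤ 4 * L₂ * numEpochs T * C := by positivity
  nlinarith

/-! ### Sums of gaps -/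

/-- The sum of the gaps of the actions. -/
def gapSum (fstar : X → Fin K → ℝ) (pistar : X → Fin K) (T : ℕ) (x : ℕ → X) (a : ℕ → Fin K) : ℝ :=
  ∑ t ∈ Finset.Icc 1 T, (fstar (x t) (pistar (x t)) - fstar (x t) (a t))

lemma sum_Icc_le_add {T τ : ℕ} {g h : ℕ → ℝ} (hg : ∀ t ∈ Finset.Icc 1 T, t < τ → g t ≤ 1)
    (hh : ∀ t ∈ Finset.Icc 1 T, 0 ≤ h t) (hgh : ∀ t ∈ Finset.Icc 1 T, τ ≤ t → g t ≤ h t) :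
    ∑ t ∈ Finset.Icc 1 T, g t ≤ τ + ∑ t ∈ Finset.Icc 1 T, h t := by
  calc ∑ t ∈ Finset.Icc 1 T, g t ≤ ∑ t ∈ Finset.Icc 1 T, ((if t < τ then 1 else 0) + h t) := by
        refine Finset.sum_le_sum fun t ht => ?_
        split_ifs with hlt
        · linarith [hg t ht hlt, hh t ht]
        · linarith [hgh t ht (not_lt.1 hlt)]
    _ = ((Finset.Icc 1 T).filter (· < τ)).card + ∑ t ∈ Finset.Icc 1 T, h t := by
        rw [Finset.sum_add_distrib, Finset.sum_boole]
    _ ≤ _ := by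
        gcongr
        calc _ ≤ (Finset.range τ).card := Finset.card_le_card fun t ht =>
              Finset.mem_range.2 (Finset.mem_filter.1 ht).2
          _ = τ := Finset.card_range τ

lemma sum_inv_sqrt_le (n : ℕ) : ∑ t ∈ Finset.Icc 1 n, 1 / √(t : ℝ) ≤ 2 * √(n : ℝ) := by
  induction n with
  | zero => simp
  | succ n ih =>
    rw [Finset.sum_Icc_succ_top (by omega)]
    have h1 : 0 < √((n + 1 : ℕ) : ℝ) := Real.sqrt_pos.2 (by positivity)
    have h2 := Real.sq_sqrt (Nat.cast_nonneg (α := ℝ) n)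
    have h3 := Real.sq_sqrt (Nat.cast_nonneg (α := ℝ) (n + 1))
    have h4 : 1 / √((n + 1 : ℕ) : ℝ) ≤ 2 * √((n + 1 : ℕ) : ℝ) - 2 * √(n : ℝ) := by
      rw [div_le_iff₀ h1]
      push_cast at h3 ⊢
      nlinarith [sq_nonneg (√((n : ℝ) + 1) - √(n : ℝ))]
    linarith

lemma sum_inv_le (n : ℕ) : ∑ t ∈ Finset.Icc 1 n, 1 / (t : ℝ) ≤ 1 + Real.log n := by
  have h := harmonic_le_one_add_log n
  rw [harmonic_eq_sum_Icc] at h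
  push_cast at h
  simpa using h

lemma gap_mem_Icc (hI : IsInstance D F fstar pistar) (y : X) (k : Fin K) :
    fstar y (pistar y) - fstar y k ∈ Icc (0 : ℝ) 1 := by
  have h1 := hI.pred_mem _ hI.star_mem y (pistar y)
  have h2 := hI.pred_mem _ hI.star_mem y k
  exact ⟨by linarith [hI.policy_greedy y k], by linarith [h1.2, h2.1]⟩

lemma IsGoodPath.gapSum_le (hI : IsInstance D F fstar pistar)
    (hG : IsGoodPath D F fstar T C lam (warmStart T L₁ C lam) x r a) (hC : 0 < C) (hlam : 0 < lam)
    (hL₁ : IsSurpriseBound D F fstar L₁) (hL₂ : IsIEC D F fstar lam L₂) (hT : 1 ≤ T) :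
    gapSum fstar pistar T x a ≤ 2 * epochStart (warmStart T L₁ C lam) +
      √(8 * L₂ * numEpochs T * C) * (2 * √T) := by
  -- The width bound through L₂ needs τ_m ≥ 2 τ_{M₀}, so epoch M₀ is charged like the warm start.
  have h := sum_Icc_le_add (T := T) (τ := 2 * epochStart (warmStart T L₁ C lam))
    (g := fun t => fstar (x t) (pistar (x t)) - fstar (x t) (a t))
    (h := fun t => √(8 * L₂ * numEpochs T * C) * (1 / √(t : ℝ)))
    (fun t _ _ => (gap_mem_Icc hI _ _).2) (fun t _ => by positivity) (fun t ht hτ => by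
      have h := hG.gap_le hI hC hlam hL₁ hL₂ hT (Finset.mem_Icc.1 ht).2 hτ (pistar (x t))
      have hL := hL₂.one_le hI
      rw [Real.sqrt_div (by positivity)] at h
      rw [mul_one_div]
      linarith)
  rw [← Finset.mul_sum] at h
  have h2 := mul_le_mul_of_nonneg_left (sum_inv_sqrt_le T)
    (Real.sqrt_nonneg (8 * L₂ * numEpochs T * C))
  push_cast at h
  exact h.trans (by linarith)

/-- A wrong action has gap between γ and the width w, so the gap is at most w²/γ, which decays like
1/t instead of t^(-1/2). -/
lemma IsGoodPath.gapSum_le_of_massart (hI : IsInstance D F fstar pistar)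
    (hG : IsGoodPath D F fstar T C lam (warmStart T L₁ C lam) x r a) (hC : 0 < C) (hlam : 0 < lam)
    (hL₁ : IsSurpriseBound D F fstar L₁) (hL₂ : IsIEC D F fstar lam L₂) (hT : 1 ≤ T) {γ : ℝ}
    (hγ : IsMassart fstar pistar γ) :
    gapSum fstar pistar T x a ≤ 2 * epochStart (warmStart T L₁ C lam) +
      8 * L₂ * numEpochs T * C / γ * (1 + Real.log T) := by
  have hL := hL₂.one_le hI
  obtain ⟨hγ0, hγm⟩ := hγ
  have hc : 0 ≤ 8 * L₂ * numEpochs T * C / γ := by positivity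
  have h := sum_Icc_le_add (T := T) (τ := 2 * epochStart (warmStart T L₁ C lam))
    (g := fun t => fstar (x t) (pistar (x t)) - fstar (x t) (a t))
    (h := fun t => 8 * L₂ * numEpochs T * C / γ * (1 / (t : ℝ)))
    (fun t _ _ => (gap_mem_Icc hI _ _).2) (fun t _ => by positivity) (fun t ht hτ => by
      by_cases hat : a t = pistar (x t)
      · rw [hat, sub_self]; positivity
      have h := hG.gap_le hI hC hlam hL₁ hL₂ hT (Finset.mem_Icc.1 ht).2 hτ (pistar (x t))
      have h1 := hγm (x t) (a t) hat
      have ht0 : (0 : ℝ) < t := by exact_mod_cast (Finset.mem_Icc.1 ht).1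
      set w := √(8 * L₂ * numEpochs T * C / t) with hw
      have hw2 : w ^ 2 = 8 * L₂ * numEpochs T * C / t := Real.sq_sqrt (by positivity)
      have h2 : γ ≤ w := by linarith
      have h3 : 8 * L₂ * numEpochs T * C / γ * (1 / (t : ℝ)) = w ^ 2 / γ := by
        rw [hw2]; field_simp
      rw [h3, le_div_iff₀ hγ0]
      nlinarith)
  rw [← Finset.mul_sum] at h
  have h2 := mul_le_mul_of_nonneg_left (sum_inv_le T) hc
  push_cast at h
  exact h.trans (by linarith)

lemma IsGoodPath.action_eq_pistar (hI : IsInstance D F fstar pistar)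
    (hG : IsGoodPath D F fstar T C lam (warmStart T L₁ C lam) x r a) (hC : 0 < C) (hlam : 0 < lam)
    (hL₁ : IsSurpriseBound D F fstar L₁) {γ : ℝ} (hγ : IsMassart fstar pistar γ) (hlγ : lam ≤ γ)
    {t : ℕ} (ht : t ≤ T) (hτ : epochStart (warmStart T L₁ C lam) ≤ t) : a t = pistar (x t) :=
  hG.action_eq hI hC hlam hL₁ ht hτ fun k hk => by linarith [hγ.2 (x t) k hk]

lemma sum_le_epochStart {m : ℕ} {g : ℕ → ℝ} (hg : ∀ t ∈ Finset.Icc 1 T, g t ≤ 1)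
    (h0 : ∀ t ∈ Finset.Icc 1 T, epochStart m ≤ t → g t = 0) :
    ∑ t ∈ Finset.Icc 1 T, g t ≤ epochStart m := by
  have h := sum_Icc_le_add (T := T) (τ := epochStart m) (g := g) (h := fun _ => 0)
    (fun t ht _ => hg t ht) (fun _ _ => le_rfl) (fun t ht hτ => (h0 t ht hτ).le)
  simpa using h

end Path

/-! ### From paths to probabilities -/

lemma one_sub_le_measureReal {Ω : Type*} [MeasurableSpace Ω] {P : Measure Ω}
    [IsProbabilityMeasure P] {S : Set Ω} {δ : ℝ} (hδ : 0 ≤ δ) (h : P Sᶜ ≤ ENNReal.ofReal δ) :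
    1 - δ ≤ P.real S := by
  have h1 : P.real Sᶜ ≤ δ := ENNReal.toReal_le_of_le_ofReal hδ h
  have h2 : P.real univ ≤ P.real S + P.real Sᶜ := by
    rw [← union_compl_self S]
    exact measureReal_union_le _ _
  rw [probReal_univ] at h2
  linarith

lemma regret_eq {X Ω : Type*} {K : ℕ} (fstar : X → Fin K → ℝ) (pistar : X → Fin K) (T : ℕ)
    (x : ℕ → Ω → X) (r : ℕ → Ω → Fin K → ℝ) (a : ℕ → Ω → Fin K) (ω : Ω) : regret pistar T x r a ω =
    gapSum fstar pistar T (fun t => x t ω) (fun t => a t ω) +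
      ∑ t ∈ Finset.Icc 1 T, (r t ω (pistar (x t ω)) - fstar (x t ω) (pistar (x t ω))) -
      ∑ t ∈ Finset.Icc 1 T, (r t ω (a t ω) - fstar (x t ω) (a t ω)) := by
  rw [regret, gapSum, ← Finset.sum_sub_distrib, ← Finset.sum_add_distrib, ← Finset.sum_sub_distrib]
  exact Finset.sum_congr rfl fun t _ => by ring

section Run

variable {X Ω : Type*} [MeasurableSpace X] [mΩ : MeasurableSpace Ω] {K : ℕ}
  {D : Measure (X × (Fin K → ℝ))} {F : Set (X → Fin K → ℝ)} {fstar : X → Fin K → ℝ}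
  {pistar : X → Fin K} {T M₀ : ℕ} {β : ℕ → ℝ} {P : Measure Ω} {x : ℕ → Ω → X}
  {r : ℕ → Ω → Fin K → ℝ} {a : ℕ → Ω → Fin K} {H : ℕ → MeasurableSpace Ω} {C δ lam : ℝ}

/-- A Chernoff bound with constant increments θ = σ √(l/T): the compensator is T θ²/4 = l/4, so a
deviation of 5/4 · √(Tl) leaves an exponent above l. -/
lemma IsOptimisticRun.measure_noise_gt_le (hI : IsInstance D F fstar pistar)
    (hR : IsOptimisticRun D F T M₀ β P x r a) (hH : IsRewardFiltration fstar P T x r a H)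
    {b : ℕ → Ω → Fin K} (hb : ∀ t ∈ Finset.Icc 1 T, Measurable[H t] (b t)) {σ : ℝ} (hσ : |σ| = 1)
    {l : ℝ} (hl : 0 < l) (hT : 1 ≤ T) :
    P {ω | 5 / 4 * √(T * l) <
      σ * ∑ t ∈ Finset.Icc 1 T, (r t ω (b t ω) - fstar (x t ω) (b t ω))} ≤
      ENNReal.ofReal (Real.exp (-l)) := by
  have := hR.prob
  have hr01 := hR.reward_mem hI
  have hf01 := hI.pred_mem _ hI.star_mem
  have hT0 : (0 : ℝ) < T := by exact_mod_cast hT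
  have hs2 := Real.sq_sqrt (mul_nonneg hT0.le hl.le)
  have hs0 := Real.sqrt_nonneg (T * l)
  -- For l > T the choice of θ would violate |θ| ≤ 1, but then the sum, which is at most T, cannot
  -- exceed √(Tl).
  rcases le_or_gt l T with hlT | hlT
  · set θ := σ * √(l / T) with hθ
    have hθ1 : |θ| ≤ 1 := by
      rw [hθ, abs_mul, hσ, one_mul, abs_of_nonneg (Real.sqrt_nonneg _)]
      exact Real.sqrt_le_one.2 ((div_le_one hT0).2 hlT)
    have hθ2 : T * θ ^ 2 = l := by
      rw [hθ, mul_pow, ← sq_abs σ, hσ, Real.sq_sqrt (by positivity)]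
      field_simp
    have hmul : √(l / T) * √(T * l) = l := by
      rw [← Real.sqrt_mul (by positivity), show l / T * (T * l) = l ^ 2 by field_simp,
        Real.sqrt_sq hl.le]
    have h := hH.measure_inter_le (hI.pred_meas _ hI.star_mem) hf01 (fun t ht => (hR.meas t ht).2.1)
      hr01 hb (θ := fun _ _ => θ) (fun _ _ => measurable_const) (fun _ _ => hθ1)
      MeasurableSet.univ le_rfl l
    rw [univ_inter, measure_univ, mul_one] at h
    refine (measure_mono fun ω hω => ?_).trans h
    rw [mem_ofPred_eq] at hω ⊢
    rw [noiseExponent, Finset.sum_sub_distrib, ← Finset.mul_sum, Finset.sum_const, Nat.card_Icc,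
      nsmul_eq_mul, Nat.add_sub_cancel, mul_div_assoc', hθ2, hθ, mul_comm σ, mul_assoc]
    have h0 : 0 < √(l / T) := Real.sqrt_pos.2 (by positivity)
    have := mul_lt_mul_of_pos_left hω h0
    linarith
  · refine le_of_eq_of_le (measure_eq_zero_iff_ae_notMem.2 ?_) zero_le
    filter_upwards [hr01] with ω hω
    rw [not_lt]
    have h1 : |∑ t ∈ Finset.Icc 1 T, (r t ω (b t ω) - fstar (x t ω) (b t ω))| ≤ T := by
      refine (Finset.abs_sum_le_sum_abs _ _).trans
        ((Finset.sum_le_sum (g := fun _ => (1 : ℝ)) fun t ht => ?_).trans (by simp))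
      have h2 := hω t ht (b t ω)
      have h3 := hf01 (x t ω) (b t ω)
      rw [abs_le]
      constructor <;> linarith [h2.1, h2.2, h3.1, h3.2]
    have h4 : (T : ℝ) ≤ √(T * l) := Real.le_sqrt_of_sq_le (by nlinarith)
    refine (le_abs_self _).trans ?_
    rw [abs_mul, hσ, one_mul]
    linarith

lemma IsOptimisticRun.measure_not_isGoodPath_and_regret_le (hI : IsInstance D F fstar pistar)
    (hR : IsOptimisticRun D F T M₀ (tolerance T C) P x r a) (hT : 2 ≤ T) (hδ : δ ∈ Ioo (0 : ℝ) 1)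
    (hC : IsRadius D F T δ C) (hM₀ : 2 ≤ M₀) (hlam : 0 < lam) :
    P {ω | ¬ (IsGoodPath D F fstar T C lam M₀ (fun t => x t ω) (fun t => r t ω) (fun t => a t ω) ∧
      regret pistar T x r a ω ≤ gapSum fstar pistar T (fun t => x t ω) (fun t => a t ω) +
        5 / 2 * √(T * C))} ≤ ENNReal.ofReal δ := by
  obtain ⟨H, hH⟩ := hR.exists_rewardFiltration hI
  have hl := log_four_div_pos hδ
  have hlC := hC.log_four_div_le hI hT hδ
  have hexp : Real.exp (-Real.log (4 / δ)) = δ / 4 := by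
    rw [Real.exp_neg, Real.exp_log (div_pos (by norm_num) hδ.1), inv_div]
  have h1 := hR.measure_noise_gt_le hI hH (b := fun t ω => pistar (x t ω)) (σ := 1)
    (fun t ht => hI.policy_meas.comp (hH.context t ht t ht)) (by simp)
    (by linarith : 0 < Real.log (4 / δ)) (by omega)
  have h2 := hR.measure_noise_gt_le hI hH hH.action (σ := -1) (by simp)
    (by linarith : 0 < Real.log (4 / δ)) (by omega)
  have h3 := hR.measure_not_isGoodPath_le hI hT hδ hC hM₀ hlam
  rw [hexp] at h1 h2
  have hδ0 := hδ.1
  calc _ ≤ ENNReal.ofReal (δ / 2) + ENNReal.ofReal (δ / 4) + ENNReal.ofReal (δ / 4) := by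
        refine (measure_mono fun ω hω => ?_).trans ((measure_union_le _ _).trans
          (add_le_add ((measure_union_le _ _).trans (add_le_add h3 h1)) h2))
        by_contra hn
        simp only [mem_union, mem_ofPred_eq, not_or, not_not, not_lt] at hn hω
        obtain ⟨⟨hg, h4⟩, h5⟩ := hn
        refine hω ⟨hg, ?_⟩
        rw [regret_eq fstar]
        have h6 : √(T * Real.log (4 / δ)) ≤ √(T * C) :=
          Real.sqrt_le_sqrt (mul_le_mul_of_nonneg_left hlC (Nat.cast_nonneg T))
        linarith
    _ = ENNReal.ofReal δ := by
        rw [← ENNReal.ofReal_add (by positivity) (by positivity),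
          ← ENNReal.ofReal_add (by positivity) (by positivity)]
        congr 1
        ring

lemma IsOptimisticRun.integrable_reward (hI : IsInstance D F fstar pistar)
    (hR : IsOptimisticRun D F T M₀ β P x r a) {t : ℕ} (ht : t ∈ Finset.Icc 1 T) {b : Ω → Fin K}
    (hb : Measurable b) : Integrable (fun ω => r t ω (b ω)) P := by
  have := hR.prob
  refine Integrable.of_bound (measurable_apply_action
    (fun k => (measurable_pi_apply k).comp (hR.meas t ht).2.1) hb).aestronglyMeasurable 1 ?_
  filter_upwards [hR.reward_mem hI] with ω hω
  rw [Real.norm_eq_abs, abs_of_nonneg (hω t ht _).1]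
  exact (hω t ht _).2

lemma IsOptimisticRun.integrable_star (hI : IsInstance D F fstar pistar)
    (hR : IsOptimisticRun D F T M₀ β P x r a) {t : ℕ} (ht : t ∈ Finset.Icc 1 T) {b : Ω → Fin K}
    (hb : Measurable b) : Integrable (fun ω => fstar (x t ω) (b ω)) P := by
  have := hR.prob
  refine Integrable.of_bound (measurable_apply_action (u := fun ω => fstar (x t ω))
    (fun k => (hI.pred_meas _ hI.star_mem k).comp (hR.meas t ht).1) hb).aestronglyMeasurable 1
    (Filter.Eventually.of_forall fun ω => ?_)
  have h := hI.pred_mem _ hI.star_mem (x t ω) (b ω)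
  rw [Real.norm_eq_abs, abs_of_nonneg h.1]
  exact h.2

lemma IsOptimisticRun.integrable_regret (hI : IsInstance D F fstar pistar)
    (hR : IsOptimisticRun D F T M₀ β P x r a) : Integrable (regret pistar T x r a) P :=
  (integrable_finsetSum _ fun t ht => hR.integrable_reward hI ht
    (hI.policy_meas.comp (hR.meas t ht).1)).sub
  (integrable_finsetSum _ fun t ht => hR.integrable_reward hI ht (hR.meas t ht).2.2)

lemma IsOptimisticRun.integrable_gapSum (hI : IsInstance D F fstar pistar)
    (hR : IsOptimisticRun D F T M₀ β P x r a) :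
    Integrable (fun ω => gapSum fstar pistar T (fun t => x t ω) (fun t => a t ω)) P :=
  integrable_finsetSum _ fun t ht => (hR.integrable_star hI ht
    (hI.policy_meas.comp (hR.meas t ht).1)).sub (hR.integrable_star hI ht (hR.meas t ht).2.2)

/-- The noise has mean zero even for adaptive actions. In expectation this removes the term of order
√(TC), which would spoil the fast rate. -/
lemma IsOptimisticRun.integral_regret (hI : IsInstance D F fstar pistar)
    (hR : IsOptimisticRun D F T M₀ β P x r a) : ∫ ω, regret pistar T x r a ω ∂P =
      ∫ ω, gapSum fstar pistar T (fun t => x t ω) (fun t => a t ω) ∂P := by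
  have := hR.prob
  obtain ⟨H, hH⟩ := hR.exists_rewardFiltration hI
  have key : ∀ t ∈ Finset.Icc 1 T, ∀ b : Ω → Fin K, Measurable[H t] b →
      ∫ ω, r t ω (b ω) ∂P = ∫ ω, fstar (x t ω) (b ω) ∂P := by
    intro t ht b hb
    have h := hH.integral_mul_reward (hI.pred_meas _ hI.star_mem) (hI.pred_mem _ hI.star_mem)
      (fun t ht => (hR.meas t ht).2.1) (hR.reward_mem hI) ht hb (g := fun _ => 1) measurable_const
      ⟨1, by simp⟩
    simpa using h
  have hp : ∀ t ∈ Finset.Icc 1 T, Measurable fun ω => pistar (x t ω) := fun t ht =>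
    hI.policy_meas.comp (hR.meas t ht).1
  simp only [regret, gapSum, Finset.sum_sub_distrib]
  rw [integral_sub (integrable_finsetSum _ fun t ht => hR.integrable_reward hI ht (hp t ht))
      (integrable_finsetSum _ fun t ht => hR.integrable_reward hI ht (hR.meas t ht).2.2),
    integral_sub (integrable_finsetSum _ fun t ht => hR.integrable_star hI ht (hp t ht))
      (integrable_finsetSum _ fun t ht => hR.integrable_star hI ht (hR.meas t ht).2.2),
    integral_finsetSum _ fun t ht => hR.integrable_reward hI ht (hp t ht),
    integral_finsetSum _ fun t ht => hR.integrable_reward hI ht (hR.meas t ht).2.2,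
    integral_finsetSum _ fun t ht => hR.integrable_star hI ht (hp t ht),
    integral_finsetSum _ fun t ht => hR.integrable_star hI ht (hR.meas t ht).2.2]
  congr 1
  · exact Finset.sum_congr rfl fun t ht => key t ht _ (hI.policy_meas.comp (hH.context t ht t ht))
  · exact Finset.sum_congr rfl fun t ht => key t ht _ (hH.action t ht)

lemma gapSum_le_card (hI : IsInstance D F fstar pistar) (y : ℕ → X) (b : ℕ → Fin K) :
    gapSum fstar pistar T y b ≤ T := by
  refine (Finset.sum_le_sum fun t _ => (gap_mem_Icc hI (y t) (b t)).2).trans ?_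
  simp

/-- Off the good paths, with probability at most δ/2, the gaps still sum to at most T. -/
lemma IsOptimisticRun.integral_regret_le (hI : IsInstance D F fstar pistar)
    (hR : IsOptimisticRun D F T M₀ (tolerance T C) P x r a) (hT : 2 ≤ T) (hδ : δ ∈ Ioo (0 : ℝ) 1)
    (hC : IsRadius D F T δ C) (hM₀ : 2 ≤ M₀) (hlam : 0 < lam) {B : ℝ} (hB0 : 0 ≤ B)
    (hB : ∀ (y : ℕ → X) (u : ℕ → Fin K → ℝ) (b : ℕ → Fin K),
      IsGoodPath D F fstar T C lam M₀ y u b → gapSum fstar pistar T y b ≤ B) :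
    ∫ ω, regret pistar T x r a ω ∂P ≤ B + T * (δ / 2) := by
  have := hR.prob
  rw [hR.integral_regret hI]
  have hint := hR.integrable_gapSum hI
  set g : Ω → ℝ := fun ω => gapSum fstar pistar T (fun t => x t ω) (fun t => a t ω) with hg
  -- A measurable hull of the event that the bound fails, of the same measure.
  set S : Set Ω := toMeasurable P {ω | B < g ω} with hS
  have hSm : MeasurableSet S := measurableSet_toMeasurable _ _
  have hPS : P.real S ≤ δ / 2 := by
    refine ENNReal.toReal_le_of_le_ofReal (by linarith [hδ.1]) ?_
    rw [hS, measure_toMeasurable]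
    refine le_trans (measure_mono fun ω hω => ?_)
      (hR.measure_not_isGoodPath_le hI hT hδ hC hM₀ hlam)
    exact fun hgood => not_le.2 hω (hB _ _ _ hgood)
  have hi : Integrable (S.indicator fun _ => (T : ℝ)) P := (integrable_const _).indicator hSm
  calc ∫ ω, g ω ∂P ≤ ∫ ω, (B + S.indicator (fun _ => (T : ℝ)) ω) ∂P := by
        refine integral_mono hint ((integrable_const _).add hi) fun ω => ?_
        by_cases hω : ω ∈ S
        · simp only [indicator_of_mem hω]
          linarith [gapSum_le_card (T := T) hI (fun t => x t ω) (fun t => a t ω)]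
        · have : ¬ B < g ω := fun h => hω (subset_toMeasurable _ _ h)
          simp only [indicator_of_notMem hω]
          linarith
    _ = B + P.real S * T := by
        rw [integral_add (integrable_const _) hi, integral_indicator_const _ hSm]
        simp
    _ ≤ _ := by
        have : (0 : ℝ) ≤ T := Nat.cast_nonneg T
        nlinarith

end Run

/-! ### Orders of magnitude -/

section Order

variable {T K : ℕ} {L₁ L₂ C lam δ : ℝ}

lemma log_two_le_log_cast (hT : 2 ≤ T) : 0.69 ≤ Real.log T :=
  (by linarith [Real.log_two_gt_d9] : 0.69 ≤ Real.log 2).trans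
    (Real.log_le_log (by norm_num) (by exact_mod_cast hT))

lemma numEpochs_le_log (hT : 2 ≤ T) : (numEpochs T : ℝ) ≤ 1 + 1.45 * Real.log T := by
  have h1 : (2 : ℝ) ^ Nat.log 2 T ≤ T := by exact_mod_cast Nat.pow_log_le_self 2 (by omega)
  have h2 := Real.log_le_log (by positivity) h1
  rw [Real.log_pow] at h2
  rw [numEpochs]
  push_cast
  have h3 := Real.log_two_gt_d9
  have h4 : (0 : ℝ) ≤ Nat.log 2 T := Nat.cast_nonneg _
  nlinarith

lemma epochStart_warmStart_le (hT : 2 ≤ T) (hL₁ : 1 ≤ L₁) (hC : 1 ≤ C)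
    (hlam : lam ∈ Ioo (0 : ℝ) 1) :
    (epochStart (warmStart T L₁ C lam) : ℝ) ≤ 25 * (L₁ * C * Real.log T / lam ^ 2) := by
  have h := (warmStart_bounds (T := T) (lam := lam) (by linarith : 0 ≤ L₁)
    (by linarith : 0 ≤ C)).2
  have hl := log_two_le_log_cast hT
  have hM := numEpochs_le_log hT
  have hlam2 : 0 < lam ^ 2 := pow_pos hlam.1 2
  have hlam1 : lam ^ 2 ≤ 1 := pow_le_one₀ hlam.1.le hlam.2.le
  have hLC : 1 ≤ L₁ * C := one_le_mul_of_one_le_of_one_le hL₁ hC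
  have hq : 1 ≤ L₁ * C / lam ^ 2 := by rw [le_div_iff₀ hlam2]; linarith
  have e1 : (2 * (numEpochs T : ℝ) + 3) * L₁ * C / lam ^ 2 =
    (2 * (numEpochs T : ℝ) + 3) * (L₁ * C / lam ^ 2) := by ring
  have e2 : L₁ * C * Real.log T / lam ^ 2 = Real.log T * (L₁ * C / lam ^ 2) := by ring
  rw [e1] at h
  rw [e2]
  nlinarith

lemma half_le_leading (hT : 2 ≤ T) (hL₁ : 1 ≤ L₁) (hC : 1 ≤ C) (hlam : lam ∈ Ioo (0 : ℝ) 1) :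
    1 / 2 ≤ L₁ * C * Real.log T / lam ^ 2 := by
  have hl := log_two_le_log_cast hT
  have hlam1 : lam ^ 2 ≤ 1 := pow_le_one₀ hlam.1.le hlam.2.le
  have hLC : 1 ≤ L₁ * C := one_le_mul_of_one_le_of_one_le hL₁ hC
  rw [le_div_iff₀ (pow_pos hlam.1 2)]
  nlinarith

lemma sqrt_order_le (hT : 2 ≤ T) (hL₂ : 1 ≤ L₂) (hC : 1 ≤ C) :
    √(8 * L₂ * numEpochs T * C) * (2 * √T) + 5 / 2 * √(T * C) ≤
      16 * (√(T * L₂ * C) * Real.log T) := by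
  have hl := log_two_le_log_cast hT
  have hM := numEpochs_le_log hT
  have hR0 := Real.sqrt_nonneg (T * L₂ * C)
  have hTC : (0 : ℝ) ≤ T * C := by positivity
  have h1 : √(8 * L₂ * numEpochs T * C) * √T ≤ 6 * (√(T * L₂ * C) * Real.log T) := by
    rw [← Real.sqrt_mul (by positivity)]
    refine Real.sqrt_le_iff.2 ⟨by positivity, ?_⟩
    rw [mul_pow, mul_pow, Real.sq_sqrt (by positivity)]
    have h2 : 8 * (numEpochs T : ℝ) ≤ 36 * Real.log T ^ 2 := by nlinarith
    have h3 : 0 ≤ T * L₂ * C := by positivity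
    nlinarith
  have h2 : √(T * C) ≤ √(T * L₂ * C) := Real.sqrt_le_sqrt (by nlinarith)
  nlinarith

lemma massart_order_le (hT : 2 ≤ T) (hL₂ : 1 ≤ L₂) (hC : 1 ≤ C) {γ : ℝ} (hγ : 0 < γ) :
    8 * L₂ * numEpochs T * C / γ * (1 + Real.log T) ≤ 80 * (L₂ * C * Real.log T ^ 2 / γ) := by
  have hl := log_two_le_log_cast hT
  have hM := numEpochs_le_log hT
  have hM0 : (0 : ℝ) ≤ numEpochs T := Nat.cast_nonneg _
  have hq : 0 ≤ L₂ * C / γ := by positivity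
  have e1 : 8 * L₂ * numEpochs T * C / γ * (1 + Real.log T) =
    8 * ((numEpochs T : ℝ) * (1 + Real.log T)) * (L₂ * C / γ) := by ring
  have e2 : 80 * (L₂ * C * Real.log T ^ 2 / γ) = 80 * Real.log T ^ 2 * (L₂ * C / γ) := by ring
  rw [e1, e2]
  refine mul_le_mul_of_nonneg_right ?_ hq
  have h1 : (numEpochs T : ℝ) ≤ 3 * Real.log T := by linarith
  have h2 : 1 + Real.log T ≤ 2.5 * Real.log T := by linarith
  nlinarith [mul_le_mul h1 h2 (by linarith) (by linarith)]

lemma logFactor_ge (K : ℕ) (hT : 2 ≤ T) (hδ : δ ∈ Ioo (0 : ℝ) 1) :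
    1 + Real.log T + Real.log (1 / δ) ≤ logFactor K T δ := by
  have hl := log_two_le_log_cast hT
  have hk : 0 ≤ Real.log K := Real.log_natCast_nonneg K
  have hd : 0 ≤ Real.log (1 / δ) := Real.log_nonneg (by rw [le_div_iff₀ hδ.1]; linarith [hδ.2])
  rw [logFactor]
  have h1 : (1 + Real.log T) ≤ (1 + Real.log T) * (1 + Real.log K) :=
    le_mul_of_one_le_right (by linarith) (by linarith)
  nlinarith

/-- If `fstar` were the only predictor, every positive constant would be admissible and none would
be least. So log |F| ≥ log 2, and additive constants can be absorbed into multiples of log |F|. -/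
lemma IsSurpriseBound.two_le_ncard {X : Type*} [MeasurableSpace X] {D : Measure (X × (Fin K → ℝ))}
    {F : Set (X → Fin K → ℝ)} {fstar : X → Fin K → ℝ} (hF : F.Finite) (hs : fstar ∈ F)
    (h : IsSurpriseBound D F fstar L₁) : 2 ≤ F.ncard := by
  by_contra! hlt
  have h0 : 0 < L₁ := h.1.1
  have heq : ∀ f ∈ F, f = fstar := fun f hf =>
    (ncard_le_one hF).1 (by omega) f hf fstar hs
  have hm := h.2 (show L₁ / 2 ∈ _ from ⟨by linarith, fun f hf x k => by simp [heq f hf]⟩)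
  linarith

lemma finiteRadius_le {X : Type*} {F : Set (X → Fin K → ℝ)} (hT : 2 ≤ T)
    (hδ : δ ∈ Ioo (0 : ℝ) 1) (hF : 2 ≤ F.ncard) :
    finiteRadius F T δ ≤ 48 * (Real.log F.ncard * logFactor K T δ) := by
  have hl := log_two_le_log_cast hT
  have hn := log_two_le_log_cast hF
  have hLF := logFactor_ge K hT hδ
  have hd : 0 ≤ Real.log (1 / δ) := Real.log_nonneg (by rw [le_div_iff₀ hδ.1]; linarith [hδ.2])
  have hF0 : (0 : ℝ) < F.ncard := by exact_mod_cast (by omega : 0 < F.ncard)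
  have hT0 : (0 : ℝ) < T := by exact_mod_cast (by omega : 0 < T)
  have e : Real.log (2 * F.ncard * (T : ℝ) ^ 2 / δ) =
      Real.log 2 + Real.log F.ncard + 2 * Real.log T + Real.log (1 / δ) := by
    rw [div_eq_mul_one_div, Real.log_mul (by positivity) (one_div_pos.2 hδ.1).ne',
      Real.log_mul (by positivity) (by positivity), Real.log_mul (by norm_num) hF0.ne',
      Real.log_pow]
    push_cast
    ring
  have h2 : Real.log 2 ≤ Real.log F.ncard :=
    Real.log_le_log (by norm_num) (by exact_mod_cast hF)
  rw [finiteRadius, e]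
  nlinarith

lemma IsRadius.le_finite {X : Type*} [MeasurableSpace X] {D : Measure (X × (Fin K → ℝ))}
    {F : Set (X → Fin K → ℝ)} (hC : IsRadius D F T δ C) (hF : F.Finite) :
    C ≤ finiteRadius F T δ := by
  rcases hC with ⟨-, rfl | rfl⟩ | ⟨hinf, -⟩
  · exact le_rfl
  · exact min_le_left _ _
  · exact absurd hF hinf

variable {N Λ : ℝ}

lemma leading_le (hL₁ : 0 ≤ L₁) (hN : 0 ≤ N) (hΛ : 1 ≤ Λ) (hlog : Real.log T ≤ Λ)
    (hC : C ≤ 48 * (N * Λ)) :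
    L₁ * C * Real.log T / lam ^ 2 ≤ 48 * Λ ^ 3 * (L₁ * N / lam ^ 2) := by
  have h0 : 0 ≤ Real.log T := Real.log_natCast_nonneg T
  have h1 : C * Real.log T ≤ 48 * (N * Λ) * Λ := by
    refine mul_le_mul hC hlog h0 (by positivity)
  have h2 : 48 * (N * Λ) * Λ ≤ 48 * Λ ^ 3 * N := by
    have : Λ ^ 2 ≤ Λ ^ 3 := pow_le_pow_right₀ hΛ (by norm_num)
    nlinarith
  rw [mul_div_assoc', mul_assoc]
  refine div_le_div_of_nonneg_right ?_ (sq_nonneg lam)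
  nlinarith [mul_le_mul_of_nonneg_left (h1.trans h2) hL₁]

lemma sqrt_term_le (hL₂ : 0 ≤ L₂) (hN : 0 ≤ N) (hΛ : 1 ≤ Λ) (hlog : Real.log T ≤ Λ)
    (hC : C ≤ 48 * (N * Λ)) :
    √(T * L₂ * C) * Real.log T ≤ 48 * Λ ^ 3 * √(T * L₂ * N) := by
  have h0 : 0 ≤ Real.log T := Real.log_natCast_nonneg T
  have hTL : 0 ≤ T * L₂ := by positivity
  have hs := Real.sqrt_nonneg (T * L₂ * N)
  have h1 : √(T * L₂ * C) ≤ 7 * Λ * √(T * L₂ * N) := by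
    refine Real.sqrt_le_iff.2 ⟨by positivity, ?_⟩
    rw [mul_pow, Real.sq_sqrt (by positivity)]
    have h2 : C ≤ (7 * Λ) ^ 2 * N := by nlinarith [mul_nonneg hN (by linarith : 0 ≤ Λ)]
    nlinarith [mul_le_mul_of_nonneg_left h2 hTL]
  calc √(T * L₂ * C) * Real.log T ≤ 7 * Λ * √(T * L₂ * N) * Λ :=
        mul_le_mul h1 hlog h0 (by positivity)
    _ = 7 * Λ ^ 2 * √(T * L₂ * N) := by ring
    _ ≤ _ := by
        have : Λ ^ 2 ≤ Λ ^ 3 := pow_le_pow_right₀ hΛ (by norm_num)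
        exact mul_le_mul_of_nonneg_right (by nlinarith [sq_nonneg Λ]) hs

lemma massart_term_le (hL₂ : 0 ≤ L₂) (hN : 0 ≤ N) (hΛ : 1 ≤ Λ) (hlog : Real.log T ≤ Λ)
    (hC : C ≤ 48 * (N * Λ)) {γ : ℝ} (hγ : 0 ≤ γ) :
    L₂ * C * Real.log T ^ 2 / γ ≤ 48 * Λ ^ 3 * (L₂ * N / γ) := by
  have h0 : 0 ≤ Real.log T := Real.log_natCast_nonneg T
  have h1 : C * Real.log T ^ 2 ≤ 48 * (N * Λ) * Λ ^ 2 :=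
    mul_le_mul hC (pow_le_pow_left₀ h0 hlog 2) (sq_nonneg _) (by positivity)
  rw [mul_div_assoc', mul_assoc]
  refine div_le_div_of_nonneg_right ?_ hγ
  nlinarith [mul_le_mul_of_nonneg_left h1 hL₂]

end Order

section Main

variable {X Ω : Type*} [MeasurableSpace X] [MeasurableSpace Ω] {K T : ℕ}
  {D : Measure (X × (Fin K → ℝ))} {F : Set (X → Fin K → ℝ)} {fstar : X → Fin K → ℝ}
  {pistar : X → Fin K} {P : Measure Ω} {x : ℕ → Ω → X} {r : ℕ → Ω → Fin K → ℝ}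
  {a : ℕ → Ω → Fin K} {L₁ L₂ lam δ C γ : ℝ}

lemma IsOptimisticRun.one_sub_le_regret_le (hT : 2 ≤ T) (hI : IsInstance D F fstar pistar)
    (hL₁ : IsSurpriseBound D F fstar L₁) (hlam : lam ∈ Ioo (0 : ℝ) 1) (hδ : δ ∈ Ioo (0 : ℝ) 1)
    (hC : IsRadius D F T δ C)
    (hR : IsOptimisticRun D F T (warmStart T L₁ C lam) (tolerance T C) P x r a)
    (hL₂ : IsIEC D F fstar lam L₂) :
    1 - δ ≤ P.real {ω | regret pistar T x r a ω ≤
      100 * (L₁ * C * Real.log T / lam ^ 2 + √(T * L₂ * C) * Real.log T)} := by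
  have := hR.prob
  have hC1 : 1 ≤ C := (log_four_div_pos hδ).trans (hC.log_four_div_le hI hT hδ)
  have hL1 := hL₁.one_le hI
  have hM₀ := two_le_warmStart T L₁ C lam
  refine one_sub_le_measureReal hδ.1.le (le_trans (measure_mono fun ω hω => ?_)
    (hR.measure_not_isGoodPath_and_regret_le hI hT hδ hC hM₀ hlam.1))
  rintro ⟨hG, hreg⟩
  refine hω (hreg.trans ?_)
  have h1 := hG.gapSum_le hI (by linarith) hlam.1 hL₁ hL₂ (by omega)
  have h2 := epochStart_warmStart_le hT hL1 hC1 hlam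
  have h3 := sqrt_order_le hT (hL₂.one_le hI) hC1
  have h4 := half_le_leading hT hL1 hC1 hlam
  have h5 : 0 ≤ √(T * L₂ * C) * Real.log T :=
    mul_nonneg (Real.sqrt_nonneg _) (Real.log_natCast_nonneg T)
  linarith

/-- Once all actions are optimal, the realized regret of each round is 0, so the noise need not be
controlled and the warm start is the only cost. -/
lemma IsOptimisticRun.one_sub_le_action_eq (hT : 2 ≤ T) (hI : IsInstance D F fstar pistar)
    (hL₁ : IsSurpriseBound D F fstar L₁) (hlam : lam ∈ Ioo (0 : ℝ) 1) (hδ : δ ∈ Ioo (0 : ℝ) 1)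
    (hC : IsRadius D F T δ C)
    (hR : IsOptimisticRun D F T (warmStart T L₁ C lam) (tolerance T C) P x r a)
    (hγ : IsMassart fstar pistar γ) (hlγ : lam ≤ γ) :
    1 - δ ≤ P.real {ω | (∀ t ∈ Finset.Icc 1 T, epochStart (warmStart T L₁ C lam) ≤ t →
      a t ω = pistar (x t ω)) ∧
      regret pistar T x r a ω ≤ 100 * (L₁ * C * Real.log T / lam ^ 2)} := by
  have := hR.prob
  have hC1 : 1 ≤ C := (log_four_div_pos hδ).trans (hC.log_four_div_le hI hT hδ)
  have hL1 := hL₁.one_le hI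
  have hM₀ := two_le_warmStart T L₁ C lam
  refine one_sub_le_measureReal hδ.1.le ((le_trans (measure_mono fun ω hω => ?_)
    (hR.measure_not_isGoodPath_le hI hT hδ hC hM₀ hlam.1)).trans
    (ENNReal.ofReal_le_ofReal (by linarith [hδ.1])))
  intro hG
  have hact : ∀ t ∈ Finset.Icc 1 T, epochStart (warmStart T L₁ C lam) ≤ t →
      a t ω = pistar (x t ω) := fun t ht hτ =>
    hG.action_eq_pistar hI (by linarith) hlam.1 hL₁ hγ hlγ (Finset.mem_Icc.1 ht).2 hτ
  refine hω ⟨hact, ?_⟩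
  have h1 : regret pistar T x r a ω ≤ epochStart (warmStart T L₁ C lam) := by
    rw [regret, ← Finset.sum_sub_distrib]
    refine sum_le_epochStart (fun t ht => ?_) fun t ht hτ => by rw [hact t ht hτ, sub_self]
    linarith [(hG.reward t ht (pistar (x t ω))).2, (hG.reward t ht (a t ω)).1]
  have h2 := epochStart_warmStart_le hT hL1 hC1 hlam
  have h4 := half_le_leading hT hL1 hC1 hlam
  linarith

lemma IsOptimisticRun.integral_regret_le_of_le_margin (hT : 2 ≤ T)
    (hI : IsInstance D F fstar pistar) (hL₁ : IsSurpriseBound D F fstar L₁)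
    (hlam : lam ∈ Ioo (0 : ℝ) 1) (hδ : δ ∈ Ioo (0 : ℝ) 1) (hδT : δ = 1 / T)
    (hC : IsRadius D F T δ C)
    (hR : IsOptimisticRun D F T (warmStart T L₁ C lam) (tolerance T C) P x r a)
    (hγ : IsMassart fstar pistar γ) (hlγ : lam ≤ γ) :
    ∫ ω, regret pistar T x r a ω ∂P ≤ 100 * (L₁ * C * Real.log T / lam ^ 2) := by
  have hC1 : 1 ≤ C := (log_four_div_pos hδ).trans (hC.log_four_div_le hI hT hδ)
  have hL1 := hL₁.one_le hI
  have hT0 : (0 : ℝ) < T := by exact_mod_cast (by omega : 0 < T)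
  have h := hR.integral_regret_le hI hT hδ hC (two_le_warmStart T L₁ C lam) hlam.1
    (B := epochStart (warmStart T L₁ C lam)) (Nat.cast_nonneg _) fun y u b hG =>
    sum_le_epochStart (fun t _ => (gap_mem_Icc hI _ _).2) fun t ht hτ => by
      rw [hG.action_eq_pistar hI (by linarith) hlam.1 hL₁ hγ hlγ (Finset.mem_Icc.1 ht).2 hτ,
        sub_self]
  have e : (T : ℝ) * (δ / 2) = 1 / 2 := by rw [hδT]; field_simp
  have h2 := epochStart_warmStart_le hT hL1 hC1 hlam
  have h4 := half_le_leading hT hL1 hC1 hlam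
  linarith

lemma IsOptimisticRun.integral_regret_le_of_margin_lt (hT : 2 ≤ T)
    (hI : IsInstance D F fstar pistar) (hL₁ : IsSurpriseBound D F fstar L₁)
    (hlam : lam ∈ Ioo (0 : ℝ) 1) (hδ : δ ∈ Ioo (0 : ℝ) 1) (hδT : δ = 1 / T)
    (hC : IsRadius D F T δ C)
    (hR : IsOptimisticRun D F T (warmStart T L₁ C lam) (tolerance T C) P x r a)
    (hγ : IsMassart fstar pistar γ) (hL₂ : IsIEC D F fstar lam L₂) :
    ∫ ω, regret pistar T x r a ω ∂P ≤
      100 * (L₁ * C * Real.log T / lam ^ 2 + L₂ * C * Real.log T ^ 2 / γ) := by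
  have hC1 : 1 ≤ C := (log_four_div_pos hδ).trans (hC.log_four_div_le hI hT hδ)
  have hL1 := hL₁.one_le hI
  have hL2 := hL₂.one_le hI
  have hγ0 := hγ.1
  have hlog : 0 ≤ Real.log T := Real.log_natCast_nonneg T
  have hT0 : (0 : ℝ) < T := by exact_mod_cast (by omega : 0 < T)
  have h := hR.integral_regret_le hI hT hδ hC (two_le_warmStart T L₁ C lam) hlam.1
    (by positivity) fun y u b hG =>
      hG.gapSum_le_of_massart hI (by linarith) hlam.1 hL₁ hL₂ (by omega) hγ
  have e : (T : ℝ) * (δ / 2) = 1 / 2 := by rw [hδT]; field_simp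
  have h2 := epochStart_warmStart_le hT hL1 hC1 hlam
  have h3 := massart_order_le hT hL2 hC1 hγ0
  have h4 := half_le_leading hT hL1 hC1 hlam
  have h5 : 0 ≤ L₂ * C * Real.log T ^ 2 / γ := by positivity
  linarith

end Main

end RegCB

theorem theorem4 : ∃ c : ℝ, 0 < c ∧ ∃ p : ℕ,
    ∀ {X : Type*} {Ω : Type*} [MeasurableSpace X] [MeasurableSpace Ω] {K T : ℕ}
      (D : Measure (X × (Fin K → ℝ))) (F : Set (X → Fin K → ℝ)) (fstar : X → Fin K → ℝ)
      (pistar : X → Fin K) (P : Measure Ω) (x : ℕ → Ω → X) (r : ℕ → Ω → Fin K → ℝ)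
      (a : ℕ → Ω → Fin K) (L₁ lam δ C : ℝ),
      2 ≤ T →
      RegCB.IsInstance D F fstar pistar →
      RegCB.IsSurpriseBound D F fstar L₁ →
      lam ∈ Ioo (0 : ℝ) 1 →
      δ ∈ Ioo (0 : ℝ) 1 →
      RegCB.IsRadius D F T δ C →
      RegCB.IsOptimisticRun D F T (RegCB.warmStart T L₁ C lam) (RegCB.tolerance T C) P x r a →
      -- the general high-probability bound
      (∀ L₂, RegCB.IsIEC D F fstar lam L₂ →
        1 - δ ≤ P.real {ω | RegCB.regret pistar T x r a ω ≤
          c * (L₁ * C * Real.log T / lam ^ 2 + √(T * L₂ * C) * Real.log T)} ∧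
        (F.Finite → 1 - δ ≤ P.real {ω | RegCB.regret pistar T x r a ω ≤
          c * RegCB.logFactor K T δ ^ p *
            (L₁ * Real.log F.ncard / lam ^ 2 + √(T * L₂ * Real.log F.ncard))})) ∧
      -- under the Massart condition with margin `γ`
      (∀ γ, RegCB.IsMassart fstar pistar γ →
        -- no regret after the warm start if `lam ≤ γ`
        (lam ≤ γ →
          1 - δ ≤ P.real {ω |
            (∀ t ∈ Finset.Icc 1 T, RegCB.epochStart (RegCB.warmStart T L₁ C lam) ≤ t →
              a t ω = pistar (x t ω)) ∧
            RegCB.regret pistar T x r a ω ≤ c * (L₁ * C * Real.log T / lam ^ 2)}) ∧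
        -- bounds in expectation, for the confidence parameter `1 / T`
        (δ = 1 / T →
          Integrable (RegCB.regret pistar T x r a) P ∧
          (lam ≤ γ →
            ∫ ω, RegCB.regret pistar T x r a ω ∂P ≤ c * (L₁ * C * Real.log T / lam ^ 2) ∧
            (F.Finite → ∫ ω, RegCB.regret pistar T x r a ω ∂P ≤
              c * RegCB.logFactor K T δ ^ p * (L₁ * Real.log F.ncard / lam ^ 2))) ∧
          (γ < lam → ∀ L₂, RegCB.IsIEC D F fstar lam L₂ →
            ∫ ω, RegCB.regret pistar T x r a ω ∂P ≤
              c * (L₁ * C * Real.log T / lam ^ 2 + L₂ * C * Real.log T ^ 2 / γ) ∧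
            (F.Finite → ∫ ω, RegCB.regret pistar T x r a ω ∂P ≤
              c * RegCB.logFactor K T δ ^ p *
                (L₁ * Real.log F.ncard / lam ^ 2 + L₂ * Real.log F.ncard / γ)))))
  := by
  -- 4800 = 100 · 48: the factor 100 from the bounds in terms of C, and 48 from C ≤ 48 log |F| ·
  -- `logFactor`. Of the three powers of `logFactor`, one comes from C and two from log² T in the
  -- Massart term.
  refine ⟨4800, by norm_num, 3, ?_⟩
  intro X Ω _ _ K T D F fstar pistar P x r a L₁ lam δ C hT hI hL₁ hlam hδ hC hR
  have := hR.prob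
  have hC1 : 1 ≤ C := (RegCB.log_four_div_pos hδ).trans (hC.log_four_div_le hI hT hδ)
  have hL1 := hL₁.one_le hI
  have hlog : 0 ≤ Real.log T := Real.log_natCast_nonneg T
  have hlead : 0 ≤ L₁ * C * Real.log T / lam ^ 2 :=
    le_trans (by norm_num) (RegCB.half_le_leading hT hL1 hC1 hlam)
  have hd : 0 ≤ Real.log (1 / δ) := Real.log_nonneg (by rw [le_div_iff₀ hδ.1]; linarith [hδ.2])
  have hΛ := RegCB.logFactor_ge K hT hδ
  have hΛ1 : 1 ≤ RegCB.logFactor K T δ := by linarith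
  have hlogΛ : Real.log T ≤ RegCB.logFactor K T δ := by linarith
  have hN : 0 ≤ Real.log F.ncard := Real.log_natCast_nonneg _
  have hCN : F.Finite → C ≤ 48 * (Real.log F.ncard * RegCB.logFactor K T δ) := fun hF =>
    (hC.le_finite hF).trans (RegCB.finiteRadius_le hT hδ (hL₁.two_le_ncard hF hI.star_mem))
  have hleadN := fun hF => RegCB.leading_le (T := T) (lam := lam) (by linarith : 0 ≤ L₁) hN hΛ1
    hlogΛ (hCN hF)
  refine ⟨fun L₂ hL₂ => ?_, fun γ hγ => ⟨fun hlγ => ?_, fun hδT => ⟨hR.integrable_regret hI,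
    fun hlγ => ?_, fun _ L₂ hL₂ => ?_⟩⟩⟩
  · have hL2 := hL₂.one_le hI
    have h := hR.one_sub_le_regret_le hT hI hL₁ hlam hδ hC hL₂
    have h0 : 0 ≤ √(T * L₂ * C) * Real.log T := by positivity
    refine ⟨h.trans (measureReal_mono fun ω hω => ?_), fun hF =>
      h.trans (measureReal_mono fun ω hω => ?_)⟩
    · rw [mem_ofPred_eq] at hω ⊢
      linarith
    · rw [mem_ofPred_eq] at hω ⊢
      linarith [hleadN hF, RegCB.sqrt_term_le (by linarith : 0 ≤ L₂) hN hΛ1 hlogΛ (hCN hF)]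
  · refine (hR.one_sub_le_action_eq hT hI hL₁ hlam hδ hC hγ hlγ).trans
      (measureReal_mono fun ω hω => ⟨hω.1, le_trans hω.2 ?_⟩)
    linarith
  · have h := hR.integral_regret_le_of_le_margin hT hI hL₁ hlam hδ hδT hC hγ hlγ
    refine ⟨h.trans (by linarith), fun hF => h.trans ?_⟩
    linarith [hleadN hF]
  · have hL2 := hL₂.one_le hI
    have hγ0 := hγ.1
    have h := hR.integral_regret_le_of_margin_lt hT hI hL₁ hlam hδ hδT hC hγ hL₂
    have h0 : 0 ≤ L₂ * C * Real.log T ^ 2 / γ := by positivity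
    refine ⟨h.trans (by linarith), fun hF => h.trans ?_⟩
    linarith [hleadN hF, RegCB.massart_term_le (by linarith : 0 ≤ L₂) hN hΛ1 hlogΛ (hCN hF)
      hγ0.le]
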